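/- **Proposition 2.2 (weak Poincaré inequality).** Let $(X,\omega)$ be a connected compact Kähler manifold of dimension $n$, and let $E_\alpha$ ($\alpha\in I$) and $B_\beta$ ($\beta\in J$) be finitely many pairwise distinct irreducible smooth hypersurfaces of $X$ whose union has simple normal crossings. Let $b_\beta\in[0,1)$, and fix smooth Hermitian metrics on the line bundles $\mathcal O(E_\alpha)$ and $\mathcal O(B_\beta)$, with canonical sections $\sigma_\alpha$ and $s_\beta$. For $\varepsilon\ge 0$ and a real multi-index $r=(r_\alpha)_{\alpha\in I}$ put $$d\mu_r^{(\varepsilon)}:=\frac{\prod_{\alpha\in I}(\varepsilon^2+|\sigma_\alpha|^2)^{r_\alpha}}{\prod_{\beta\in J}(\varepsilon^2+|s_\beta|^2)^{b_\beta}}\,dV_\omega ,$$ where $dV_\omega$ is the Riemannian volume measure of $\omega$. Let $\varepsilon_0>0$ and let $(g_\varepsilon)_{0\le\varepsilon\le\varepsilon_0}$ be a metric $g_0$ with conic singularities along $\sum_\beta b_\beta B_\beta$ together with an $\varepsilon$-regularization of it, that is: $g_\varepsilon$ is a smooth Riemannian metric on $X$ if $\varepsilon>0$, and on $X\setminus\bigcup_\beta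 B_\beta$ if $\varepsilon=0$, and every point of $X$ has a neighbourhood with centred holomorphic coordinates $(z_1,\dots,z_n)$, in which those $E_\alpha$ and $B_\beta$ that meet it are distinct coordinate hyperplanes, such that on this neighbourhood $g_\varepsilon$ is quasi-isometric, with constants independent of $\varepsilon\in[0,\varepsilon_0]$, to the model metric $$\sum_{j}c_j\,|dz_j|^2,\qquad c_j=(\varepsilon^2+|z_j|^2)^{-b_\beta}\ \text{ if } \{z_j=0\} \text{ is } B_\beta,\quad c_j=1\ \text{ otherwise.}$$ Let $q=(q_\alpha)_{\alpha\in I}$ with real $q_\alpha\ge 0$, let $p\ge 1$ be a real number, and let $q_p$ be the multi-index with components $(1-\tfrac p2)q_\alpha$. Then there is a constant $C>0$, independent of $\varepsilon$ and $f$, such that for every $\varepsilon\in[0,\varepsilon_0]$ and every smooth (real- or complex-valued) function $f$ on $X$ $$\int_X|f-\mathrm{VM}_\mu(f)|^p\,d\mu_q^{(\varepsilon)}\le C\int_X|\nabla_\varepsilon f|^p\,d\mu_{q_p}^{(\varepsilon)},\qquad \mathrm{VM}_\mu(f):=\frac{1}{\mu_q^{(\varepsilon)}(X)}\int_X f\,d\mu_q^{(\varepsilon)},$$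 where $\nabla_\varepsilon f$ is the gradient of $f$ with respect to $g_\varepsilon$ and $|\nabla_\varepsilon f|$ its length with respect to $g_\varepsilon$ (for complex-valued $f$, $|\nabla_\varepsilon f|^2=|\nabla_\varepsilon\operatorname{Re}f|^2+|\nabla_\varepsilon\operatorname{Im}f|^2$); the right-hand side may be $+\infty$ when $\varepsilon=0$ and $p>2$. -/

import Mathlib

open Set Filter Topology MeasureTheory Bundle
open scoped Manifold ContDiff ENNReal

noncomputable section

namespace WeakPoincare

/-! `n`-dimensional complex manifolds are modelled on `Fin n → ℂ` (only the differentiable structure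
of the model is used). Complex derivatives are taken with respect to `𝓘(ℂ, Fin n → ℂ)`, real ones
with respect to `𝓘(ℝ, Fin n → ℂ)`. -/

/-- A complex manifold is a smooth real manifold. -/
instance instIsManifoldReal {n : ℕ} {X : Type*} [TopologicalSpace X]
    [ChartedSpace (Fin n → ℂ) X] [IsManifold 𝓘(ℂ, Fin n → ℂ) ω X] :
    IsManifold 𝓘(ℝ, Fin n → ℂ) ∞ X := by
  refine isManifold_of_contDiffOn _ _ _ fun e e' he he' => ?_
  have h := ((contDiffGroupoid ω 𝓘(ℂ, Fin n → ℂ)).compatible he he')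
  have h2 := (contDiffGroupoid_le (I := 𝓘(ℂ, Fin n → ℂ)) (m := ∞) (n := ω) (by simp) h)
  have h3 := (mem_groupoid_of_pregroupoid.1 h2).1
  exact ContDiffOn.restrict_scalars ℝ h3

variable {n : ℕ} {X : Type*} [TopologicalSpace X] [ChartedSpace (Fin n → ℂ) X]

variable (n) in
/-- The real tangent space of `X` at `x`. -/
abbrev RealTangent (x : X) : Type := TangentSpace 𝓘(ℝ, Fin n → ℂ) x

variable (n X) in
/-- A choice of a real bilinear form on every (real) tangent space of `X`. -/
abbrev BilinField : Type _ := ∀ x : X, RealTangent n x →L[ℝ] RealTangent n x →L[ℝ] ℝ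

variable (n X) in
/-- Smooth Riemannian metrics on the real manifold underlying `X`. -/
abbrev SmoothMetric [IsManifold 𝓘(ℂ, Fin n → ℂ) ω X] : Type _ :=
  ContMDiffRiemannianMetric 𝓘(ℝ, Fin n → ℂ) ∞ (Fin n → ℂ) (fun x : X => RealTangent n x)

/-- The expression of a field of bilinear forms in a chart `φ`, at the point `z` of the target:
the pull-back of `g` by `φ⁻¹`. -/
def inChart (g : BilinField n X) (φ : OpenPartialHomeomorph X (Fin n → ℂ))
    (z u v : Fin n → ℂ) : ℝ :=
  g (φ.symm z) (mfderiv 𝓘(ℝ, Fin n → ℂ) 𝓘(ℝ, Fin n → ℂ) φ.symm z u)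
    (mfderiv 𝓘(ℝ, Fin n → ℂ) 𝓘(ℝ, Fin n → ℂ) φ.symm z v)

/-- A Riemannian metric `G` on a complex manifold is Kähler if the complex structure is isometric
and the real 2-form `Ω(u, v) = G(Ju, v)` is closed. Both conditions are expressed in the holomorphic
charts, where `J` is the multiplication by `Complex.I`, and where
`dΩ(u, v, w) = D_u Ω(v, w) + D_v Ω(w, u) + D_w Ω(u, v)` for constant `u, v, w`. -/
structure IsKahler [IsManifold 𝓘(ℂ, Fin n → ℂ) ω X] (G : SmoothMetric n X) : Prop where
  hermitian : ∀ φ ∈ atlas (Fin n → ℂ) X, ∀ z ∈ φ.target, ∀ u v : Fin n → ℂ,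
    inChart G.inner φ z (Complex.I • u) (Complex.I • v) = inChart G.inner φ z u v
  closed : ∀ φ ∈ atlas (Fin n → ℂ) X, ∀ z ∈ φ.target, ∀ u v w : Fin n → ℂ,
    fderiv ℝ (fun z' => inChart G.inner φ z' (Complex.I • v) w) z u
      + fderiv ℝ (fun z' => inChart G.inner φ z' (Complex.I • w) u) z v
      + fderiv ℝ (fun z' => inChart G.inner φ z' (Complex.I • u) v) z w = 0

/-- The real basis `∂/∂x_j, ∂/∂y_j` of `ℂⁿ`, where `z_j = x_j + i y_j`. -/
def realBasis (a : Fin n × Fin 2) : Fin n → ℂ :=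
  Pi.single a.1 (if a.2 = 0 then 1 else Complex.I)

/-- The Riemannian volume density `√(det g_{ab})` in a chart. -/
def chartDensity (g : BilinField n X) (φ : OpenPartialHomeomorph X (Fin n → ℂ))
    (z : Fin n → ℂ) : ℝ :=
  √(Matrix.det (Matrix.of fun a b : Fin n × Fin 2 => inChart g φ z (realBasis a) (realBasis b)))

/-- The part carried by the domain of `φ` of the Riemannian volume measure: the image under `φ⁻¹`
of the measure `√(det g_{ab}) dλ` on the target of `φ`, with `λ` the Lebesgue measure. -/
def chartVolume [MeasurableSpace X] (g : BilinField n X)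
    (φ : OpenPartialHomeomorph X (Fin n → ℂ)) : Measure X :=
  Measure.map φ.symm
    ((volume.withDensity fun z => ENNReal.ofReal (chartDensity g φ z)).restrict φ.target)

/-- The Riemannian volume measure `dV_g`: the least measure that dominates its part in each of the
charts of the atlas. By the change of variables formula these parts agree on the overlaps, so that
the restriction of `dV_g` to the domain of each chart `φ` is `chartVolume g φ`. -/
def riemannianVolume [MeasurableSpace X] (g : BilinField n X) : Measure X :=
  ⨆ φ ∈ atlas (Fin n → ℂ) X, chartVolume g φ

/-- The gradient of a real function `u` with respect to `g`: the tangent vector `w` with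
`g(w, v) = du(v)` for all `v`. -/
def metricGradient (g : BilinField n X) (u : X → ℝ) (x : X) : RealTangent n x :=
  Classical.epsilon fun w : RealTangent n x =>
    ∀ v : RealTangent n x, g x w v = (mfderiv 𝓘(ℝ, Fin n → ℂ) 𝓘(ℝ, ℝ) u x v : ℝ)

/-- The length `|∇f|_g` of the gradient of a complex-valued function:
`|∇f|² = |∇ Re f|² + |∇ Im f|²`. For a real-valued `f` this is the usual length. -/
def gradNorm (g : BilinField n X) (f : X → ℂ) (x : X) : ℝ :=
  √(g x (metricGradient g (fun y => (f y).re) x) (metricGradient g (fun y => (f y).re) x)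
    + g x (metricGradient g (fun y => (f y).im) x) (metricGradient g (fun y => (f y).im) x))

/-- `φ` is a holomorphic chart centred at `x` in which each member `D i` of the family either is
absent (`κ i = none`) or is the coordinate hyperplane `z_j = 0` (`κ i = some j`), different members
being different hyperplanes. -/
structure IsAdaptedChart {ι : Type*} (D : ι → Set X) (x : X)
    (φ : OpenPartialHomeomorph X (Fin n → ℂ)) (κ : ι → Option (Fin n)) : Prop where
  mem_maximalAtlas : φ ∈ IsManifold.maximalAtlas 𝓘(ℂ, Fin n → ℂ) ω X
  mem_source : x ∈ φ.source
  centred : φ x = 0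
  injective : ∀ i i' j, κ i = some j → κ i' = some j → i = i'
  hyperplane : ∀ i j, κ i = some j → ∀ y ∈ φ.source, y ∈ D i ↔ φ y j = 0
  absent : ∀ i, κ i = none → ∀ y ∈ φ.source, y ∉ D i

variable (n) in
/-- The `D i` are the (pairwise different, irreducible) components of a divisor with simple normal
crossing support. -/
structure IsSNC {ι : Type*} (D : ι → Set X) : Prop where
  connected : ∀ i, IsConnected (D i)
  exists_chart : ∀ x : X, ∃ (φ : OpenPartialHomeomorph X (Fin n → ℂ)) (κ : ι → Option (Fin n)),
    IsAdaptedChart D x φ κ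

variable (n) in
/-- A local holomorphic equation, vanishing to first order, of a smooth hypersurface `D`. -/
structure LocalEquation (D : Set X) where
  U : Set X
  isOpen : IsOpen U
  s : X → ℂ
  holomorphic : ContMDiffOn 𝓘(ℂ, Fin n → ℂ) 𝓘(ℂ, ℂ) ω s U
  zero_iff : ∀ x ∈ U, s x = 0 ↔ x ∈ D
  reduced : ∀ x ∈ U, x ∈ D → mfderiv 𝓘(ℂ, Fin n → ℂ) 𝓘(ℂ, ℂ) s x ≠ 0

variable (n) in
/-- A smooth Hermitian metric `h` on the line bundle `𝒪(D)`. A local equation `s` of `D` over `U`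
gives the holomorphic frame `1/s` of `𝒪(D)` over `U`; the metric is given by the squared lengths
`weight = |1/s|²_h` of all these frames, which are smooth and positive, and which transform by
`|1/s|²_h = |s'/s|² |1/s'|²_h` (stated on the overlap as `weight · |s|² = weight' · |s'|²`, which
determines one weight from the other, by density of the complement of `D`). -/
structure HermitianMetric (D : Set X) where
  weight : LocalEquation n D → X → ℝ
  smooth : ∀ e, ContMDiffOn 𝓘(ℝ, Fin n → ℂ) 𝓘(ℝ, ℝ) ∞ (weight e) e.U
  pos : ∀ e, ∀ x ∈ e.U, 0 < weight e x
  compat : ∀ e e', ∀ x ∈ e.U ∩ e'.U, weight e x * ‖e.s x‖ ^ 2 = weight e' x * ‖e'.s x‖ ^ 2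

open Classical in
/-- The squared length `|σ|²_h` of the canonical section `σ` of `𝒪(D)`. As `σ = s · (1/s)`, it is
`|s|² |1/s|²_h` for any local equation `s` of `D` around the point. -/
def HermitianMetric.normSq {D : Set X} (h : HermitianMetric n D) (x : X) : ℝ :=
  if H : ∃ e : LocalEquation n D, x ∈ e.U then h.weight H.choose x * ‖H.choose.s x‖ ^ 2 else 0

/-- The value `|σ|²_h` does not depend on the choice of the local equation. -/
theorem HermitianMetric.normSq_eq {D : Set X} (h : HermitianMetric n D) (e : LocalEquation n D)
    {x : X} (hx : x ∈ e.U) : h.normSq x = h.weight e x * ‖e.s x‖ ^ 2 := by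
  have H : ∃ e : LocalEquation n D, x ∈ e.U := ⟨e, hx⟩
  rw [HermitianMetric.normSq, dif_pos H]
  exact h.compat _ _ x ⟨H.choose_spec, hx⟩

/-- The measure
`∏_α (ε² + |σ_α|²)^{q_α} / ∏_β (ε² + |s_β|²)^{b_β} dV_G`. -/
def weightedVolume [MeasurableSpace X] {I J : Type*} [Fintype I] [Fintype J]
    {E : I → Set X} {B : J → Set X} (G : BilinField n X)
    (hE : ∀ α, HermitianMetric n (E α)) (hB : ∀ β, HermitianMetric n (B β))
    (b : J → ℝ) (q : I → ℝ) (ε : ℝ) : Measure X :=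
  (riemannianVolume G).withDensity fun x => ENNReal.ofReal
    ((∏ α, (ε ^ 2 + (hE α).normSq x) ^ q α) / ∏ β, (ε ^ 2 + (hB β).normSq x) ^ b β)

/-- The multi-index `q_p`, with components `(1 - p/2) q_α`. -/
def scaledIndex {I : Type*} (q : I → ℝ) (p : ℝ) : I → ℝ := fun α => (1 - p / 2) * q α

/-- The coefficient of `|dz_j|²` in the model conic metric: `(ε² + |z_j|²)^{-b_β}` if the `j`-th
coordinate hyperplane is `B β`, and `1` if it is none of the `B β`. -/
def modelCoeff {I J : Type*} [Fintype J] (b : J → ℝ) (κ : I ⊕ J → Option (Fin n)) (ε : ℝ)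
    (z : Fin n → ℂ) (j : Fin n) : ℝ :=
  ∏ β, if κ (Sum.inr β) = some j then (ε ^ 2 + ‖z j‖ ^ 2) ^ (-b β) else 1

/-- The model conic metric `∑_j (coefficient) |dz_j|²`, evaluated on `(v, v)` at the point `z`. -/
def modelMetric {I J : Type*} [Fintype J] (b : J → ℝ) (κ : I ⊕ J → Option (Fin n)) (ε : ℝ)
    (z v : Fin n → ℂ) : ℝ :=
  ∑ j, modelCoeff b κ ε z j * ‖v j‖ ^ 2

/-- The set on which the `ε`-regularized conic metric is defined: all of `X` for `ε ≠ 0`, the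
complement of the support of the divisor for `ε = 0`. -/
def regularSet {J : Type*} (B : J → Set X) (ε : ℝ) : Set X := {x | ε ≠ 0 ∨ ∀ β, x ∉ B β}

/-- `g 0` is a Riemannian metric with conic singularities along `∑ b_β B_β` and `(g ε)`,
`0 < ε ≤ ε₀`, is an `ε`-regularization of it: the `g ε` are smooth Riemannian metrics (outside of
the support of `B` if `ε = 0`) which, in suitable holomorphic coordinates adapted to the divisors
near any given point, are quasi-isometric to the model metric
`∑_β |dz_β|² / (ε² + |z_β|²)^{b_β} + ∑ |dz_j|²`, uniformly with respect to `ε`. -/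
structure IsConicRegularization [IsManifold 𝓘(ℂ, Fin n → ℂ) ω X] {I J : Type*} [Fintype J]
    (E : I → Set X) (B : J → Set X) (b : J → ℝ) (ε₀ : ℝ) (g : ℝ → BilinField n X) : Prop where
  symm : ∀ ε ∈ Icc 0 ε₀, ∀ x ∈ regularSet B ε, ∀ v w : RealTangent n x, g ε x v w = g ε x w v
  pos : ∀ ε ∈ Icc 0 ε₀, ∀ x ∈ regularSet B ε, ∀ v : RealTangent n x, v ≠ 0 → 0 < g ε x v v
  smooth : ∀ ε ∈ Icc 0 ε₀,
    ContMDiffOn 𝓘(ℝ, Fin n → ℂ)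
      (𝓘(ℝ, Fin n → ℂ).prod 𝓘(ℝ, (Fin n → ℂ) →L[ℝ] (Fin n → ℂ) →L[ℝ] ℝ)) ∞
      (fun x => TotalSpace.mk' ((Fin n → ℂ) →L[ℝ] (Fin n → ℂ) →L[ℝ] ℝ)
        (E := fun x : X => RealTangent n x →L[ℝ] RealTangent n x →L[ℝ] ℝ) x (g ε x))
      (regularSet B ε)
  quasiIsometric : ∀ x₀ : X,
    ∃ (φ : OpenPartialHomeomorph X (Fin n → ℂ)) (κ : I ⊕ J → Option (Fin n)),
      IsAdaptedChart (Sum.elim E B) x₀ φ κ ∧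
      ∃ V ∈ 𝓝 x₀, V ⊆ φ.source ∧ ∃ A : ℝ, 0 < A ∧
        ∀ ε ∈ Icc 0 ε₀, ∀ y ∈ V ∩ regularSet B ε, ∀ v : RealTangent n y,
          A⁻¹ * modelMetric b κ ε (φ y)
              (mfderiv 𝓘(ℝ, Fin n → ℂ) 𝓘(ℝ, Fin n → ℂ) φ y v) ≤ g ε y v v ∧
          g ε y v v ≤ A * modelMetric b κ ε (φ y)
              (mfderiv 𝓘(ℝ, Fin n → ℂ) 𝓘(ℝ, Fin n → ℂ) φ y v)

end WeakPoincare

end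

/-!
The average is removed at the very end: by Jensen's inequality it is enough to bound the oscillation
integral `∬ |f x - f y|^p dμ dμ` over `X × X`, where `μ` is the measure with the index `q`.

*Globalization.* Given bounds for these integrals over products `U × U` of small open sets, an
intermediate open set `O`, whose measure is bounded from below uniformly in `ε`, allows one to pass
from `U × O` and `O × W` to `U × W` (`OscControlled.trans`). As `X` is connected, any two points
have neighbourhoods `U`, `W` with a bound over `U × W`, and compactness gives `X × X`
(`oscControlled_univ`, `average_le_of_oscControlled`).

*Localization.* In an adapted chart `μ` is comparable, uniformly in `ε`, to the product measure
`∏ (ε² + |z_k|²)^{a_k} dλ` on a polydisc, with `a_k = q_α` or `a_k = -b_β` or `a_k = 0`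
(`exists_weightedVolume_comparable`). The decisive point is that all `a_k > -1`. The Poincaré
inequality for a product measure follows from those of its factors
(`lintegral_lintegral_pi_le`), so that one is left with the disc.

*The disc.* For `a > -1` the Poincaré inequality for the weight `(ε² + |z|²)^a` holds with the
gradient taken with respect to the conical metric `(ε² + |z|²)^a |dz|²`, that is, with the factor
`(ε² + |z|²)^{-pa/2}` on the right hand side, and with a constant independent of `ε`
(`exists_disc_poincare`). Two points are joined along a ray, where Hölder's inequality is applied
with the arclength of the conical metric as density, and along a circle, whose conical length is
bounded.

*The gradient.* Along a coordinate `z_k` that cuts out a `B_β`, the factor above is exactly what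
turns the Euclidean derivative into the conical one. Along a coordinate that cuts out an `E_α`
the metric is Euclidean, and the factor lowers the exponent from `q_α` to `(1 - p/2) q_α`, as in
`q_p`; the other coordinates only contribute bounded factors, because `q_α ≥ 0`
(`rpow_mul_prod_chartExponent_le`, `exists_lintegral_partialFDeriv_le`).
-/

noncomputable section

namespace WeakPoincare

/-! ### Power means -/

/-- Jensen's inequality for a finite measure that is not normalized. -/
theorem rpow_lintegral_le {α : Type*} [MeasurableSpace α] (μ : Measure α) {f : α → ℝ≥0∞}
    (hf : AEMeasurable f μ) {p : ℝ} (hp : 1 ≤ p) :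
    (∫⁻ x, f x ∂μ) ^ p ≤ μ univ ^ (p - 1) * ∫⁻ x, f x ^ p ∂μ := by
  have hp0 : 0 < p := by linarith
  have h := eLpNorm_le_eLpNorm_mul_rpow_measure_univ (μ := μ) (f := f) (p := 1)
    (q := ENNReal.ofReal p) (by simpa using hp) hf.aestronglyMeasurable
  rw [eLpNorm_one_eq_lintegral_enorm, eLpNorm_eq_lintegral_rpow_enorm_toReal
    (by simpa using hp0) (by simp)] at h
  simp only [enorm_eq_self, ENNReal.toReal_ofReal hp0.le, ENNReal.toReal_one] at h
  calc (∫⁻ x, f x ∂μ) ^ p ≤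
      ((∫⁻ x, f x ^ p ∂μ) ^ (1 / p) * μ univ ^ (1 / 1 - 1 / p)) ^ p := by gcongr
    _ = _ := by
      rw [ENNReal.mul_rpow_of_nonneg _ _ hp0.le, ← ENNReal.rpow_mul, ← ENNReal.rpow_mul, mul_comm]
      congr 2 <;> field_simp
      simp

/-- Hölder's inequality with respect to an auxiliary density `k`. -/
theorem rpow_lintegral_le_of_density {α : Type*} [MeasurableSpace α] (μ : Measure α)
    {f : α → ℝ≥0∞} (hf : Measurable f) {k : α → ℝ} (hk : Measurable k) (hk0 : ∀ᵐ x ∂μ, 0 < k x)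
    {p : ℝ} (hp : 1 ≤ p) :
    (∫⁻ x, f x ∂μ) ^ p ≤ (∫⁻ x, ENNReal.ofReal (k x) ∂μ) ^ (p - 1) *
      ∫⁻ x, f x ^ p * ENNReal.ofReal (k x ^ (1 - p)) ∂μ := by
  have hK : Measurable fun x => ENNReal.ofReal (k x) := hk.ennreal_ofReal
  have h := rpow_lintegral_le (μ.withDensity fun x => ENNReal.ofReal (k x))
    (f := fun x => f x * ENNReal.ofReal ((k x)⁻¹)) (by fun_prop) hp
  rw [lintegral_withDensity_eq_lintegral_mul _ hK (by fun_prop),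
    lintegral_withDensity_eq_lintegral_mul _ hK (by fun_prop),
    withDensity_apply _ MeasurableSet.univ, Measure.restrict_univ] at h
  have e1 : ∫⁻ x, f x ∂μ = ∫⁻ x, ((fun x => ENNReal.ofReal (k x)) *
      fun x => f x * ENNReal.ofReal ((k x)⁻¹)) x ∂μ := by
    refine lintegral_congr_ae ?_
    filter_upwards [hk0] with x hx
    simp only [Pi.mul_apply]
    rw [mul_left_comm, ← ENNReal.ofReal_mul (by positivity), mul_inv_cancel₀ hx.ne']
    simp
  have e2 : ∫⁻ x, f x ^ p * ENNReal.ofReal (k x ^ (1 - p)) ∂μ =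
      ∫⁻ x, ((fun x => ENNReal.ofReal (k x)) *
        fun x => (f x * ENNReal.ofReal ((k x)⁻¹)) ^ p) x ∂μ := by
    refine lintegral_congr_ae ?_
    filter_upwards [hk0] with x hx
    simp only [Pi.mul_apply]
    rw [ENNReal.mul_rpow_of_nonneg _ _ (by linarith),
      ENNReal.ofReal_rpow_of_pos (by positivity), mul_left_comm, ← ENNReal.ofReal_mul hx.le]
    congr 2
    rw [Real.rpow_sub hx, Real.rpow_one, Real.inv_rpow hx.le, div_eq_mul_inv]
  rwa [e1, e2]

theorem enorm_sub_rpow_le {E : Type*} [NormedAddCommGroup E] {p : ℝ} (hp : 1 ≤ p) (a b c : E) :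
    ‖a - c‖ₑ ^ p ≤ 2 ^ (p - 1) * (‖a - b‖ₑ ^ p + ‖b - c‖ₑ ^ p) := by
  refine le_trans ?_ (ENNReal.rpow_add_le_mul_rpow_add_rpow _ _ hp)
  gcongr
  rw [← sub_add_sub_cancel a b c]
  exact enorm_add_le _ _

theorem enorm_sub_le_lintegral_uIoc {H H' : ℝ → ℂ} {r s : ℝ}
    (hH : ∀ t, HasDerivAt H (H' t) t) (hc : Continuous H') {m : ℝ → ℝ≥0∞}
    (hm : ∀ t ∈ uIoc s r, ‖H' t‖ₑ ≤ m t) : ‖H r - H s‖ₑ ≤ ∫⁻ t in uIoc s r, m t := by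
  rw [← intervalIntegral.integral_eq_sub_of_hasDerivAt (fun t _ => hH t)
    (hc.intervalIntegrable _ _)]
  have : ‖∫ t in s..r, H' t‖ₑ = ‖∫ t in uIoc s r, H' t‖ₑ := by
    rw [← ofReal_norm, ← ofReal_norm,
      intervalIntegral.norm_intervalIntegral_eq]
  rw [this]
  exact (enorm_integral_le_lintegral_enorm _).trans
    (setLIntegral_mono_ae' measurableSet_uIoc (ae_of_all _ hm))

/-! ### Powers of `ε² + t²` -/

theorem rpow_le_add_rpow {c x C : ℝ} (hc : 0 < c) (hcx : c ≤ x) (hxC : x ≤ C) (e : ℝ) :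
    x ^ e ≤ c ^ e + C ^ e := by
  have hx : 0 < x := hc.trans_le hcx
  have hC : 0 < C := hx.trans_le hxC
  rcases le_total 0 e with he | he
  · have := Real.rpow_le_rpow hx.le hxC he
    have := Real.rpow_pos_of_pos hc e
    linarith
  · have := Real.rpow_le_rpow_of_nonpos hc hcx he
    have := Real.rpow_pos_of_pos hC e
    linarith

/-- The weight `(ε² + s²)^e` at a smaller radius is bounded by the weight at `t`, up to a power of
`s / t` that does not depend on `ε`. -/
theorem regularized_rpow_le {ε s t : ℝ} (hs : 0 < s) (hst : s ≤ t) (e : ℝ) :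
    (ε ^ 2 + s ^ 2) ^ e ≤ (ε ^ 2 + t ^ 2) ^ e * (s / t) ^ (2 * min e 0) := by
  have ht : 0 < t := hs.trans_le hst
  rcases le_total 0 e with he | he
  · rw [min_eq_right he]
    simp only [mul_zero, Real.rpow_zero, mul_one]
    gcongr
  · rw [min_eq_left he, Real.rpow_mul (by positivity), Real.rpow_two,
      ← Real.mul_rpow (by positivity) (by positivity)]
    refine Real.rpow_le_rpow_of_nonpos (by positivity) ?_ he
    rw [div_pow, mul_div_assoc', div_le_iff₀ (by positivity)]
    have : s ^ 2 ≤ t ^ 2 := by gcongr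
    nlinarith [mul_nonneg (sq_nonneg ε) (sub_nonneg.2 this)]

theorem lintegral_Ioo_rpow {t e : ℝ} (ht : 0 < t) (he : -1 < e) :
    ∫⁻ s in Ioo 0 t, ENNReal.ofReal ((s / t) ^ e) = ENNReal.ofReal (t / (e + 1)) := by
  have hi : IntervalIntegrable (fun s : ℝ => s ^ e) volume 0 t :=
    intervalIntegral.intervalIntegrable_rpow' he
  have hi' : IntegrableOn (fun s : ℝ => (s / t) ^ e) (Ioo 0 t) := by
    have := ((intervalIntegrable_iff_integrableOn_Ioo_of_le ht.le).1 hi).mul_const ((t ^ e)⁻¹)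
    refine IntegrableOn.congr_fun this (fun s hs => ?_) measurableSet_Ioo
    rw [Real.div_rpow hs.1.le ht.le, div_eq_mul_inv]
  rw [← ofReal_integral_eq_lintegral_ofReal hi']
  · congr 1
    have h1 : ∫ s in Ioo 0 t, (s / t) ^ e = ∫ s in (0 : ℝ)..t, s ^ e * (t ^ e)⁻¹ := by
      rw [intervalIntegral.integral_of_le ht.le, integral_Ioc_eq_integral_Ioo]
      refine setIntegral_congr_fun measurableSet_Ioo (fun s hs => ?_)
      rw [Real.div_rpow hs.1.le ht.le, div_eq_mul_inv]
    rw [h1, intervalIntegral.integral_mul_const, integral_rpow (Or.inl he),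
      Real.zero_rpow (by linarith), Real.rpow_add ht, Real.rpow_one]
    have : t ^ e ≠ 0 := (Real.rpow_pos_of_pos ht e).ne'
    field_simp
    simp
  · refine (ae_restrict_iff' measurableSet_Ioo).2 (ae_of_all _ fun s hs => ?_)
    exact Real.rpow_nonneg (div_nonneg hs.1.le ht.le) _

/-- The radial part `(ε² + r²)^a r dr`, on `(0, R)`, of the measure `(ε² + |z|²)^a dλ`. -/
def radialMeasure (ε a R : ℝ) : Measure ℝ :=
  (volume.restrict (Ioo 0 R)).withDensity fun r => ENNReal.ofReal ((ε ^ 2 + r ^ 2) ^ a * r)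

theorem lintegral_radialMeasure (ε a R : ℝ) {k : ℝ → ℝ≥0∞} (hk : Measurable k) :
    ∫⁻ r, k r ∂radialMeasure ε a R =
      ∫⁻ r in Ioo 0 R, ENNReal.ofReal ((ε ^ 2 + r ^ 2) ^ a * r) * k r := by
  rw [radialMeasure, lintegral_withDensity_eq_lintegral_mul _ (by fun_prop) hk]
  rfl

/-- The mass below the radius `t` is at most a multiple of `t` times the density at `t`. -/
theorem radialMeasure_Iio_le {ε a R t : ℝ} (ha : -1 < a) (ht : 0 < t) :
    radialMeasure ε a R (Iio t) ≤
      ENNReal.ofReal ((ε ^ 2 + t ^ 2) ^ a * t ^ 2 / (2 * min a 0 + 2)) := by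
  have hm : -1 < min a 0 := by simp [ha]
  rw [radialMeasure, withDensity_apply _ measurableSet_Iio,
    Measure.restrict_restrict measurableSet_Iio]
  calc ∫⁻ r in Iio t ∩ Ioo 0 R, ENNReal.ofReal ((ε ^ 2 + r ^ 2) ^ a * r)
      ≤ ∫⁻ r in Ioo 0 t, ENNReal.ofReal ((ε ^ 2 + r ^ 2) ^ a * r) :=
        lintegral_mono_set fun r hr => ⟨hr.2.1, hr.1⟩
    _ ≤ ∫⁻ r in Ioo 0 t, ENNReal.ofReal ((ε ^ 2 + t ^ 2) ^ a * t) *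
          ENNReal.ofReal ((r / t) ^ (2 * min a 0 + 1)) := by
        refine setLIntegral_mono_ae' measurableSet_Ioo (ae_of_all _ fun r hr => ?_)
        rw [← ENNReal.ofReal_mul (by positivity)]
        refine ENNReal.ofReal_le_ofReal ?_
        have := regularized_rpow_le (ε := ε) hr.1 hr.2.le a
        rw [Real.rpow_add (div_pos hr.1 ht), Real.rpow_one]
        calc (ε ^ 2 + r ^ 2) ^ a * r
            ≤ (ε ^ 2 + t ^ 2) ^ a * (r / t) ^ (2 * min a 0) * r := by gcongr; exact hr.1.le
          _ = _ := by field_simp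
    _ = _ := by
        rw [lintegral_const_mul _ (by fun_prop), lintegral_Ioo_rpow ht (by linarith),
          ← ENNReal.ofReal_mul (by positivity)]
        congr 1
        rw [show 2 * min a 0 + 1 + 1 = 2 * min a 0 + 2 by ring]
        ring

/-- A bound for `(ε² + R²)^e`, whatever the sign of `e`, which is uniform in `ε ∈ [0, ε₀]`. -/
def endBound (ε₀ R e : ℝ) : ℝ := (R ^ 2) ^ e + (ε₀ ^ 2 + R ^ 2) ^ e

theorem endBound_nonneg {ε₀ R : ℝ} (e : ℝ) : 0 ≤ endBound ε₀ R e := by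
  unfold endBound; positivity

theorem rpow_le_endBound {ε₀ R ε : ℝ} (hR : 0 < R) (hε : ε ∈ Icc 0 ε₀) (e : ℝ) :
    (ε ^ 2 + R ^ 2) ^ e ≤ endBound ε₀ R e := by
  refine rpow_le_add_rpow (by positivity) (by nlinarith [sq_nonneg ε]) ?_ e
  have := hε.1
  have := hε.2
  gcongr

theorem rpow_le_endBound_of_nonneg {ε₀ R ε t : ℝ} (hε : ε ∈ Icc 0 ε₀) (ht : 0 ≤ t)
    (htR : t ≤ R) {e : ℝ} (he : 0 ≤ e) : (ε ^ 2 + t ^ 2) ^ e ≤ endBound ε₀ R e := by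
  have h0 := hε.1
  have h1 := hε.2
  have : (ε ^ 2 + t ^ 2) ^ e ≤ (ε₀ ^ 2 + R ^ 2) ^ e := by gcongr
  have h2 : 0 ≤ (R ^ 2) ^ e := by positivity
  unfold endBound
  linarith

theorem radialMeasure_univ_le {ε₀ ε a R : ℝ} (ha : -1 < a) (hR : 0 < R) (hε : ε ∈ Icc 0 ε₀) :
    radialMeasure ε a R univ ≤
      ENNReal.ofReal (endBound ε₀ R a * R ^ 2 / (2 * min a 0 + 2)) := by
  have hm : -1 < min a 0 := by simp [ha]
  have h : radialMeasure ε a R univ ≤ radialMeasure ε a R (Iio R) := by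
    have h0 : radialMeasure ε a R (Ioo 0 R)ᶜ = 0 :=
      (withDensity_absolutelyContinuous _ _) (by simp)
    calc radialMeasure ε a R univ ≤ radialMeasure ε a R (Iio R ∪ (Ioo 0 R)ᶜ) :=
          measure_mono fun r _ => by
            by_cases h : r ∈ Ioo 0 R
            · exact Or.inl h.2
            · exact Or.inr h
      _ ≤ _ := (measure_union_le _ _).trans (by rw [h0, add_zero])
  refine h.trans ((radialMeasure_Iio_le ha hR).trans (ENNReal.ofReal_le_ofReal ?_))
  have := rpow_le_endBound hR hε a
  have : 0 < 2 * min a 0 + 2 := by linarith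
  gcongr

/-- The length of the radius of the cone is bounded uniformly in `ε`. -/
theorem lintegral_sqrt_weight_le {ε₀ ε a R : ℝ} (ha : -1 < a) (hR : 0 < R) (hε : ε ∈ Icc 0 ε₀) :
    ∫⁻ t in Ioo 0 R, ENNReal.ofReal ((ε ^ 2 + t ^ 2) ^ (a / 2)) ≤
      ENNReal.ofReal (endBound ε₀ R (a / 2) * (R / (2 * min (a / 2) 0 + 1))) := by
  have hm : -1 < 2 * min (a / 2) 0 := by
    rcases le_total (a / 2) 0 with h | h <;> simp [h]; linarith
  calc ∫⁻ t in Ioo 0 R, ENNReal.ofReal ((ε ^ 2 + t ^ 2) ^ (a / 2))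
      ≤ ∫⁻ t in Ioo 0 R, ENNReal.ofReal (endBound ε₀ R (a / 2)) *
          ENNReal.ofReal ((t / R) ^ (2 * min (a / 2) 0)) := by
        refine setLIntegral_mono_ae' measurableSet_Ioo (ae_of_all _ fun t ht => ?_)
        rw [← ENNReal.ofReal_mul (endBound_nonneg _)]
        refine ENNReal.ofReal_le_ofReal ?_
        refine (regularized_rpow_le (ε := ε) ht.1 ht.2.le (a / 2)).trans ?_
        have h1 := ht.1
        gcongr
        exact rpow_le_endBound hR hε _
    _ = _ := by
        rw [lintegral_const_mul _ (by fun_prop), lintegral_Ioo_rpow hR hm,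
          ← ENNReal.ofReal_mul (endBound_nonneg _)]

/-! ### The weighted inequality on a disc -/

instance (ε a R : ℝ) : SFinite (radialMeasure ε a R) := by unfold radialMeasure; infer_instance

theorem ae_radialMeasure_mem (ε a R : ℝ) : ∀ᵐ r ∂radialMeasure ε a R, r ∈ Ioo 0 R :=
  (withDensity_absolutelyContinuous _ _) (ae_restrict_mem measurableSet_Ioo)

/-- The conical length of the circle of radius `t` is bounded. -/
theorem mul_rpow_half_le {ε₀ ε a R t : ℝ} (ha : -1 < a) (hε : ε ∈ Icc 0 ε₀) (ht : t ∈ Ioo 0 R) :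
    t * (ε ^ 2 + t ^ 2) ^ (a / 2) ≤ endBound ε₀ R ((a + 1) / 2) := by
  have ht0 : 0 < t := ht.1
  have hX : 0 < ε ^ 2 + t ^ 2 := by positivity
  have htX : t ≤ (ε ^ 2 + t ^ 2) ^ (1 / 2 : ℝ) := by
    rw [← Real.sqrt_eq_rpow]
    exact Real.le_sqrt_of_sq_le (by nlinarith [sq_nonneg ε])
  calc t * (ε ^ 2 + t ^ 2) ^ (a / 2)
      ≤ (ε ^ 2 + t ^ 2) ^ (1 / 2 : ℝ) * (ε ^ 2 + t ^ 2) ^ (a / 2) := by gcongr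
    _ = (ε ^ 2 + t ^ 2) ^ ((a + 1) / 2) := by rw [← Real.rpow_add hX]; congr 1; ring
    _ ≤ _ := rpow_le_endBound_of_nonneg hε ht0.le ht.2.le (by linarith)

/-- The inequality along the rays of the cone. Hölder's inequality is applied with the arclength
density `(ε² + t²)^{a/2}` of the rays. -/
theorem exists_radial_poincare {p a ε₀ R : ℝ} (hp : 1 ≤ p) (ha : -1 < a) (hR : 0 < R) :
    ∃ C : ℝ≥0∞, C ≠ ⊤ ∧ ∀ ε ∈ Icc 0 ε₀, ∀ (H : ℝ → ℂ) (m : ℝ → ℝ≥0∞), Measurable m →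
      (∀ r s, ‖H r - H s‖ₑ ≤ ∫⁻ t in uIoc s r, m t) →
      ∫⁻ r, ∫⁻ s, ‖H r - H s‖ₑ ^ p ∂radialMeasure ε a R ∂radialMeasure ε a R ≤
        C * ∫⁻ t, m t ^ p * ENNReal.ofReal ((ε ^ 2 + t ^ 2) ^ (-(p / 2) * a))
          ∂radialMeasure ε a R := by
  set K : ℝ≥0∞ := ENNReal.ofReal (endBound ε₀ R (a / 2) * (R / (2 * min (a / 2) 0 + 1))) with hK
  set L : ℝ≥0∞ := ENNReal.ofReal (endBound ε₀ R a * R ^ 2 / (2 * min a 0 + 2)) with hL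
  set N : ℝ≥0∞ := ENNReal.ofReal (endBound ε₀ R ((a + 1) / 2) / (2 * min a 0 + 2)) with hN
  have hm0 : 0 < 2 * min a 0 + 2 := by
    have : -1 < min a 0 := by simp [ha]
    linarith
  refine ⟨K ^ (p - 1) * (2 * L * N), ?_, fun ε hε H m hm hH => ?_⟩
  · refine ENNReal.mul_ne_top (ENNReal.rpow_ne_top_of_nonneg (by linarith) ENNReal.ofReal_ne_top)
      (ENNReal.mul_ne_top (ENNReal.mul_ne_top (by simp) ENNReal.ofReal_ne_top)
        ENNReal.ofReal_ne_top)
  set ρ := radialMeasure ε a R with hρ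
  set M : ℝ → ℝ≥0∞ := fun t => m t ^ p * ENNReal.ofReal (((ε ^ 2 + t ^ 2) ^ (a / 2)) ^ (1 - p))
  have hM : Measurable M := by fun_prop
  -- A pair `(r, s)` of radii with `t` between them has one member below `t`; hence the factor
  -- `ρ (Iio t)`, which compensates the weight of the arclength density.
  set B : ℝ≥0∞ := ∫⁻ t in Ioo 0 R, M t * ρ (Iio t) with hB
  have hpt : ∀ r ∈ Ioo 0 R, ∀ s ∈ Ioo 0 R, ‖H r - H s‖ₑ ^ p ≤
      K ^ (p - 1) * ((∫⁻ t in Ioo 0 R, (Iio t).indicator (fun _ => M t) r) +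
        ∫⁻ t in Ioo 0 R, (Iio t).indicator (fun _ => M t) s) := by
    intro r hr s hs
    have hsub : uIoc s r ⊆ Ioo 0 R := by
      intro t ht
      rw [uIoc, mem_Ioc] at ht
      exact ⟨(lt_min hs.1 hr.1).trans ht.1, ht.2.trans_lt (max_lt hs.2 hr.2)⟩
    have h1 : ∫⁻ t in uIoc s r, m t = ∫⁻ t in Ioo 0 R, (uIoc s r).indicator m t := by
      rw [lintegral_indicator measurableSet_uIoc, Measure.restrict_restrict measurableSet_uIoc,
        inter_eq_left.2 hsub]
    have h2 := rpow_lintegral_le_of_density (volume.restrict (Ioo 0 R))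
      (f := (uIoc s r).indicator m) (hm.indicator measurableSet_uIoc)
      (k := fun t => (ε ^ 2 + t ^ 2) ^ (a / 2)) (by fun_prop)
      ((ae_restrict_iff' measurableSet_Ioo).2 (ae_of_all _ fun t ht => by
        have := ht.1; positivity)) hp
    rw [← h1] at h2
    calc ‖H r - H s‖ₑ ^ p ≤ (∫⁻ t in uIoc s r, m t) ^ p := by
          gcongr
          exact hH r s
      _ ≤ _ := h2
      _ ≤ K ^ (p - 1) * ∫⁻ t in Ioo 0 R, ((Iio t).indicator (fun _ => M t) r +
            (Iio t).indicator (fun _ => M t) s) := by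
          gcongr with t
          · exact lintegral_sqrt_weight_le ha hR hε
          · by_cases ht : t ∈ uIoc s r
            · rw [indicator_of_mem ht]
              rw [uIoc, mem_Ioc, min_lt_iff] at ht
              rcases ht.1 with h | h
              · exact le_add_left (by rw [indicator_of_mem (by exact h)])
              · exact le_add_right (by rw [indicator_of_mem (by exact h)])
            · rw [indicator_of_notMem ht, ENNReal.zero_rpow_of_pos (by linarith), zero_mul]
              exact zero_le
      _ = _ := by
          rw [lintegral_add_left]
          exact hM.indicator measurableSet_Ioi
  have hmeas : Measurable (fun x : ℝ × ℝ => (Iio x.2).indicator (fun _ => M x.2) x.1) := by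
    have : (fun x : ℝ × ℝ => (Iio x.2).indicator (fun _ => M x.2) x.1) =
        {x : ℝ × ℝ | x.1 < x.2}.indicator (fun x => M x.2) := by
      ext x; simp [indicator_apply]
    rw [this]
    exact (hM.comp measurable_snd).indicator (measurableSet_lt measurable_fst measurable_snd)
  have hF : ∫⁻ r, (∫⁻ t in Ioo 0 R, (Iio t).indicator (fun _ => M t) r) ∂ρ = B := by
    rw [lintegral_lintegral_swap hmeas.aemeasurable]
    refine lintegral_congr fun t => ?_
    rw [lintegral_indicator_const measurableSet_Iio]
  have hF' : Measurable fun r => ∫⁻ t in Ioo 0 R, (Iio t).indicator (fun _ => M t) r :=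
    hmeas.lintegral_prod_right'
  have hρL : ρ univ ≤ L := radialMeasure_univ_le ha hR hε
  have hBN : B ≤ N * ∫⁻ t, m t ^ p * ENNReal.ofReal ((ε ^ 2 + t ^ 2) ^ (-(p / 2) * a)) ∂ρ := by
    rw [hρ, lintegral_radialMeasure _ _ _ (by fun_prop), ← lintegral_const_mul _ (by fun_prop), hB]
    refine setLIntegral_mono_ae' measurableSet_Ioo (ae_of_all _ fun t ht => ?_)
    have ht0 : 0 < t := ht.1
    have hX : 0 < ε ^ 2 + t ^ 2 := by positivity
    have hE := endBound_nonneg (ε₀ := ε₀) (R := R) ((a + 1) / 2)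
    have hEB : 0 ≤ endBound ε₀ R ((a + 1) / 2) / (2 * min a 0 + 2) * ((ε ^ 2 + t ^ 2) ^ a * t) := by
      positivity
    calc M t * ρ (Iio t)
        ≤ M t * ENNReal.ofReal ((ε ^ 2 + t ^ 2) ^ a * t ^ 2 / (2 * min a 0 + 2)) := by
          gcongr
          exact radialMeasure_Iio_le ha ht0
      _ = m t ^ p * ENNReal.ofReal (((ε ^ 2 + t ^ 2) ^ (a / 2)) ^ (1 - p) *
            ((ε ^ 2 + t ^ 2) ^ a * t ^ 2 / (2 * min a 0 + 2))) := by
          rw [ENNReal.ofReal_mul (by positivity), mul_assoc]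
      _ ≤ m t ^ p * ENNReal.ofReal (endBound ε₀ R ((a + 1) / 2) / (2 * min a 0 + 2) *
            ((ε ^ 2 + t ^ 2) ^ a * t) * (ε ^ 2 + t ^ 2) ^ (-(p / 2) * a)) := by
          refine mul_le_mul_right (ENNReal.ofReal_le_ofReal ?_) _
          have h1 : ((ε ^ 2 + t ^ 2) ^ (a / 2)) ^ (1 - p) =
              (ε ^ 2 + t ^ 2) ^ (a / 2) * (ε ^ 2 + t ^ 2) ^ (-(p / 2) * a) := by
            rw [← Real.rpow_mul hX.le, ← Real.rpow_add hX]
            congr 1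
            ring
          rw [h1]
          have h2 := mul_rpow_half_le ha hε ht
          calc _ = (t * (ε ^ 2 + t ^ 2) ^ (a / 2)) / (2 * min a 0 + 2) *
                ((ε ^ 2 + t ^ 2) ^ a * t) * (ε ^ 2 + t ^ 2) ^ (-(p / 2) * a) := by ring
            _ ≤ endBound ε₀ R ((a + 1) / 2) / (2 * min a 0 + 2) *
                ((ε ^ 2 + t ^ 2) ^ a * t) * (ε ^ 2 + t ^ 2) ^ (-(p / 2) * a) := by gcongr
      _ = _ := by
          rw [ENNReal.ofReal_mul hEB, ENNReal.ofReal_mul (by positivity)]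
          ring
  calc ∫⁻ r, ∫⁻ s, ‖H r - H s‖ₑ ^ p ∂ρ ∂ρ
      ≤ ∫⁻ r, ∫⁻ s, K ^ (p - 1) * ((∫⁻ t in Ioo 0 R, (Iio t).indicator (fun _ => M t) r) +
        ∫⁻ t in Ioo 0 R, (Iio t).indicator (fun _ => M t) s) ∂ρ ∂ρ := by
        refine lintegral_mono_ae ((ae_radialMeasure_mem ε a R).mono fun r hr => ?_)
        exact lintegral_mono_ae ((ae_radialMeasure_mem ε a R).mono fun s hs => hpt r hr s hs)
    _ = K ^ (p - 1) * (2 * ρ univ * B) := by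
        have h1 : ∀ r, ∫⁻ s, K ^ (p - 1) *
            ((∫⁻ t in Ioo 0 R, (Iio t).indicator (fun _ => M t) r) +
              ∫⁻ t in Ioo 0 R, (Iio t).indicator (fun _ => M t) s) ∂ρ =
            K ^ (p - 1) * ((∫⁻ t in Ioo 0 R, (Iio t).indicator (fun _ => M t) r) * ρ univ + B) := by
          intro r
          rw [lintegral_const_mul _ (by fun_prop), lintegral_add_right _ hF', hF, lintegral_const]
        simp_rw [h1]
        rw [lintegral_const_mul _ (by fun_prop), lintegral_add_right _ (by fun_prop),
          lintegral_mul_const _ hF', hF, lintegral_const]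
        ring
    _ ≤ K ^ (p - 1) * (2 * L * (N * ∫⁻ t, m t ^ p *
          ENNReal.ofReal ((ε ^ 2 + t ^ 2) ^ (-(p / 2) * a)) ∂ρ)) := by gcongr
    _ = _ := by ring

/-- The measure `(ε² + |z|²)^a dλ` on the disc of radius `R`. -/
def discMeasure (ε a R : ℝ) : Measure ℂ :=
  (volume.restrict (Metric.ball 0 R)).withDensity fun z => ENNReal.ofReal ((ε ^ 2 + ‖z‖ ^ 2) ^ a)

instance (ε a R : ℝ) : SFinite (discMeasure ε a R) := by unfold discMeasure; infer_instance

/-- The measure `dθ` on the angular interval of the polar coordinates. -/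
abbrev angleMeasure : Measure ℝ := volume.restrict (Ioo (-Real.pi) Real.pi)

theorem angleMeasure_univ : angleMeasure univ = ENNReal.ofReal (2 * Real.pi) := by
  rw [Measure.restrict_apply MeasurableSet.univ, univ_inter, Real.volume_Ioo]
  congr 1
  ring

/-- Polar coordinates. -/
theorem lintegral_discMeasure (ε a R : ℝ) {k : ℂ → ℝ≥0∞} (hk : Measurable k) :
    ∫⁻ z, k z ∂discMeasure ε a R =
      ∫⁻ r : ℝ, ∫⁻ θ : ℝ, k (r * Complex.exp (θ * Complex.I)) ∂angleMeasure
        ∂radialMeasure ε a R := by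
  classical
  have hm1 : Measurable fun x : ℝ × ℝ => k (x.1 * Complex.exp (x.2 * Complex.I)) :=
    hk.comp (by fun_prop)
  rw [discMeasure, lintegral_withDensity_eq_lintegral_mul _ (by fun_prop) hk,
    ← lintegral_indicator Metric.isOpen_ball.measurableSet,
    ← Complex.lintegral_comp_polarCoord_symm, lintegral_radialMeasure _ _ _
      hm1.lintegral_prod_right', polarCoord_target, Measure.volume_eq_prod,
    ← Measure.prod_restrict, lintegral_prod]
  · have hI : (Ioo 0 R : Set ℝ) = Iio R ∩ Ioi 0 := by ext; simp [and_comm]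
    rw [hI, ← Measure.restrict_restrict measurableSet_Iio, ← lintegral_indicator measurableSet_Iio]
    refine setLIntegral_congr_fun measurableSet_Ioi fun r hr => ?_
    have hr0 : (0 : ℝ) < r := hr
    have hn : ∀ θ : ℝ, ‖(r : ℂ) * Complex.exp (θ * Complex.I)‖ = r := by
      intro θ
      rw [norm_mul, Complex.norm_exp_ofReal_mul_I, mul_one, Complex.norm_real, Real.norm_eq_abs,
        abs_of_pos hr0]
    have he : ∀ θ : ℝ, Complex.polarCoord.symm (r, θ) = r * Complex.exp (θ * Complex.I) := by
      intro θ
      rw [Complex.polarCoord_symm_apply, Complex.exp_mul_I]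
      push_cast
      rfl
    simp only [he, indicator_apply, Metric.mem_ball, dist_zero_right, hn, Pi.mul_apply, mem_Iio]
    by_cases hrR : r < R
    · simp only [hrR, if_true, smul_eq_mul]
      rw [← lintegral_const_mul]
      · refine lintegral_congr fun θ => ?_
        rw [ENNReal.ofReal_mul (by positivity)]
        ring
      · exact hk.comp (by fun_prop)
    · simp [hrR]
  · have hg : Measurable ((Metric.ball (0 : ℂ) R).indicator
        ((fun z => ENNReal.ofReal ((ε ^ 2 + ‖z‖ ^ 2) ^ a)) * k)) :=
      Measurable.indicator (Measurable.mul (by fun_prop) hk) Metric.isOpen_ball.measurableSet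
    have hpol : Measurable fun x : ℝ × ℝ => Complex.polarCoord.symm x := by
      simp_rw [Complex.polarCoord_symm_apply]
      fun_prop
    exact (measurable_fst.ennreal_ofReal.smul (hg.comp hpol)).aemeasurable

theorem discMeasure_univ_le {ε₀ ε a R : ℝ} (ha : -1 < a) (hR : 0 < R) (hε : ε ∈ Icc 0 ε₀) :
    discMeasure ε a R univ ≤ ENNReal.ofReal (2 * Real.pi) *
      ENNReal.ofReal (endBound ε₀ R a * R ^ 2 / (2 * min a 0 + 2)) := by
  have h : discMeasure ε a R univ = ∫⁻ z, (fun _ => 1) z ∂discMeasure ε a R := by simp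
  rw [h, lintegral_discMeasure _ _ _ measurable_const]
  simp only [lintegral_const, one_mul, angleMeasure_univ]
  gcongr
  exact radialMeasure_univ_le ha hR hε

/-- Differences along the circles of the cone. -/
theorem enorm_sub_rpow_le_circle {p a ε₀ ε R s : ℝ} (hp : 1 ≤ p) (ha : -1 < a)
    (hε : ε ∈ Icc 0 ε₀) (hs : s ∈ Ioo 0 R) {h : ℂ → ℂ} (hh : ContDiff ℝ 1 h) {θ φ : ℝ}
    (hθ : θ ∈ Ioo (-Real.pi) Real.pi) (hφ : φ ∈ Ioo (-Real.pi) Real.pi) :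
    ‖h (s * Complex.exp (θ * Complex.I)) - h (s * Complex.exp (φ * Complex.I))‖ₑ ^ p ≤
      ENNReal.ofReal (2 * Real.pi) ^ (p - 1) *
        (ENNReal.ofReal (endBound ε₀ R ((a + 1) / 2) ^ p) *
          ∫⁻ t : ℝ, ‖fderiv ℝ h (s * Complex.exp (t * Complex.I))‖ₑ ^ p *
            ENNReal.ofReal ((ε ^ 2 + s ^ 2) ^ (-(p / 2) * a)) ∂angleMeasure) := by
  set e : ℝ → ℂ := fun θ => Complex.exp (θ * Complex.I) with he
  have hemeas : Continuous e := by fun_prop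
  have henorm : ∀ θ, ‖e θ‖ = 1 := fun θ => Complex.norm_exp_ofReal_mul_I θ
  have hfc : Continuous (fderiv ℝ h) := hh.continuous_fderiv (by simp)
  have hdiff : Differentiable ℝ h := hh.differentiable (by simp)
  set N : ℂ → ℝ≥0∞ := fun z => ‖fderiv ℝ h z‖ₑ with hN
  have hNm : Measurable N := by fun_prop
  have hs0 : 0 < s := hs.1
  have hX : 0 < ε ^ 2 + s ^ 2 := by positivity
  have hsub : uIoc φ θ ⊆ Ioo (-Real.pi) Real.pi := by
    intro t ht
    rw [uIoc, mem_Ioc] at ht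
    exact ⟨(lt_min hφ.1 hθ.1).trans ht.1, ht.2.trans_lt (max_lt hφ.2 hθ.2)⟩
  have h1 : ‖h (s * e θ) - h (s * e φ)‖ₑ ≤
      ∫⁻ t in uIoc φ θ, ENNReal.ofReal s * N (s * e t) := by
    refine enorm_sub_le_lintegral_uIoc (H := fun t : ℝ => h (s * e t))
      (H' := fun t => fderiv ℝ h (s * e t) (s * (e t * Complex.I))) (fun t => ?_)
      (by fun_prop) fun t _ => ?_
    · have h0 : HasDerivAt e (e t * Complex.I) t := by
        have := (((Complex.ofRealCLM.hasDerivAt (x := t)).mul_const Complex.I).cexp)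
        simpa [he] using this
      exact (hdiff _).hasFDerivAt.comp_hasDerivAt t (h0.const_mul (s : ℂ))
    · refine ((fderiv ℝ h (s * e t)).le_opENorm _).trans ?_
      rw [← ofReal_norm ((s : ℂ) * (e t * Complex.I))]
      simp [hN, henorm, abs_of_pos hs0, mul_comm]
  calc ‖h (s * e θ) - h (s * e φ)‖ₑ ^ p
      ≤ (∫⁻ t, ENNReal.ofReal s * N (s * e t) ∂angleMeasure) ^ p := by
        gcongr
        exact h1.trans (lintegral_mono_set hsub)
    _ ≤ angleMeasure univ ^ (p - 1) *
        ∫⁻ t, (ENNReal.ofReal s * N (s * e t)) ^ p ∂angleMeasure :=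
        rpow_lintegral_le _ (by fun_prop) hp
    _ ≤ _ := by
        rw [angleMeasure_univ, ← lintegral_const_mul (ENNReal.ofReal (_ ^ p)) (by fun_prop)]
        refine mul_le_mul_right (lintegral_mono fun t => ?_) _
        rw [ENNReal.mul_rpow_of_nonneg _ _ (by linarith), mul_comm, mul_left_comm]
        refine mul_le_mul_right ?_ _
        rw [ENNReal.ofReal_rpow_of_pos hs0, ← ENNReal.ofReal_mul
          (Real.rpow_nonneg (endBound_nonneg _) _)]
        refine ENNReal.ofReal_le_ofReal ?_
        have h2 := mul_rpow_half_le ha hε hs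
        calc s ^ p = (s * (ε ^ 2 + s ^ 2) ^ (a / 2)) ^ p * (ε ^ 2 + s ^ 2) ^ (-(p / 2) * a) := by
              rw [Real.mul_rpow hs0.le (by positivity), ← Real.rpow_mul hX.le, mul_assoc,
                ← Real.rpow_add hX]
              ring_nf
              simp
          _ ≤ _ := by gcongr

/-- The inequality on a disc with the conical metric `(ε² + |z|²)^a |dz|²`, uniformly in `ε`. The
factor `(ε² + |z|²)^{-pa/2}` converts the Euclidean length of the gradient into the conical one. -/
theorem exists_disc_poincare {p a ε₀ R : ℝ} (hp : 1 ≤ p) (ha : -1 < a) (hR : 0 < R) :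
    ∃ C : ℝ≥0∞, C ≠ ⊤ ∧ ∀ ε ∈ Icc 0 ε₀, ∀ h : ℂ → ℂ, ContDiff ℝ 1 h →
      ∫⁻ z, ∫⁻ ζ, ‖h z - h ζ‖ₑ ^ p ∂discMeasure ε a R ∂discMeasure ε a R ≤
        C * ∫⁻ z, ‖fderiv ℝ h z‖ₑ ^ p * ENNReal.ofReal ((ε ^ 2 + ‖z‖ ^ 2) ^ (-(p / 2) * a))
          ∂discMeasure ε a R := by
  obtain ⟨C₁, hC₁, hrad⟩ := exists_radial_poincare (ε₀ := ε₀) hp ha hR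
  set L : ℝ≥0∞ := ENNReal.ofReal (endBound ε₀ R a * R ^ 2 / (2 * min a 0 + 2)) with hL
  set P : ℝ≥0∞ := ENNReal.ofReal (2 * Real.pi) with hP
  set A : ℝ≥0∞ := ENNReal.ofReal (endBound ε₀ R ((a + 1) / 2) ^ p) with hA
  refine ⟨2 ^ (p - 1) * (P * C₁ + L * P ^ 2 * P ^ (p - 1) * A), ?_, fun ε hε h hh => ?_⟩
  · have h1 : (2 : ℝ≥0∞) ^ (p - 1) ≠ ⊤ := ENNReal.rpow_ne_top_of_nonneg (by linarith) (by simp)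
    have h2 : P ^ (p - 1) ≠ ⊤ :=
      ENNReal.rpow_ne_top_of_nonneg (by linarith) ENNReal.ofReal_ne_top
    have h3 : P ≠ ⊤ := ENNReal.ofReal_ne_top
    have h4 : L ≠ ⊤ := ENNReal.ofReal_ne_top
    have h5 : A ≠ ⊤ := ENNReal.ofReal_ne_top
    finiteness
  set ρ := radialMeasure ε a R with hρ
  have hρL : ρ univ ≤ L := radialMeasure_univ_le ha hR hε
  set e : ℝ → ℂ := fun θ => Complex.exp (θ * Complex.I) with he
  have hemeas : Continuous e := by fun_prop
  have henorm : ∀ θ, ‖e θ‖ = 1 := fun θ => Complex.norm_exp_ofReal_mul_I θ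
  have hcont : Continuous h := hh.continuous
  have hfc : Continuous (fderiv ℝ h) := hh.continuous_fderiv (by simp)
  have hdiff : Differentiable ℝ h := hh.differentiable (by simp)
  set σ : Measure ℝ := angleMeasure with hσ
  have hσP : σ univ = P := angleMeasure_univ
  set N : ℂ → ℝ≥0∞ := fun z => ‖fderiv ℝ h z‖ₑ with hN
  have hNm : Measurable N := by fun_prop
  set Q : ℝ → ℝ≥0∞ := fun s => ∫⁻ t, N (s * e t) ^ p *
    ENNReal.ofReal ((ε ^ 2 + s ^ 2) ^ (-(p / 2) * a)) ∂σ with hQ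
  have hQm : Measurable Q := by
    have : Measurable fun x : ℝ × ℝ => N (x.1 * e x.2) ^ p *
      ENNReal.ofReal ((ε ^ 2 + x.1 ^ 2) ^ (-(p / 2) * a)) := by fun_prop
    exact this.lintegral_prod_right'
  set D : ℝ≥0∞ := ∫⁻ s, Q s ∂ρ with hD
  have hDswap : D = ∫⁻ θ, ∫⁻ t : ℝ, N (t * e θ) ^ p *
      ENNReal.ofReal ((ε ^ 2 + t ^ 2) ^ (-(p / 2) * a)) ∂ρ ∂σ := by
    refine lintegral_lintegral_swap ?_
    refine Measurable.aemeasurable ?_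
    simp only [Function.uncurry_def]
    fun_prop
  have hDeq : ∫⁻ z, ‖fderiv ℝ h z‖ₑ ^ p * ENNReal.ofReal ((ε ^ 2 + ‖z‖ ^ 2) ^ (-(p / 2) * a))
      ∂discMeasure ε a R = D := by
    rw [lintegral_discMeasure _ _ _ (by fun_prop)]
    refine lintegral_congr fun t => lintegral_congr fun θ => ?_
    congr 4
    rw [norm_mul, Complex.norm_exp_ofReal_mul_I, mul_one, Complex.norm_real, Real.norm_eq_abs,
      sq_abs]
  have hray : ∀ θ, ∫⁻ r : ℝ, ∫⁻ s : ℝ, ‖h (r * e θ) - h (s * e θ)‖ₑ ^ p ∂ρ ∂ρ ≤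
      C₁ * ∫⁻ t : ℝ, N (t * e θ) ^ p *
        ENNReal.ofReal ((ε ^ 2 + t ^ 2) ^ (-(p / 2) * a)) ∂ρ := by
    intro θ
    refine hrad ε hε (fun r => h (r * e θ)) (fun t => N (t * e θ))
      (hNm.comp (by fun_prop)) fun r s => ?_
    refine enorm_sub_le_lintegral_uIoc (H := fun r : ℝ => h (r * e θ))
      (H' := fun t => fderiv ℝ h (t * e θ) (e θ)) (fun t => ?_) (by fun_prop) fun t _ => ?_
    · have h1 : HasDerivAt (fun t : ℝ => (t : ℂ) * e θ) (e θ) t := by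
        simpa using (Complex.ofRealCLM.hasDerivAt (x := t)).mul_const (e θ)
      exact (hdiff _).hasFDerivAt.comp_hasDerivAt t h1
    · refine ((fderiv ℝ h (t * e θ)).le_opENorm _).trans ?_
      rw [← ofReal_norm (e θ), henorm]
      simp [hN]
  obtain ⟨T, hT⟩ : ∃ T : ℝ → ℝ → ℝ≥0∞, ∀ r θ,
      T r θ = ∫⁻ s : ℝ, ‖h (r * e θ) - h (s * e θ)‖ₑ ^ p ∂ρ := ⟨_, fun _ _ => rfl⟩
  have hm6 : Measurable fun x : ℝ × ℝ => T x.1 x.2 := by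
    have : Measurable fun x : (ℝ × ℝ) × ℝ =>
      ‖h (x.1.1 * e x.1.2) - h (x.2 * e x.1.2)‖ₑ ^ p := by fun_prop
    simp_rw [hT]
    exact this.lintegral_prod_right'
  have hm7 : Measurable fun r : ℝ => ∫⁻ θ, T r θ ∂σ :=
    Measurable.lintegral_prod_right' (f := fun x => T x.1 x.2) hm6
  have hm8 : ∀ r : ℝ, Measurable fun θ => T r θ := fun r =>
    Measurable.comp (g := fun x : ℝ × ℝ => T x.1 x.2) hm6 (measurable_prodMk_left (x := r))
  have hsw : ∫⁻ r, ∫⁻ θ, T r θ ∂σ ∂ρ ≤ C₁ * D := by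
    rw [lintegral_lintegral_swap hm6.aemeasurable]
    simp_rw [hT]
    refine (lintegral_mono fun θ => hray θ).trans ?_
    rw [lintegral_const_mul, hDswap]
    have : Measurable fun x : ℝ × ℝ => N (x.2 * e x.1) ^ p *
      ENNReal.ofReal ((ε ^ 2 + x.2 ^ 2) ^ (-(p / 2) * a)) := by fun_prop
    exact this.lintegral_prod_right'
  set A' : ℝ≥0∞ := P ^ (p - 1) * A with hA'
  calc ∫⁻ z, ∫⁻ ζ, ‖h z - h ζ‖ₑ ^ p ∂discMeasure ε a R ∂discMeasure ε a R
      = ∫⁻ r : ℝ, ∫⁻ θ, ∫⁻ s : ℝ, ∫⁻ φ, ‖h (r * e θ) - h (s * e φ)‖ₑ ^ p ∂σ ∂ρ ∂σ ∂ρ := by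
        have hm : Measurable fun x : ℂ × ℂ => ‖h x.1 - h x.2‖ₑ ^ p := by fun_prop
        rw [lintegral_discMeasure _ _ _ hm.lintegral_prod_right']
        refine lintegral_congr fun r => lintegral_congr fun θ => ?_
        exact lintegral_discMeasure _ _ _ (by fun_prop)
    _ ≤ ∫⁻ r : ℝ, ∫⁻ θ, ∫⁻ s : ℝ, ∫⁻ _, 2 ^ (p - 1) *
          (‖h (r * e θ) - h (s * e θ)‖ₑ ^ p + A' * Q s) ∂σ ∂ρ ∂σ ∂ρ := by
        refine lintegral_mono fun r => setLIntegral_mono_ae' measurableSet_Ioo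
          (ae_of_all _ fun θ hθ => ?_)
        refine lintegral_mono_ae ((ae_radialMeasure_mem ε a R).mono fun s hs => ?_)
        refine setLIntegral_mono_ae' measurableSet_Ioo (ae_of_all _ fun φ hφ => ?_)
        refine (enorm_sub_rpow_le hp _ (h (s * e θ)) _).trans ?_
        refine mul_le_mul_right (add_le_add_right ?_ _) _
        rw [hA', mul_assoc]
        exact enorm_sub_rpow_le_circle hp ha hε hs hh hθ hφ
    _ = ∫⁻ r : ℝ, ∫⁻ θ, 2 ^ (p - 1) * (T r θ + A' * D) * P ∂σ ∂ρ := by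
        refine lintegral_congr fun r => lintegral_congr fun θ => ?_
        simp only [lintegral_const, hσP]
        have h0 : Continuous fun s : ℝ => h (s * e θ) := hcont.comp (by fun_prop)
        have h1 : Measurable fun s : ℝ => ‖h (r * e θ) - h (s * e θ)‖ₑ ^ p :=
          (measurable_const.sub h0.measurable).enorm.pow_const p
        have h2 : Measurable fun s : ℝ => ‖h (r * e θ) - h (s * e θ)‖ₑ ^ p + A' * Q s :=
          h1.add (hQm.const_mul _)
        rw [lintegral_mul_const _ (h2.const_mul _), lintegral_const_mul _ h2,
          lintegral_add_right _ (hQm.const_mul _), lintegral_const_mul _ hQm, hT]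
    _ = ∫⁻ r : ℝ, 2 ^ (p - 1) * ((∫⁻ θ, T r θ ∂σ) + A' * D * P) * P ∂ρ := by
        refine lintegral_congr fun r => ?_
        have := hm8 r
        rw [lintegral_mul_const _ (by fun_prop), lintegral_const_mul _ (by fun_prop),
          lintegral_add_right _ (by fun_prop), lintegral_const, hσP]
    _ = 2 ^ (p - 1) * ((∫⁻ r, ∫⁻ θ, T r θ ∂σ ∂ρ) + A' * D * P * ρ univ) * P := by
        rw [lintegral_mul_const _ (by fun_prop), lintegral_const_mul _ (by fun_prop),
          lintegral_add_right _ (by fun_prop), lintegral_const]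
    _ ≤ 2 ^ (p - 1) * (C₁ * D + A' * D * P * L) * P := by gcongr
    _ = _ := by
        rw [hDeq, hA']
        ring

/-! ### Product measures -/

section Product

variable {ι Ω : Type*} [Fintype ι] [DecidableEq ι] [MeasurableSpace Ω]

theorem lintegral_pi_prod (ν : ι → Measure Ω) [∀ i, SigmaFinite (ν i)] {f : ι → Ω → ℝ≥0∞}
    (hf : ∀ i, Measurable (f i)) :
    ∫⁻ x, ∏ i, f i (x i) ∂Measure.pi ν = ∏ i, ∫⁻ t, f i t ∂ν i := by
  have hm : Measurable fun x : ι → Ω => ∏ i, f i (x i) :=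
    Finset.measurable_prod _ fun i _ => (hf i).comp (measurable_pi_apply i)
  have key : ∀ (s : Finset ι) (x : ι → Ω),
      (∫⋯∫⁻_s, (fun x => ∏ i, f i (x i)) ∂ν) x =
        (∏ i ∈ s, ∫⁻ t, f i t ∂ν i) * ∏ i ∈ sᶜ, f i (x i) := by
    intro s
    induction s using Finset.induction_on with
    | empty => intro x; simp
    | insert j s hj ih =>
      intro x
      rw [lmarginal_insert _ hm hj]
      simp_rw [ih]
      have h1 : sᶜ = insert j (insert j s)ᶜ := by
        ext i
        by_cases h : i = j <;> simp [h, hj]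
      have h2 : ∀ t, ∏ i ∈ sᶜ, f i (Function.update x j t i) =
          f j t * ∏ i ∈ (insert j s)ᶜ, f i (x i) := by
        intro t
        rw [h1, Finset.prod_insert (by simp)]
        congr 1
        · simp
        · refine Finset.prod_congr rfl fun i hi => ?_
          rw [Function.update_of_ne]
          rintro rfl
          simp at hi
      simp_rw [h2]
      rw [lintegral_const_mul _ ((hf j).mul_const _), lintegral_mul_const _ (hf j),
        Finset.prod_insert hj]
      ring
  rcases isEmpty_or_nonempty Ω with hΩ | hΩ
  · rcases isEmpty_or_nonempty ι with hι | ⟨⟨i⟩⟩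
    · simp
    · rw [Finset.prod_eq_zero (Finset.mem_univ i)]
      · have : IsEmpty (ι → Ω) := ⟨fun x => hΩ.elim (x i)⟩
        simp [Measure.eq_zero_of_isEmpty]
      · simp [Measure.eq_zero_of_isEmpty]
  · rw [lintegral_eq_lmarginal_univ (fun _ => Classical.arbitrary Ω), key]
    simp

theorem pi_withDensity (ν : ι → Measure Ω) [∀ i, SigmaFinite (ν i)] {f : ι → Ω → ℝ≥0∞}
    (hf : ∀ i, Measurable (f i)) [∀ i, SigmaFinite ((ν i).withDensity (f i))] :
    Measure.pi (fun i => (ν i).withDensity (f i)) =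
      (Measure.pi ν).withDensity fun x => ∏ i, f i (x i) := by
  refine Measure.pi_eq fun s hs => ?_
  rw [withDensity_apply _ (MeasurableSet.univ_pi hs), Measure.restrict_pi_pi,
    lintegral_pi_prod _ hf]
  exact Finset.prod_congr rfl fun i _ => (withDensity_apply _ (hs i)).symm

variable (μ : ι → Measure Ω) [∀ i, IsFiniteMeasure (μ i)]

/-- Exchanging the coordinates in `s` between two independent points preserves the product
measure. -/
theorem measurePreserving_piecewise (s : Finset ι) :
    MeasurePreserving (fun x : (ι → Ω) × (ι → Ω) => (s.piecewise x.2 x.1, s.piecewise x.1 x.2))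
      ((Measure.pi μ).prod (Measure.pi μ)) ((Measure.pi μ).prod (Measure.pi μ)) := by
  have h1 := measurePreserving_arrowProdEquivProdArrow Ω Ω ι μ μ
  have h2 : MeasurePreserving
      (fun (a : ι → Ω × Ω) i => (if i ∈ s then Prod.swap else id) (a i))
      (Measure.pi fun i => (μ i).prod (μ i)) (Measure.pi fun i => (μ i).prod (μ i)) := by
    refine measurePreserving_pi _ _ fun i => ?_
    split_ifs
    · exact Measure.measurePreserving_swap
    · exact MeasurePreserving.id _
  convert h1.comp (h2.comp h1.symm) using 1
  ext x i
  · by_cases hi : i ∈ s <;>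
      simp [hi, MeasurableEquiv.arrowProdEquivProdArrow, Equiv.arrowProdEquivProdArrow]
  · by_cases hi : i ∈ s <;>
      simp [hi, MeasurableEquiv.arrowProdEquivProdArrow, Equiv.arrowProdEquivProdArrow]

/-- Tensorization: a Poincaré inequality in each of the variables gives one for the product. Two
points are joined by changing one coordinate after the other. -/
theorem lintegral_lintegral_pi_le {p : ℝ} (hp : 1 ≤ p) {M : ℝ≥0∞} (hM1 : 1 ≤ M)
    (hM : ∀ i, μ i univ ≤ M) {F : (ι → Ω) → ℂ} (hF : Measurable F) {C : ι → ℝ≥0∞}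
    {D : ι → (ι → Ω) → ℝ≥0∞} (hD : ∀ i, Measurable (D i))
    (h : ∀ i x, ∫⁻ u, ∫⁻ t, ‖F (Function.update x i u) - F (Function.update x i t)‖ₑ ^ p ∂μ i ∂μ i ≤
      C i * ∫⁻ u, D i (Function.update x i u) ∂μ i) :
    ∫⁻ z, ∫⁻ ζ, ‖F z - F ζ‖ₑ ^ p ∂Measure.pi μ ∂Measure.pi μ ≤
      (2 ^ (p - 1)) ^ Fintype.card ι * M ^ Fintype.card ι *
        ∑ i, C i * ∫⁻ z, D i z ∂Measure.pi μ := by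
  set ν := Measure.pi μ with hν
  have h21 : (1 : ℝ≥0∞) ≤ 2 ^ (p - 1) := by
    simpa using ENNReal.rpow_le_rpow_of_exponent_le (x := 2) (by norm_num) (sub_nonneg.2 hp)
  -- The points obtained by exchanging the coordinates in `s` are again independent, so that the
  -- cost of changing the coordinate `j` is given by the inequality in that variable.
  have hone : ∀ j : ι, ∀ s : Finset ι, j ∉ s →
      ∫⁻ x, ‖F (s.piecewise x.2 x.1) - F ((insert j s).piecewise x.2 x.1)‖ₑ ^ p ∂(ν.prod ν) ≤
        M ^ Fintype.card ι * (C j * ∫⁻ z, D j z ∂ν) := by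
    intro j s hj
    have hu : Measurable fun q : (ι → Ω) × Ω => Function.update q.1 j q.2 := by
      refine measurable_pi_lambda _ fun i => ?_
      by_cases hi : i = j
      · subst hi; simpa using measurable_snd
      · simp only [Function.update_of_ne hi]
        exact (measurable_pi_apply i).comp measurable_fst
    set g : (ι → Ω) × Ω → ℝ≥0∞ := fun q => ‖F q.1 - F (Function.update q.1 j q.2)‖ₑ ^ p with hg
    have hgm : Measurable g :=
      ((hF.comp measurable_fst).sub (hF.comp hu)).enorm.pow_const p
    set H : (ι → Ω) → ℝ≥0∞ := fun y => ∫⁻ t, g (y, t) ∂μ j with hH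
    have hHm : Measurable H := hgm.lintegral_prod_right'
    have hgm2 : Measurable fun y : (ι → Ω) × (ι → Ω) => g (y.1, y.2 j) :=
      hgm.comp (measurable_fst.prodMk ((measurable_pi_apply j).comp measurable_snd))
    calc ∫⁻ x, ‖F (s.piecewise x.2 x.1) - F ((insert j s).piecewise x.2 x.1)‖ₑ ^ p ∂(ν.prod ν)
        = ∫⁻ x, g (s.piecewise x.2 x.1, s.piecewise x.1 x.2 j) ∂(ν.prod ν) := by
          refine lintegral_congr fun x => ?_
          rw [Finset.piecewise_insert, Finset.piecewise_eq_of_notMem s _ _ hj]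
      _ = ∫⁻ y, g (y.1, y.2 j) ∂(ν.prod ν) :=
          (measurePreserving_piecewise μ s).lintegral_comp hgm2
      _ = ∫⁻ y, ∫⁻ y', g (y, y' j) ∂ν ∂ν := lintegral_prod _ hgm2.aemeasurable
      _ = ∫⁻ y, (∏ k ∈ Finset.univ.erase j, μ k univ) * H y ∂ν := by
          refine lintegral_congr fun y => ?_
          have h1 : ∫⁻ y', g (y, y' j) ∂ν = ∫⁻ t, g (y, t) ∂(ν.map (Function.eval j)) :=
            (lintegral_map (hgm.comp measurable_prodMk_left) (measurable_pi_apply j)).symm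
          rw [h1, hν, Measure.pi_map_eval, lintegral_smul_measure, smul_eq_mul]
      _ ≤ M ^ Fintype.card ι * ∫⁻ y, H y ∂ν := by
          rw [lintegral_const_mul _ hHm]
          gcongr
          calc ∏ k ∈ Finset.univ.erase j, μ k univ ≤ ∏ k ∈ Finset.univ.erase j, M :=
                Finset.prod_le_prod' fun k _ => hM k
            _ ≤ M ^ Fintype.card ι := by
                rw [Finset.prod_const]
                exact pow_le_pow_right₀ hM1 (Finset.card_le_univ _)
      _ ≤ M ^ Fintype.card ι * ∫⁻ z, C j * D j z ∂ν := by
          refine mul_le_mul_right ?_ _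
          refine lintegral_le_of_lmarginal_le {j} hHm ((hD j).const_mul _) fun x => ?_
          rw [lmarginal_singleton, lmarginal_singleton]
          have hDx : Measurable fun t => D j (Function.update x j t) :=
            (hD j).comp (measurable_update x)
          beta_reduce
          rw [lintegral_const_mul _ hDx]
          refine le_trans (le_of_eq ?_) (h j x)
          refine lintegral_congr fun u => lintegral_congr fun t => ?_
          simp [hg]
      _ = _ := by rw [lintegral_const_mul _ (hD j)]
  have hpw : ∀ s : Finset ι, Measurable fun x : (ι → Ω) × (ι → Ω) => s.piecewise x.2 x.1 :=
    fun s => measurable_fst.comp (measurePreserving_piecewise μ s).measurable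
  have key : ∀ s : Finset ι,
      ∫⁻ x, ‖F x.1 - F (s.piecewise x.2 x.1)‖ₑ ^ p ∂(ν.prod ν) ≤
        (2 ^ (p - 1)) ^ s.card * (M ^ Fintype.card ι * ∑ i ∈ s, C i * ∫⁻ z, D i z ∂ν) := by
    intro s
    induction s using Finset.induction_on with
    | empty => simp [ENNReal.zero_rpow_of_pos (show 0 < p by linarith)]
    | insert j s hj ih =>
      rw [Finset.card_insert_of_notMem hj, Finset.sum_insert hj]
      have hm1 : Measurable fun x : (ι → Ω) × (ι → Ω) =>
          ‖F x.1 - F (s.piecewise x.2 x.1)‖ₑ ^ p :=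
        ((hF.comp measurable_fst).sub (hF.comp (hpw s))).enorm.pow_const p
      calc ∫⁻ x, ‖F x.1 - F ((insert j s).piecewise x.2 x.1)‖ₑ ^ p ∂(ν.prod ν)
          ≤ ∫⁻ x, 2 ^ (p - 1) * (‖F x.1 - F (s.piecewise x.2 x.1)‖ₑ ^ p +
              ‖F (s.piecewise x.2 x.1) - F ((insert j s).piecewise x.2 x.1)‖ₑ ^ p) ∂(ν.prod ν) :=
            lintegral_mono fun x => enorm_sub_rpow_le hp _ _ _
        _ = 2 ^ (p - 1) * ((∫⁻ x, ‖F x.1 - F (s.piecewise x.2 x.1)‖ₑ ^ p ∂(ν.prod ν)) +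
              ∫⁻ x, ‖F (s.piecewise x.2 x.1) - F ((insert j s).piecewise x.2 x.1)‖ₑ ^ p
                ∂(ν.prod ν)) := by
            rw [lintegral_const_mul', lintegral_add_left hm1]
            exact ENNReal.rpow_ne_top_of_nonneg (by linarith) (by simp)
        _ ≤ 2 ^ (p - 1) *
            ((2 ^ (p - 1)) ^ s.card * (M ^ Fintype.card ι * ∑ i ∈ s, C i * ∫⁻ z, D i z ∂ν) +
              (2 ^ (p - 1)) ^ s.card * (M ^ Fintype.card ι * (C j * ∫⁻ z, D j z ∂ν))) := by
            gcongr
            refine (hone j s hj).trans ?_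
            exact le_mul_of_one_le_left zero_le (one_le_pow₀ h21)
        _ = _ := by ring
  have hfin := key Finset.univ
  simp only [Finset.piecewise_univ, Finset.card_univ] at hfin
  rw [lintegral_prod] at hfin
  · rw [mul_assoc]
    exact hfin
  · exact (((hF.comp measurable_fst).sub (hF.comp measurable_snd)).enorm.pow_const p).aemeasurable

end Product

/-! ### The weighted inequality on a polydisc -/

section Polydisc

variable {n : ℕ}

/-- The measure `∏_j (ε² + |z_j|²)^{a_j} dλ` on the polydisc of radius `R`. -/
def polydiscMeasure (ε : ℝ) (a : Fin n → ℝ) (R : ℝ) : Measure (Fin n → ℂ) :=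
  (volume.restrict (Metric.ball 0 R)).withDensity fun z =>
    ENNReal.ofReal (∏ j, (ε ^ 2 + ‖z j‖ ^ 2) ^ a j)

theorem isFiniteMeasure_discMeasure {ε₀ ε a R : ℝ} (ha : -1 < a) (hR : 0 < R)
    (hε : ε ∈ Icc 0 ε₀) : IsFiniteMeasure (discMeasure ε a R) :=
  ⟨(discMeasure_univ_le ha hR hε).trans_lt
    (ENNReal.mul_lt_top ENNReal.ofReal_lt_top ENNReal.ofReal_lt_top)⟩

/-- The polydisc is a ball for the sup norm of `Fin n → ℂ`. -/
theorem polydiscMeasure_eq_pi {ε₀ ε R : ℝ} {a : Fin n → ℝ} (ha : ∀ j, -1 < a j) (hR : 0 < R)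
    (hε : ε ∈ Icc 0 ε₀) :
    polydiscMeasure ε a R = Measure.pi fun j => discMeasure ε (a j) R := by
  have := fun j => isFiniteMeasure_discMeasure (ha j) hR hε
  unfold discMeasure at this ⊢
  rw [pi_withDensity _ (fun j => by fun_prop), ← Measure.restrict_pi_pi, polydiscMeasure,
    ball_pi _ hR, ← volume_pi]
  congr 1
  ext z
  rw [ENNReal.ofReal_prod_of_nonneg fun j _ => by positivity]

theorem exists_polydiscMeasure_univ_le {ε₀ R : ℝ} {a : Fin n → ℝ} (ha : ∀ j, -1 < a j)
    (hR : 0 < R) : ∃ M : ℝ≥0∞, M ≠ ⊤ ∧ ∀ ε ∈ Icc 0 ε₀, polydiscMeasure ε a R univ ≤ M := by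
  refine ⟨∏ j, ENNReal.ofReal (2 * Real.pi) *
      ENNReal.ofReal (endBound ε₀ R (a j) * R ^ 2 / (2 * min (a j) 0 + 2)), ?_, fun ε hε => ?_⟩
  · exact (ENNReal.prod_lt_top fun j _ =>
      ENNReal.mul_lt_top ENNReal.ofReal_lt_top ENNReal.ofReal_lt_top).ne
  · have := fun j => isFiniteMeasure_discMeasure (ha j) hR hε
    rw [polydiscMeasure_eq_pi ha hR hε, Measure.pi_univ]
    exact Finset.prod_le_prod' fun j _ => discMeasure_univ_le (ha j) hR hε

/-- The derivative of `F` along the `j`-th complex coordinate axis, as a real-linear map. -/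
def partialFDeriv (F : (Fin n → ℂ) → ℂ) (j : Fin n) (z : Fin n → ℂ) : ℂ →L[ℝ] ℂ :=
  (fderiv ℝ F z).comp (ContinuousLinearMap.single ℝ (fun _ : Fin n => ℂ) j)

/-- The inequality on a polydisc. The constant does not depend on `ε` or on the function. -/
theorem exists_polydisc_poincare {p ε₀ R : ℝ} (hp : 1 ≤ p) {a : Fin n → ℝ} (ha : ∀ j, -1 < a j)
    (hR : 0 < R) :
    ∃ C : ℝ≥0∞, C ≠ ⊤ ∧ ∀ ε ∈ Icc 0 ε₀, ∀ F : (Fin n → ℂ) → ℂ, ContDiff ℝ 1 F →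
      ∫⁻ z, ∫⁻ ζ, ‖F z - F ζ‖ₑ ^ p ∂polydiscMeasure ε a R ∂polydiscMeasure ε a R ≤
        C * ∑ j, ∫⁻ z, ‖partialFDeriv F j z‖ₑ ^ p *
          ENNReal.ofReal ((ε ^ 2 + ‖z j‖ ^ 2) ^ (-(p / 2) * a j)) ∂polydiscMeasure ε a R := by
  choose C hC hd using fun j => exists_disc_poincare (ε₀ := ε₀) hp (ha j) hR
  set M : ℝ≥0∞ := 1 + ∑ j, ENNReal.ofReal (2 * Real.pi) *
    ENNReal.ofReal (endBound ε₀ R (a j) * R ^ 2 / (2 * min (a j) 0 + 2)) with hM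
  have hMtop : M ≠ ⊤ := by
    refine ENNReal.add_ne_top.2 ⟨by simp, ENNReal.sum_ne_top.2 fun j _ => ?_⟩
    exact ENNReal.mul_ne_top ENNReal.ofReal_ne_top ENNReal.ofReal_ne_top
  have h2 : (2 : ℝ≥0∞) ^ (p - 1) ≠ ⊤ := ENNReal.rpow_ne_top_of_nonneg (by linarith) (by simp)
  refine ⟨(2 ^ (p - 1)) ^ n * M ^ n * ∑ j, C j, ?_, fun ε hε F hF => ?_⟩
  · exact ENNReal.mul_ne_top (ENNReal.mul_ne_top (ENNReal.pow_ne_top h2)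
      (ENNReal.pow_ne_top hMtop)) (ENNReal.sum_ne_top.2 fun j _ => hC j)
  have := fun j => isFiniteMeasure_discMeasure (ha j) hR hε
  have hfc : Continuous (fderiv ℝ F) := hF.continuous_fderiv (by simp)
  have hpc : ∀ j, Continuous (partialFDeriv F j) := fun j => by
    unfold partialFDeriv
    exact hfc.clm_comp continuous_const
  rw [polydiscMeasure_eq_pi ha hR hε]
  have hmain := lintegral_lintegral_pi_le (fun j => discMeasure ε (a j) R) hp (M := M)
    (by simp [hM]) (fun j => ?_) hF.continuous.measurable (C := C)
    (D := fun j z => ‖partialFDeriv F j z‖ₑ ^ p *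
      ENNReal.ofReal ((ε ^ 2 + ‖z j‖ ^ 2) ^ (-(p / 2) * a j))) (fun j => ?_) fun j x => ?_
  · refine hmain.trans ?_
    simp only [Fintype.card_fin]
    rw [mul_assoc _ (∑ j, C j)]
    refine mul_le_mul_right ?_ _
    rw [Finset.mul_sum]
    exact Finset.sum_le_sum fun j _ => mul_le_mul_left
      (Finset.single_le_sum (f := C) (fun _ _ => zero_le) (Finset.mem_univ j)) _
  · refine (discMeasure_univ_le (ha j) hR hε).trans ?_
    refine le_trans ?_ (le_add_left le_rfl)
    exact Finset.single_le_sum (f := fun j => ENNReal.ofReal (2 * Real.pi) *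
      ENNReal.ofReal (endBound ε₀ R (a j) * R ^ 2 / (2 * min (a j) 0 + 2)))
      (fun _ _ => zero_le) (Finset.mem_univ j)
  · have := hpc j
    fun_prop
  · have hup : ContDiff ℝ 1 fun u : ℂ => F (Function.update x j u) := by
      refine hF.comp ?_
      exact contDiff_update 1 x j
    have hder : ∀ u, fderiv ℝ (fun u : ℂ => F (Function.update x j u)) u =
        partialFDeriv F j (Function.update x j u) := by
      intro u
      have h1 := (hasFDerivAt_update (𝕜 := ℝ) x (i := j) u)
      have h2 := (hF.differentiable (by simp) (Function.update x j u)).hasFDerivAt.comp u h1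
      rw [show (fun u : ℂ => F (Function.update x j u)) = F ∘ Function.update x j from rfl,
        h2.fderiv]
      unfold partialFDeriv
      congr 1
      ext v i
      by_cases hi : i = j
      · subst hi; simp
      · simp [hi]
    have := hd j ε hε _ hup
    simp_rw [hder] at this
    simpa using this

end Polydisc

/-! ### The Riemannian volume in holomorphic charts -/

section Volume

variable {n : ℕ} {X : Type*} [TopologicalSpace X]

theorem measurableSet_target_inter_preimage [MeasurableSpace X] [BorelSpace X]
    (φ : OpenPartialHomeomorph X (Fin n → ℂ)) {s : Set X} (hs : MeasurableSet s) :
    MeasurableSet (φ.target ∩ φ.symm ⁻¹' s) := by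
  have h := (continuousOn_iff_continuous_domRestrict.1 φ.continuousOn_symm).measurable hs
  convert φ.open_target.measurableSet.subtype_image h using 1
  ext z
  simp [and_comm]

theorem aemeasurable_chart_symm [MeasurableSpace X] [BorelSpace X]
    (φ : OpenPartialHomeomorph X (Fin n → ℂ)) (ρ : Measure (Fin n → ℂ)) :
    AEMeasurable φ.symm (ρ.restrict φ.target) :=
  φ.continuousOn_symm.aemeasurable φ.open_target.measurableSet

variable [ChartedSpace (Fin n → ℂ) X]

theorem mem_maximalAtlas_real {φ : OpenPartialHomeomorph X (Fin n → ℂ)}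
    (h : φ ∈ IsManifold.maximalAtlas 𝓘(ℂ, Fin n → ℂ) ω X) :
    φ ∈ IsManifold.maximalAtlas 𝓘(ℝ, Fin n → ℂ) ∞ X := by
  have key : ∀ e : OpenPartialHomeomorph (Fin n → ℂ) (Fin n → ℂ),
      e ∈ contDiffGroupoid ω 𝓘(ℂ, Fin n → ℂ) → e ∈ contDiffGroupoid ∞ 𝓘(ℝ, Fin n → ℂ) := by
    intro e he
    have h2 := contDiffGroupoid_le (I := 𝓘(ℂ, Fin n → ℂ)) (m := ∞) (n := ω) (by simp) he
    have h3 := mem_groupoid_of_pregroupoid.1 h2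
    exact mem_groupoid_of_pregroupoid.2
      ⟨ContDiffOn.restrict_scalars ℝ h3.1, ContDiffOn.restrict_scalars ℝ h3.2⟩
  intro e he
  exact ⟨key _ (h e he).1, key _ (h e he).2⟩

/-- `realBasis` as a basis of `ℂⁿ` over `ℝ`. -/
def realCoordBasis (n : ℕ) : Module.Basis (Fin n × Fin 2) ℝ (Fin n → ℂ) :=
  (Pi.basis fun _ : Fin n => Complex.basisOneI).reindex (Equiv.sigmaEquivProd _ _)

theorem realCoordBasis_apply (a : Fin n × Fin 2) : realCoordBasis n a = realBasis a := by
  obtain ⟨j, k⟩ := a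
  rw [realCoordBasis, Module.Basis.reindex_apply, realBasis]
  simp only [Equiv.sigmaEquivProd_symm_apply, Pi.basis_apply, Complex.coe_basisOneI]
  fin_cases k <;> simp

/-- `inChart g φ z` as a bilinear form. -/
def inChartForm (g : BilinField n X) (φ : OpenPartialHomeomorph X (Fin n → ℂ))
    (z : Fin n → ℂ) : LinearMap.BilinForm ℝ (Fin n → ℂ) :=
  let T : (Fin n → ℂ) →L[ℝ] RealTangent n (φ.symm z) :=
    mfderiv 𝓘(ℝ, Fin n → ℂ) 𝓘(ℝ, Fin n → ℂ) φ.symm z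
  LinearMap.mk₂ ℝ (fun u v => g (φ.symm z) (T u) (T v))
    (fun u u' v => by rw [map_add, map_add]; rfl)
    (fun c u v => by rw [map_smul, map_smul]; rfl)
    (fun u v v' => by rw [map_add, map_add])
    (fun c u v => by rw [map_smul, map_smul])

theorem chartDensity_eq (g : BilinField n X) (φ : OpenPartialHomeomorph X (Fin n → ℂ))
    (z : Fin n → ℂ) :
    chartDensity g φ z =
      √(LinearMap.BilinForm.toMatrix (realCoordBasis n) (inChartForm g φ z)).det := by
  rw [chartDensity]
  congr 2
  ext a b
  rw [LinearMap.BilinForm.toMatrix_apply, realCoordBasis_apply, realCoordBasis_apply]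
  rfl

theorem chartVolume_apply [MeasurableSpace X] [BorelSpace X] (g : BilinField n X)
    (φ : OpenPartialHomeomorph X (Fin n → ℂ)) {s : Set X} (hs : MeasurableSet s) :
    chartVolume g φ s =
      ∫⁻ z in φ.target ∩ φ.symm ⁻¹' s, ENNReal.ofReal (chartDensity g φ z) := by
  rw [chartVolume, Measure.map_apply_of_aemeasurable (aemeasurable_chart_symm φ _) hs,
    Measure.restrict_apply' φ.open_target.measurableSet, inter_comm,
    withDensity_apply _ (measurableSet_target_inter_preimage φ hs)]

theorem mdifferentiable_of_mem_maximalAtlas {φ : OpenPartialHomeomorph X (Fin n → ℂ)}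
    (h : φ ∈ IsManifold.maximalAtlas 𝓘(ℂ, Fin n → ℂ) ω X) :
    φ.MDifferentiable 𝓘(ℝ, Fin n → ℂ) 𝓘(ℝ, Fin n → ℂ) :=
  ⟨(contMDiffOn_of_mem_maximalAtlas (mem_maximalAtlas_real h)).mdifferentiableOn (by simp),
    (contMDiffOn_symm_of_mem_maximalAtlas (mem_maximalAtlas_real h)).mdifferentiableOn (by simp)⟩

variable {φ ψ : OpenPartialHomeomorph X (Fin n → ℂ)}

/-- A transition map is differentiable, and its derivative intertwines the derivatives of the
inverse charts. -/
theorem hasFDerivAt_transition (hφ : φ ∈ IsManifold.maximalAtlas 𝓘(ℂ, Fin n → ℂ) ω X)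
    (hψ : ψ ∈ IsManifold.maximalAtlas 𝓘(ℂ, Fin n → ℂ) ω X) {z : Fin n → ℂ} (hz : z ∈ φ.target)
    (hzψ : φ.symm z ∈ ψ.source) :
    HasFDerivAt (ψ ∘ φ.symm) (fderiv ℝ (ψ ∘ φ.symm) z) z ∧
      ∀ u : Fin n → ℂ, mfderiv 𝓘(ℝ, Fin n → ℂ) 𝓘(ℝ, Fin n → ℂ) ψ.symm ((ψ ∘ φ.symm) z)
        (fderiv ℝ (ψ ∘ φ.symm) z u) =
          mfderiv 𝓘(ℝ, Fin n → ℂ) 𝓘(ℝ, Fin n → ℂ) φ.symm z u := by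
  have h1 := (mdifferentiable_of_mem_maximalAtlas hφ).mdifferentiableAt_symm hz
  have h2 := (mdifferentiable_of_mem_maximalAtlas hψ).mdifferentiableAt hzψ
  have h3 : MDifferentiableAt 𝓘(ℝ, Fin n → ℂ) 𝓘(ℝ, Fin n → ℂ) (ψ ∘ φ.symm) z := h2.comp z h1
  have h4 : mfderiv 𝓘(ℝ, Fin n → ℂ) 𝓘(ℝ, Fin n → ℂ) (ψ ∘ φ.symm) z =
      (mfderiv 𝓘(ℝ, Fin n → ℂ) 𝓘(ℝ, Fin n → ℂ) ψ (φ.symm z)).comp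
        (mfderiv 𝓘(ℝ, Fin n → ℂ) 𝓘(ℝ, Fin n → ℂ) φ.symm z) := mfderiv_comp z h2 h1
  refine ⟨(mdifferentiableAt_iff_differentiableAt.1 h3).hasFDerivAt, fun u => ?_⟩
  rw [← mfderiv_eq_fderiv, h4]
  have h5 := (mdifferentiable_of_mem_maximalAtlas hψ).symm_comp_deriv hzψ
  exact congrArg (fun L : TangentSpace 𝓘(ℝ, Fin n → ℂ) (φ.symm z) →L[ℝ]
    TangentSpace 𝓘(ℝ, Fin n → ℂ) (φ.symm z) =>
      L (mfderiv 𝓘(ℝ, Fin n → ℂ) 𝓘(ℝ, Fin n → ℂ) φ.symm z u)) h5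

/-- The volume density transforms by the absolute value of the Jacobian determinant. -/
theorem chartDensity_transition (g : BilinField n X)
    (hφ : φ ∈ IsManifold.maximalAtlas 𝓘(ℂ, Fin n → ℂ) ω X)
    (hψ : ψ ∈ IsManifold.maximalAtlas 𝓘(ℂ, Fin n → ℂ) ω X) {z : Fin n → ℂ} (hz : z ∈ φ.target)
    (hzψ : φ.symm z ∈ ψ.source) :
    chartDensity g φ z = |(fderiv ℝ (ψ ∘ φ.symm) z).det| * chartDensity g ψ ((ψ ∘ φ.symm) z) := by
  obtain ⟨-, hT⟩ := hasFDerivAt_transition hφ hψ hz hzψ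
  set T := fderiv ℝ (ψ ∘ φ.symm) z with hTdef
  have hB : inChartForm g φ z =
      (inChartForm g ψ ((ψ ∘ φ.symm) z)).comp (T : (Fin n → ℂ) →ₗ[ℝ] (Fin n → ℂ)) T := by
    refine LinearMap.ext₂ fun u v => ?_
    have hp : ψ.symm ((ψ ∘ φ.symm) z) = φ.symm z := ψ.left_inv hzψ
    change inChart g φ z u v = inChart g ψ ((ψ ∘ φ.symm) z) (T u) (T v)
    unfold inChart
    rw [hT u, hT v, hp]
  rw [chartDensity_eq, chartDensity_eq, hB, LinearMap.BilinForm.toMatrix_comp (realCoordBasis n),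
    Matrix.det_mul, Matrix.det_mul, Matrix.det_transpose, LinearMap.det_toMatrix, mul_right_comm,
    ← sq, Real.sqrt_mul (sq_nonneg _), Real.sqrt_sq_eq_abs]

variable [MeasurableSpace X] [BorelSpace X]

/-- On the overlap of two charts the two expressions of the Riemannian volume agree. -/
theorem chartVolume_restrict_source (g : BilinField n X)
    (hφ : φ ∈ IsManifold.maximalAtlas 𝓘(ℂ, Fin n → ℂ) ω X)
    (hψ : ψ ∈ IsManifold.maximalAtlas 𝓘(ℂ, Fin n → ℂ) ω X) :
    (chartVolume g φ).restrict ψ.source = (chartVolume g ψ).restrict φ.source := by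
  ext s hs
  have hmφ := φ.open_source.measurableSet
  have hmψ := ψ.open_source.measurableSet
  rw [Measure.restrict_apply hs, Measure.restrict_apply hs, chartVolume_apply _ _ (hs.inter hmψ),
    chartVolume_apply _ _ (hs.inter hmφ)]
  set A := φ.target ∩ φ.symm ⁻¹' (s ∩ ψ.source) with hA
  have hAm : MeasurableSet A :=
    measurableSet_target_inter_preimage φ (hs.inter hmψ)
  have himg : (ψ ∘ φ.symm) '' A = ψ.target ∩ ψ.symm ⁻¹' (s ∩ φ.source) := by
    ext w
    constructor
    · rintro ⟨z, ⟨hz, hzs, hzψ⟩, rfl⟩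
      refine ⟨ψ.map_source hzψ, ?_⟩
      simp only [mem_preimage, Function.comp_apply, ψ.left_inv hzψ]
      exact ⟨hzs, φ.map_target hz⟩
    · rintro ⟨hw, hws, hwφ⟩
      refine ⟨φ (ψ.symm w), ⟨φ.map_source hwφ, ?_⟩, ?_⟩
      · simp only [mem_preimage, φ.left_inv hwφ]
        exact ⟨hws, ψ.map_target hw⟩
      · simp [φ.left_inv hwφ, ψ.right_inv hw]
  have hinj : InjOn (ψ ∘ φ.symm) A := by
    intro z hz w hw h
    exact φ.symm.injOn hz.1 hw.1 (ψ.injOn hz.2.2 hw.2.2 h)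
  rw [← himg, lintegral_image_eq_lintegral_abs_det_fderiv_mul volume hAm
    (fun z hz => (hasFDerivAt_transition hφ hψ hz.1 hz.2.2).1.hasFDerivWithinAt) hinj]
  refine setLIntegral_congr_fun hAm fun z hz => ?_
  rw [chartDensity_transition g hφ hψ hz.1 hz.2.2, ENNReal.ofReal_mul (abs_nonneg _)]

variable [IsManifold 𝓘(ℂ, Fin n → ℂ) ω X]

/-- In any holomorphic chart the Riemannian volume has the density `√(det g_{ab})`. -/
theorem riemannianVolume_restrict_source [CompactSpace X] (g : BilinField n X)
    (hφ : φ ∈ IsManifold.maximalAtlas 𝓘(ℂ, Fin n → ℂ) ω X) :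
    (riemannianVolume g).restrict φ.source = chartVolume g φ := by
  obtain ⟨t, ht⟩ := (isCompact_univ (X := X)).elim_finite_subcover
    (fun x : X => (chartAt (Fin n → ℂ) x).source) (fun x => (chartAt _ x).open_source)
    (fun x _ => mem_iUnion.2 ⟨x, mem_chart_source _ x⟩)
  set ch : t → OpenPartialHomeomorph X (Fin n → ℂ) := fun x => chartAt (Fin n → ℂ) (x : X) with hch
  have hchm : ∀ x, ch x ∈ IsManifold.maximalAtlas 𝓘(ℂ, Fin n → ℂ) ω X :=
    fun x => IsManifold.chart_mem_maximalAtlas _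
  have hcov : ⋃ x, (ch x).source = univ := by
    refine eq_univ_of_univ_subset (ht.trans ?_)
    intro y hy
    simp only [mem_iUnion] at hy ⊢
    obtain ⟨x, hx, hy⟩ := hy
    exact ⟨⟨x, hx⟩, hy⟩
  have e : t ≃ Fin (Fintype.card t) := Fintype.equivFin t
  -- Cut into disjoint pieces, each of which lies in one chart, the chart volumes add up to a
  -- measure that restricts to the chart volume of every chart; it is the supremum of those.
  set S : t → Set X := fun x => (ch x).source \ ⋃ y ∈ {y | e y < e x}, (ch y).source with hS
  have hSm : ∀ x, MeasurableSet (S x) := fun x =>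
    (ch x).open_source.measurableSet.diff
      (isOpen_biUnion fun y _ => (ch y).open_source).measurableSet
  have hSd : Pairwise (Function.onFun Disjoint S) := by
    intro x y hxy
    have key : ∀ x y, e x < e y → Disjoint (S x) (S y) := fun x y h =>
      disjoint_left.2 fun p hp hq => hq.2 (mem_biUnion (x := x) h hp.1)
    rcases lt_or_gt_of_ne (e.injective.ne hxy) with h | h
    · exact key x y h
    · exact (key y x h).symm
  have hSU : ⋃ x, S x = univ := by
    refine eq_univ_of_forall fun p => ?_
    have hp : {x | p ∈ (ch x).source}.Nonempty := by
      have : p ∈ ⋃ x, (ch x).source := hcov ▸ mem_univ p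
      exact mem_iUnion.1 this
    obtain ⟨x, hx, hmin⟩ := (toFinite _).exists_minimalFor e _ hp
    refine mem_iUnion.2 ⟨x, hx, fun hq => ?_⟩
    obtain ⟨y, hy, hpy⟩ := mem_iUnion₂.1 hq
    exact absurd (hmin hpy (le_of_lt hy)) (not_le.2 hy)
  set m : Measure X := Measure.sum fun x => (chartVolume g (ch x)).restrict (S x) with hm
  have hmφ : ∀ φ ∈ IsManifold.maximalAtlas 𝓘(ℂ, Fin n → ℂ) ω X,
      m.restrict φ.source = chartVolume g φ := by
    intro φ hφ
    rw [hm, Measure.restrict_sum_of_countable]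
    have h1 : ∀ x, ((chartVolume g (ch x)).restrict (S x)).restrict φ.source =
        (chartVolume g φ).restrict (S x) := by
      intro x
      rw [Measure.restrict_restrict φ.open_source.measurableSet, inter_comm,
        ← Measure.restrict_restrict (hSm x), chartVolume_restrict_source g (hchm x) hφ,
        Measure.restrict_restrict (hSm x), inter_eq_left.2 sdiff_subset]
    simp_rw [h1]
    rw [← Measure.restrict_iUnion hSd hSm, hSU, Measure.restrict_univ]
  have hmeq : riemannianVolume g = m := by
    apply le_antisymm
    · refine iSup₂_le fun ψ hψ => ?_
      rw [← hmφ ψ (IsManifold.subset_maximalAtlas hψ)]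
      exact Measure.restrict_le_self
    · calc m ≤ Measure.sum fun x => (riemannianVolume g).restrict (S x) := by
            refine Measure.le_iff.2 fun s hs => ?_
            rw [hm, Measure.sum_apply _ hs, Measure.sum_apply _ hs]
            refine ENNReal.tsum_le_tsum fun x => Measure.restrict_mono le_rfl ?_ s
            exact le_iSup₂_of_le (ch x) (chart_mem_atlas _ _) le_rfl
        _ = riemannianVolume g := by
            rw [← Measure.restrict_iUnion hSd hSm, hSU, Measure.restrict_univ]
  rw [hmeq, hmφ φ hφ]

end Volume

/-! ### Regularity of the volume density -/

section Metric

variable {n : ℕ} {X : Type*} [TopologicalSpace X] [ChartedSpace (Fin n → ℂ) X]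
  {φ : OpenPartialHomeomorph X (Fin n → ℂ)}

theorem mfderiv_mfderiv_symm (hφ : φ ∈ IsManifold.maximalAtlas 𝓘(ℂ, Fin n → ℂ) ω X)
    {z : Fin n → ℂ} (hz : z ∈ φ.target) (u : Fin n → ℂ) :
    mfderiv 𝓘(ℝ, Fin n → ℂ) 𝓘(ℝ, Fin n → ℂ) φ (φ.symm z)
      (mfderiv 𝓘(ℝ, Fin n → ℂ) 𝓘(ℝ, Fin n → ℂ) φ.symm z u) = u :=
  congrArg (fun L : TangentSpace 𝓘(ℝ, Fin n → ℂ) z →L[ℝ] TangentSpace 𝓘(ℝ, Fin n → ℂ) z => L u)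
    ((mdifferentiable_of_mem_maximalAtlas hφ).comp_symm_deriv hz)

variable [IsManifold 𝓘(ℂ, Fin n → ℂ) ω X]

theorem continuousOn_inChart (G : SmoothMetric n X)
    (hφ : φ ∈ IsManifold.maximalAtlas 𝓘(ℂ, Fin n → ℂ) ω X) (u v : Fin n → ℂ) :
    ContinuousOn (fun z => inChart G.inner φ z u v) φ.target := by
  have hs : ContMDiffOn 𝓘(ℝ, Fin n → ℂ) 𝓘(ℝ, Fin n → ℂ) ∞ φ.symm φ.target :=
    contMDiffOn_symm_of_mem_maximalAtlas (mem_maximalAtlas_real hφ)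
  have : IsManifold 𝓘(ℝ, Fin n → ℂ) 1 X := IsManifold.of_le (n := ∞) (by simp)
  have hu : UniqueMDiffOn 𝓘(ℝ, Fin n → ℂ) φ.target := φ.open_target.uniqueMDiffOn
  have hsec : ∀ w : Fin n → ℂ, ContMDiffOn 𝓘(ℝ, Fin n → ℂ)
      (𝓘(ℝ, Fin n → ℂ).prod 𝓘(ℝ, Fin n → ℂ)) 1
      (fun z => TotalSpace.mk' (Fin n → ℂ) (E := fun x : X => RealTangent n x) (φ.symm z)
        (mfderiv 𝓘(ℝ, Fin n → ℂ) 𝓘(ℝ, Fin n → ℂ) φ.symm z w)) φ.target := by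
    intro w
    have h1 := hs.contMDiffOn_tangentMapWithin (m := 1) (by norm_cast) hu
    have h2 : ContMDiffOn 𝓘(ℝ, Fin n → ℂ) (𝓘(ℝ, Fin n → ℂ).prod 𝓘(ℝ, Fin n → ℂ)) 1
        (fun z : Fin n → ℂ => (⟨z, w⟩ : TangentBundle 𝓘(ℝ, Fin n → ℂ) (Fin n → ℂ))) φ.target := by
      intro z _
      rw [contMDiffWithinAt_totalSpace]
      refine ⟨contMDiffWithinAt_id, ?_⟩
      simpa using contMDiffWithinAt_const
    refine (h1.comp h2 fun z hz => hz).congr fun z hz => ?_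
    simp only [Function.comp_apply, tangentMapWithin]
    rw [mfderivWithin_of_isOpen φ.open_target hz]
  intro z hz
  have h : ContMDiffWithinAt 𝓘(ℝ, Fin n → ℂ) (𝓘(ℝ, Fin n → ℂ).prod 𝓘(ℝ, ℝ)) 1
      (fun z => TotalSpace.mk' ℝ (E := Bundle.Trivial X ℝ) (φ.symm z)
        (G.inner (φ.symm z) (mfderiv 𝓘(ℝ, Fin n → ℂ) 𝓘(ℝ, Fin n → ℂ) φ.symm z u)
          (mfderiv 𝓘(ℝ, Fin n → ℂ) 𝓘(ℝ, Fin n → ℂ) φ.symm z v))) φ.target z := by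
    apply ContMDiffWithinAt.clm_bundle_apply₂ (F₁ := Fin n → ℂ) (F₂ := Fin n → ℂ)
    · exact ContMDiffAt.comp_contMDiffWithinAt z (G.contMDiff.of_le (by simp)).contMDiffAt
        ((hs z hz).of_le (by simp))
    · exact hsec u z hz
    · exact hsec v z hz
  rw [contMDiffWithinAt_totalSpace] at h
  exact h.2.continuousWithinAt

theorem chartDensity_pos (G : SmoothMetric n X)
    (hφ : φ ∈ IsManifold.maximalAtlas 𝓘(ℂ, Fin n → ℂ) ω X) {z : Fin n → ℂ} (hz : z ∈ φ.target) :
    0 < chartDensity G.inner φ z := by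
  rw [chartDensity_eq, Real.sqrt_pos]
  refine Matrix.PosDef.det_pos ?_
  refine Matrix.PosDef.of_dotProduct_mulVec_pos ?_ ?_
  · ext a b
    rw [Matrix.conjTranspose_apply, LinearMap.BilinForm.toMatrix_apply,
      LinearMap.BilinForm.toMatrix_apply]
    exact G.symm _ _ _
  · intro x hx
    set u : Fin n → ℂ := (realCoordBasis n).equivFun.symm x with hu
    have hune : u ≠ 0 := by
      rw [hu]
      exact (LinearEquiv.map_ne_zero_iff _).2 hx
    have h1 : star x ⬝ᵥ (LinearMap.BilinForm.toMatrix (realCoordBasis n)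
        (inChartForm G.inner φ z)).mulVec x = inChartForm G.inner φ z u u := by
      rw [LinearMap.BilinForm.dotProduct_toMatrix_mulVec]
      rfl
    rw [h1]
    refine G.pos _ _ fun h0 => hune ?_
    rw [← mfderiv_mfderiv_symm hφ hz u]
    erw [h0]
    exact map_zero _

theorem continuousOn_chartDensity (G : SmoothMetric n X)
    (hφ : φ ∈ IsManifold.maximalAtlas 𝓘(ℂ, Fin n → ℂ) ω X) :
    ContinuousOn (chartDensity G.inner φ) φ.target := by
  unfold chartDensity
  refine Real.continuous_sqrt.comp_continuousOn ?_
  simp only [Matrix.det_apply, Matrix.of_apply]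
  refine continuousOn_finsetSum _ fun σ _ => ContinuousOn.const_smul ?_ _
  exact continuousOn_finsetProd _ fun a _ => continuousOn_inChart G hφ _ _

end Metric

/-! ### Comparison of the weights with powers of the coordinates -/

section Weights

variable {n : ℕ} {X : Type*} [TopologicalSpace X] [ChartedSpace (Fin n → ℂ) X]

theorem rpow_le_of_comparable {c C T x : ℝ} (hc : 0 < c) (hT : 0 < T) (h1 : c * T ≤ x)
    (h2 : x ≤ C * T) (e : ℝ) : x ^ e ≤ (c ^ e + C ^ e) * T ^ e := by
  have h3 : c ≤ x / T := (le_div_iff₀ hT).2 h1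
  have h4 : x / T ≤ C := (div_le_iff₀ hT).2 h2
  have h5 : x = x / T * T := by field_simp
  rw [h5, Real.mul_rpow (hc.le.trans h3) hT.le]
  gcongr
  exact rpow_le_add_rpow hc h3 h4 e

/-- `K` controls the quotients of `x` and `y` in both directions. -/
def Comparable (K x y : ℝ) : Prop := x ≤ K * y ∧ y ≤ K * x

theorem exists_comparable_rpow {c C : ℝ} (hc : 0 < c) (hC : 0 < C) (e : ℝ) :
    ∃ K : ℝ, 0 < K ∧ ∀ T x : ℝ, 0 < T → c * T ≤ x → x ≤ C * T → Comparable K (x ^ e) (T ^ e) := by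
  refine ⟨(c ^ e + C ^ e) + (C⁻¹ ^ e + c⁻¹ ^ e), by positivity, fun T x hT h1 h2 => ?_⟩
  have hx : 0 < x := lt_of_lt_of_le (by positivity) h1
  have hTe := Real.rpow_pos_of_pos hT e
  have hxe := Real.rpow_pos_of_pos hx e
  constructor
  · refine (rpow_le_of_comparable hc hT h1 h2 e).trans ?_
    exact mul_le_mul_of_nonneg_right (le_add_of_nonneg_right (by positivity)) hTe.le
  · have h3 : C⁻¹ * x ≤ T := by rw [inv_mul_le_iff₀ hC]; exact h2
    have h4 : T ≤ c⁻¹ * x := by rw [le_inv_mul_iff₀ hc]; exact h1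
    refine (rpow_le_of_comparable (inv_pos.2 hC) hx h3 h4 e).trans ?_
    exact mul_le_mul_of_nonneg_right (le_add_of_nonneg_left (by positivity)) hxe.le

theorem Comparable.prod {ι : Type*} {s : Finset ι} {K x y : ι → ℝ} (hx : ∀ i ∈ s, 0 ≤ x i)
    (hy : ∀ i ∈ s, 0 ≤ y i) (h : ∀ i ∈ s, Comparable (K i) (x i) (y i)) :
    Comparable (∏ i ∈ s, K i) (∏ i ∈ s, x i) (∏ i ∈ s, y i) := by
  constructor
  · rw [← Finset.prod_mul_distrib]
    exact Finset.prod_le_prod hx fun i hi => (h i hi).1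
  · rw [← Finset.prod_mul_distrib]
    exact Finset.prod_le_prod hy fun i hi => (h i hi).2

theorem Comparable.mul {K K' x y x' y' : ℝ} (hx : 0 ≤ x) (hy : 0 ≤ y) (hx' : 0 ≤ x')
    (hy' : 0 ≤ y') (h : Comparable K x y) (h' : Comparable K' x' y') :
    Comparable (K * K') (x * x') (y * y') := by
  constructor
  · calc x * x' ≤ (K * y) * (K' * y') := mul_le_mul h.1 h'.1 hx' (hx.trans h.1)
      _ = _ := by ring
  · calc y * y' ≤ (K * x) * (K' * x') := mul_le_mul h.2 h'.2 hy' (hy.trans h.2)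
      _ = _ := by ring

variable {φ : OpenPartialHomeomorph X (Fin n → ℂ)}

/-- The coordinate `z_j` as a local equation of the hypersurface `z_j = 0`. -/
def coordEquation {D : Set X} (hφ : φ ∈ IsManifold.maximalAtlas 𝓘(ℂ, Fin n → ℂ) ω X) (j : Fin n)
    (hD : ∀ y ∈ φ.source, y ∈ D ↔ φ y j = 0) : LocalEquation n D where
  U := φ.source
  isOpen := φ.open_source
  s := fun y => φ y j
  holomorphic := by
    have h1 : ContMDiff 𝓘(ℂ, Fin n → ℂ) 𝓘(ℂ, ℂ) ω
        (ContinuousLinearMap.proj (R := ℂ) (φ := fun _ : Fin n => ℂ) j) :=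
      (ContinuousLinearMap.proj (R := ℂ) (φ := fun _ : Fin n => ℂ) j).contMDiff
    exact h1.comp_contMDiffOn (contMDiffOn_of_mem_maximalAtlas hφ)
  zero_iff := fun x hx => (hD x hx).symm
  reduced := by
    intro x hx _ h0
    have hmd : φ.MDifferentiable 𝓘(ℂ, Fin n → ℂ) 𝓘(ℂ, Fin n → ℂ) :=
      ⟨(contMDiffOn_of_mem_maximalAtlas hφ).mdifferentiableOn (by simp),
        (contMDiffOn_symm_of_mem_maximalAtlas hφ).mdifferentiableOn (by simp)⟩
    set P := ContinuousLinearMap.proj (R := ℂ) (φ := fun _ : Fin n => ℂ) j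
    have h2 : mfderiv 𝓘(ℂ, Fin n → ℂ) 𝓘(ℂ, ℂ) (P ∘ φ) x =
        (mfderiv 𝓘(ℂ, Fin n → ℂ) 𝓘(ℂ, ℂ) P (φ x)).comp
          (mfderiv 𝓘(ℂ, Fin n → ℂ) 𝓘(ℂ, Fin n → ℂ) φ x) :=
      mfderiv_comp x P.differentiableAt.mdifferentiableAt (hmd.mdifferentiableAt hx)
    have h3 := hmd.comp_symm_deriv (φ.map_source hx)
    rw [φ.left_inv hx] at h3
    have h4 : (show ℂ from mfderiv 𝓘(ℂ, Fin n → ℂ) 𝓘(ℂ, ℂ) (P ∘ φ) x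
        (mfderiv 𝓘(ℂ, Fin n → ℂ) 𝓘(ℂ, Fin n → ℂ) φ.symm (φ x)
          (Pi.single j (1 : ℂ) : Fin n → ℂ))) = 1 := by
      rw [h2, mfderiv_eq_fderiv, P.fderiv]
      have h5 := congrArg (fun L : TangentSpace 𝓘(ℂ, Fin n → ℂ) (φ x) →L[ℂ]
        TangentSpace 𝓘(ℂ, Fin n → ℂ) (φ x) => P (L (Pi.single j (1 : ℂ) : Fin n → ℂ))) h3
      refine Eq.trans h5 ?_
      change (Pi.single j (1 : ℂ) : Fin n → ℂ) j = 1
      simp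
    change mfderiv 𝓘(ℂ, Fin n → ℂ) 𝓘(ℂ, ℂ) (P ∘ φ) x = 0 at h0
    rw [h0] at h4
    exact zero_ne_one (α := ℂ) h4

/-- The constant `1` as a local equation outside of the hypersurface. -/
def unitEquation {D : Set X} (φ : OpenPartialHomeomorph X (Fin n → ℂ))
    (hD : ∀ y ∈ φ.source, y ∉ D) : LocalEquation n D where
  U := φ.source
  isOpen := φ.open_source
  s := fun _ => 1
  holomorphic := contMDiffOn_const
  zero_iff := fun x hx => by simp [hD x hx]
  reduced := fun x hx hxD => absurd hxD (hD x hx)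

/-- Near a point `|σ|²` is comparable to `|s|²`, for a local equation `s`. -/
theorem HermitianMetric.exists_bounds {D : Set X} (h : HermitianMetric n D)
    (e : LocalEquation n D) {x : X} (hx : x ∈ e.U) :
    ∃ c C : ℝ, 0 < c ∧ 0 < C ∧
      ∀ᶠ y in 𝓝 x, c * ‖e.s y‖ ^ 2 ≤ h.normSq y ∧ h.normSq y ≤ C * ‖e.s y‖ ^ 2 := by
  have hpos := h.pos e x hx
  have hcont : ContinuousAt (h.weight e) x :=
    (h.smooth e).continuousOn.continuousAt (e.isOpen.mem_nhds hx)
  refine ⟨h.weight e x / 2, 2 * h.weight e x, by positivity, by positivity, ?_⟩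
  filter_upwards [e.isOpen.mem_nhds hx, hcont.eventually (lt_mem_nhds (half_lt_self hpos)),
    hcont.eventually (gt_mem_nhds (show h.weight e x < 2 * h.weight e x by linarith))]
    with y hy h1 h2
  rw [h.normSq_eq e hy]
  constructor <;> gcongr

/-- The power of `ε² + |z_k|²` that corresponds to a divisor component, which is the hyperplane
`z_k = 0` if `o = some k`, and which does not meet the chart if `o = none`. -/
def coordPower (o : Option (Fin n)) (e ε : ℝ) (z : Fin n → ℂ) : ℝ :=
  ∏ k, if o = some k then (ε ^ 2 + ‖z k‖ ^ 2) ^ e else 1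

theorem coordPower_pos {o : Option (Fin n)} {e ε : ℝ} {z : Fin n → ℂ} (hz : ∀ k, z k ≠ 0) :
    0 < coordPower o e ε z := by
  refine Finset.prod_pos fun k _ => ?_
  have := norm_pos_iff.2 (hz k)
  split_ifs <;> positivity

/-- Near a point `(ε² + |σ|²)^e` is comparable to `(ε² + |z_j|²)^e` if the divisor is `z_j = 0`, and
to `1` if it is absent, uniformly in `ε`. -/
theorem HermitianMetric.exists_comparable_normSq {D : Set X} (h : HermitianMetric n D)
    (hφ : φ ∈ IsManifold.maximalAtlas 𝓘(ℂ, Fin n → ℂ) ω X) {x : X} (hx : x ∈ φ.source)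
    {o : Option (Fin n)} (hsome : ∀ j, o = some j → ∀ y ∈ φ.source, y ∈ D ↔ φ y j = 0)
    (hnone : o = none → ∀ y ∈ φ.source, y ∉ D) (e ε₀ : ℝ) :
    ∃ K : ℝ, 0 < K ∧ ∀ᶠ y in 𝓝 x, ∀ ε ∈ Icc 0 ε₀, (∀ k, φ y k ≠ 0) →
      0 < ε ^ 2 + h.normSq y ∧
        Comparable K ((ε ^ 2 + h.normSq y) ^ e) (coordPower o e ε (φ y)) := by
  rcases o with _ | j
  · obtain ⟨c, C, hc, hC, hcC⟩ := h.exists_bounds (unitEquation φ (hnone rfl)) hx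
    obtain ⟨K, hK, hKc⟩ := exists_comparable_rpow hc (show 0 < ε₀ ^ 2 + C by positivity) e
    refine ⟨K, hK, hcC.mono fun y hy ε hε _ => ?_⟩
    simp only [unitEquation, norm_one, one_pow, mul_one] at hy
    have h0 := hε.1
    have h1 : ε ^ 2 ≤ ε₀ ^ 2 := by have := hε.2; gcongr
    have h2 := sq_nonneg ε
    refine ⟨by linarith, ?_⟩
    have := hKc 1 (ε ^ 2 + h.normSq y) one_pos (by linarith) (by linarith)
    simpa [coordPower] using this
  · obtain ⟨c, C, hc, hC, hcC⟩ := h.exists_bounds (coordEquation hφ j (hsome j rfl)) hx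
    obtain ⟨K, hK, hKc⟩ := exists_comparable_rpow (show 0 < min 1 c by positivity)
      (show 0 < max 1 C by positivity) e
    refine ⟨K, hK, hcC.mono fun y hy ε hε hne => ?_⟩
    simp only [coordEquation] at hy
    have hj := norm_pos_iff.2 (hne j)
    have hT : 0 < ε ^ 2 + ‖φ y j‖ ^ 2 := by positivity
    have h1 : min 1 c * (ε ^ 2 + ‖φ y j‖ ^ 2) ≤ ε ^ 2 + h.normSq y := by
      have e1 : min 1 c * ε ^ 2 ≤ 1 * ε ^ 2 := by gcongr; exact min_le_left _ _
      have e2 : min 1 c * ‖φ y j‖ ^ 2 ≤ c * ‖φ y j‖ ^ 2 := by gcongr; exact min_le_right _ _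
      linarith [hy.1]
    have h2 : ε ^ 2 + h.normSq y ≤ max 1 C * (ε ^ 2 + ‖φ y j‖ ^ 2) := by
      have e1 : 1 * ε ^ 2 ≤ max 1 C * ε ^ 2 := by gcongr; exact le_max_left _ _
      have e2 : C * ‖φ y j‖ ^ 2 ≤ max 1 C * ‖φ y j‖ ^ 2 := by gcongr; exact le_max_right _ _
      linarith [hy.2]
    refine ⟨lt_of_lt_of_le (by positivity) h1, ?_⟩
    have := hKc _ _ hT h1 h2
    have he : coordPower (some j) e ε (φ y) = (ε ^ 2 + ‖φ y j‖ ^ 2) ^ e := by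
      simp [coordPower]
    rwa [he]

/-- The exponent of `ε² + |z_k|²` in the weight with the exponents `e i` along the components of a
divisor with the chart data `κ`. -/
def coordExponent {ι : Type*} [Fintype ι] (κ : ι → Option (Fin n)) (e : ι → ℝ) (k : Fin n) : ℝ :=
  ∑ i, if κ i = some k then e i else 0

theorem prod_coordPower {ι : Type*} [Fintype ι] (κ : ι → Option (Fin n)) (e : ι → ℝ) {ε : ℝ}
    {z : Fin n → ℂ} (hz : ∀ k, z k ≠ 0) :
    ∏ i, coordPower (κ i) (e i) ε z = ∏ k, (ε ^ 2 + ‖z k‖ ^ 2) ^ coordExponent κ e k := by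
  unfold coordPower coordExponent
  rw [Finset.prod_comm]
  refine Finset.prod_congr rfl fun k _ => ?_
  have := norm_pos_iff.2 (hz k)
  rw [Real.rpow_sum_of_pos (show 0 < ε ^ 2 + ‖z k‖ ^ 2 by positivity)]
  refine Finset.prod_congr rfl fun i _ => ?_
  split_ifs <;> simp

theorem modelCoeff_eq {I J : Type*} [Fintype J] (b : J → ℝ) (κ : I ⊕ J → Option (Fin n)) (ε : ℝ)
    {z : Fin n → ℂ} {j : Fin n} (hz : z j ≠ 0) :
    modelCoeff b κ ε z j =
      (ε ^ 2 + ‖z j‖ ^ 2) ^ coordExponent (fun β => κ (Sum.inr β)) (fun β => -b β) j := by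
  have := norm_pos_iff.2 hz
  unfold modelCoeff coordExponent
  rw [Real.rpow_sum_of_pos (show 0 < ε ^ 2 + ‖z j‖ ^ 2 by positivity)]
  refine Finset.prod_congr rfl fun i _ => ?_
  split_ifs <;> simp

/-- Near a point the density of `weightedVolume` is comparable to a product of powers of
`ε² + |z_k|²` in an adapted chart, uniformly in `ε`. -/
theorem exists_comparable_density {I J : Type*} [Fintype I] [Fintype J] {E : I → Set X}
    {B : J → Set X} (hE : ∀ α, HermitianMetric n (E α)) (hB : ∀ β, HermitianMetric n (B β))
    {x : X} {κ : I ⊕ J → Option (Fin n)} (h : IsAdaptedChart (Sum.elim E B) x φ κ)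
    (e : I → ℝ) (b : J → ℝ) (ε₀ : ℝ) :
    ∃ K : ℝ, 0 < K ∧ ∀ᶠ y in 𝓝 x, ∀ ε ∈ Icc 0 ε₀, (∀ k, φ y k ≠ 0) →
      Comparable K
        ((∏ α, (ε ^ 2 + (hE α).normSq y) ^ e α) / ∏ β, (ε ^ 2 + (hB β).normSq y) ^ b β)
        (∏ k, (ε ^ 2 + ‖φ y k‖ ^ 2) ^ (coordExponent (fun α => κ (Sum.inl α)) e k +
          coordExponent (fun β => κ (Sum.inr β)) (fun β => -b β) k)) := by
  choose K₁ hK₁ h₁ using fun α => (hE α).exists_comparable_normSq h.mem_maximalAtlas h.mem_source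
    (o := κ (Sum.inl α)) (fun j hj => h.hyperplane (Sum.inl α) j hj)
    (fun hn => h.absent (Sum.inl α) hn) (e α) ε₀
  choose K₂ hK₂ h₂ using fun β => (hB β).exists_comparable_normSq h.mem_maximalAtlas h.mem_source
    (o := κ (Sum.inr β)) (fun j hj => h.hyperplane (Sum.inr β) j hj)
    (fun hn => h.absent (Sum.inr β) hn) (-b β) ε₀
  refine ⟨(∏ α, K₁ α) * ∏ β, K₂ β, mul_pos (Finset.prod_pos fun α _ => hK₁ α)
    (Finset.prod_pos fun β _ => hK₂ β), ?_⟩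
  filter_upwards [eventually_all.2 h₁, eventually_all.2 h₂] with y hy₁ hy₂ ε hε hne
  have e1 : (∏ α, (ε ^ 2 + (hE α).normSq y) ^ e α) / ∏ β, (ε ^ 2 + (hB β).normSq y) ^ b β =
      (∏ α, (ε ^ 2 + (hE α).normSq y) ^ e α) * ∏ β, (ε ^ 2 + (hB β).normSq y) ^ (-b β) := by
    rw [div_eq_mul_inv, ← Finset.prod_inv_distrib]
    congr 1
    refine Finset.prod_congr rfl fun β _ => ?_
    rw [Real.rpow_neg (hy₂ β ε hε hne).1.le]
  have e2 : ∏ k, (ε ^ 2 + ‖φ y k‖ ^ 2) ^ (coordExponent (fun α => κ (Sum.inl α)) e k +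
        coordExponent (fun β => κ (Sum.inr β)) (fun β => -b β) k) =
      (∏ α, coordPower (κ (Sum.inl α)) (e α) ε (φ y)) *
        ∏ β, coordPower (κ (Sum.inr β)) (-b β) ε (φ y) := by
    rw [prod_coordPower (fun α => κ (Sum.inl α)) e hne,
      prod_coordPower (fun β => κ (Sum.inr β)) (fun β => -b β) hne, ← Finset.prod_mul_distrib]
    refine Finset.prod_congr rfl fun k _ => ?_
    have := norm_pos_iff.2 (hne k)
    rw [Real.rpow_add (by positivity)]
  rw [e1, e2]
  have p1 : ∀ α, 0 ≤ (ε ^ 2 + (hE α).normSq y) ^ e α := fun α =>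
    Real.rpow_nonneg (hy₁ α ε hε hne).1.le _
  have p2 : ∀ β, 0 ≤ (ε ^ 2 + (hB β).normSq y) ^ (-b β) := fun β =>
    Real.rpow_nonneg (hy₂ β ε hε hne).1.le _
  have p3 : ∀ α, 0 ≤ coordPower (κ (Sum.inl α)) (e α) ε (φ y) := fun α => (coordPower_pos hne).le
  have p4 : ∀ β, 0 ≤ coordPower (κ (Sum.inr β)) (-b β) ε (φ y) := fun β => (coordPower_pos hne).le
  refine Comparable.mul (Finset.prod_nonneg fun α _ => p1 α) (Finset.prod_nonneg fun α _ => p3 α)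
    (Finset.prod_nonneg fun β _ => p2 β) (Finset.prod_nonneg fun β _ => p4 β) ?_ ?_
  · exact Comparable.prod (fun α _ => p1 α) (fun α _ => p3 α) fun α _ => (hy₁ α ε hε hne).2
  · exact Comparable.prod (fun β _ => p2 β) (fun β _ => p4 β) fun β _ => (hy₂ β ε hε hne).2

theorem coordExponent_nonneg {ι : Type*} [Fintype ι] {κ : ι → Option (Fin n)} {e : ι → ℝ}
    (he : ∀ i, 0 ≤ e i) (k : Fin n) : 0 ≤ coordExponent κ e k :=
  Finset.sum_nonneg fun i _ => by split_ifs <;> simp [he]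

/-- As different components are different hyperplanes, at most one of them contributes. -/
theorem neg_one_lt_coordExponent {ι : Type*} [Fintype ι] {κ : ι → Option (Fin n)} {e : ι → ℝ}
    (hκ : ∀ i i' j, κ i = some j → κ i' = some j → i = i') (he : ∀ i, -1 < e i) (k : Fin n) :
    -1 < coordExponent κ e k := by
  unfold coordExponent
  by_cases h : ∃ i, κ i = some k
  · obtain ⟨i, hi⟩ := h
    rw [Finset.sum_eq_single i]
    · simpa [hi] using he i
    · intro i' _ hne
      rw [if_neg fun h' => hne (hκ _ _ _ h' hi)]
    · simp
  · rw [Finset.sum_eq_zero]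
    · norm_num
    · intro i _
      rw [if_neg fun h' => h ⟨i, h'⟩]

end Weights

/-! ### The gradient in an adapted chart -/

section Gradient

variable {n : ℕ} {X : Type*} [TopologicalSpace X] [ChartedSpace (Fin n → ℂ) X]

/-- The real differential of a function, with values in the target itself. -/
def realDiff {F : Type*} [NormedAddCommGroup F] [NormedSpace ℝ F] (f : X → F) (y : X) :
    RealTangent n y →L[ℝ] F :=
  mfderiv 𝓘(ℝ, Fin n → ℂ) 𝓘(ℝ, F) f y

/-- The gradient exists, because a definite form is nondegenerate. -/
theorem metricGradient_spec {g : BilinField n X} {y : X}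
    (hpos : ∀ v : RealTangent n y, v ≠ 0 → 0 < g y v v) (u : X → ℝ) (v : RealTangent n y) :
    g y (metricGradient g u y) v = realDiff u y v := by
  have hfd : FiniteDimensional ℝ (RealTangent n y) :=
    inferInstanceAs (FiniteDimensional ℝ (Fin n → ℂ))
  let L : RealTangent n y →ₗ[ℝ] Module.Dual ℝ (RealTangent n y) :=
    { toFun := fun w => (g y w : RealTangent n y →ₗ[ℝ] ℝ)
      map_add' := fun w w' => by rw [map_add]; rfl
      map_smul' := fun c w => by rw [map_smul]; rfl }
  have hinj : Function.Injective L := by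
    rw [injective_iff_map_eq_zero]
    intro w hw
    by_contra hne
    have h1 := hpos w hne
    have h2 : L w w = 0 := by rw [hw]; rfl
    exact h1.ne' h2
  have hsurj : Function.Surjective L :=
    (LinearMap.injective_iff_surjective_of_finrank_eq_finrank
      (Subspace.dual_finrank_eq (K := ℝ) (V := RealTangent n y)).symm).1 hinj
  obtain ⟨w, hw⟩ := hsurj (realDiff (n := n) u y).toLinearMap
  have hex : ∃ w : RealTangent n y, ∀ v : RealTangent n y,
      g y w v = realDiff u y v :=
    ⟨w, fun v => LinearMap.congr_fun hw v⟩
  exact Classical.epsilon_spec hex v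

/-- The Cauchy–Schwarz inequality for the gradient. -/
theorem sq_realDiff_le {g : BilinField n X} {y : X}
    (hsymm : ∀ v w : RealTangent n y, g y v w = g y w v)
    (hpos : ∀ v : RealTangent n y, v ≠ 0 → 0 < g y v v) (u : X → ℝ) (v : RealTangent n y) :
    realDiff u y v ^ 2 ≤
      g y (metricGradient g u y) (metricGradient g u y) * g y v v := by
  rw [← metricGradient_spec hpos u v]
  let L : LinearMap.BilinForm ℝ (RealTangent n y) :=
    LinearMap.mk₂ ℝ (fun w w' => g y w w') (fun w w' v => by rw [map_add]; rfl)
      (fun c w v => by rw [map_smul]; rfl) (fun w v v' => by rw [map_add])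
      (fun c w v => by rw [map_smul])
  have hnn : ∀ w, 0 ≤ L w w := by
    intro w
    by_cases hw : w = 0
    · rw [hw]; simp
    · exact (hpos w hw).le
  exact LinearMap.BilinForm.apply_sq_le_of_symm L hnn ⟨fun v w => hsymm v w⟩ _ _

theorem norm_sq_realDiff_le {g : BilinField n X} {y : X}
    (hsymm : ∀ v w : RealTangent n y, g y v w = g y w v)
    (hpos : ∀ v : RealTangent n y, v ≠ 0 → 0 < g y v v) {f : X → ℂ}
    (hf : MDifferentiableAt 𝓘(ℝ, Fin n → ℂ) 𝓘(ℝ, ℂ) f y) (v : RealTangent n y) :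
    ‖realDiff f y v‖ ^ 2 ≤ gradNorm g f y ^ 2 * g y v v := by
  have hnn : ∀ w : RealTangent n y, 0 ≤ g y w w := by
    intro w
    by_cases hw : w = 0
    · rw [hw]; simp
    · exact (hpos w hw).le
  have hre : realDiff (fun x => (f x).re) y v =
      (realDiff f y v).re := by
    have h1 : mfderiv 𝓘(ℝ, Fin n → ℂ) 𝓘(ℝ, ℝ) (Complex.reCLM ∘ f) y =
        (mfderiv 𝓘(ℝ, ℂ) 𝓘(ℝ, ℝ) Complex.reCLM (f y)).comp
          (mfderiv 𝓘(ℝ, Fin n → ℂ) 𝓘(ℝ, ℂ) f y) :=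
      mfderiv_comp y Complex.reCLM.differentiableAt.mdifferentiableAt hf
    change mfderiv 𝓘(ℝ, Fin n → ℂ) 𝓘(ℝ, ℝ) (Complex.reCLM ∘ f) y v = _
    rw [h1, mfderiv_eq_fderiv, Complex.reCLM.fderiv]
    rfl
  have him : realDiff (fun x => (f x).im) y v =
      (realDiff f y v).im := by
    have h1 : mfderiv 𝓘(ℝ, Fin n → ℂ) 𝓘(ℝ, ℝ) (Complex.imCLM ∘ f) y =
        (mfderiv 𝓘(ℝ, ℂ) 𝓘(ℝ, ℝ) Complex.imCLM (f y)).comp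
          (mfderiv 𝓘(ℝ, Fin n → ℂ) 𝓘(ℝ, ℂ) f y) :=
      mfderiv_comp y Complex.imCLM.differentiableAt.mdifferentiableAt hf
    change mfderiv 𝓘(ℝ, Fin n → ℂ) 𝓘(ℝ, ℝ) (Complex.imCLM ∘ f) y v = _
    rw [h1, mfderiv_eq_fderiv, Complex.imCLM.fderiv]
    rfl
  have h1 := sq_realDiff_le hsymm hpos (fun x => (f x).re) v
  have h2 := sq_realDiff_le hsymm hpos (fun x => (f x).im) v
  rw [hre] at h1
  rw [him] at h2
  rw [gradNorm, Real.sq_sqrt (add_nonneg (hnn _) (hnn _)), ← Complex.normSq_eq_norm_sq,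
    Complex.normSq_apply]
  nlinarith [h1, h2]

/-- The Euclidean derivative along the `j`-th coordinate axis is bounded by the gradient with
respect to a metric that is bounded by the model metric. -/
theorem norm_partialFDeriv_le {I J : Type*} [Fintype J] {b : J → ℝ}
    {κ : I ⊕ J → Option (Fin n)} {ε A : ℝ} (hA : 0 < A) {g : BilinField n X}
    {φ : OpenPartialHomeomorph X (Fin n → ℂ)}
    (hφ : φ ∈ IsManifold.maximalAtlas 𝓘(ℂ, Fin n → ℂ) ω X) {y : X} (hy : y ∈ φ.source)
    (hsymm : ∀ v w : RealTangent n y, g y v w = g y w v)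
    (hpos : ∀ v : RealTangent n y, v ≠ 0 → 0 < g y v v)
    (hgA : ∀ v : RealTangent n y, g y v v ≤ A * modelMetric b κ ε (φ y)
      (mfderiv 𝓘(ℝ, Fin n → ℂ) 𝓘(ℝ, Fin n → ℂ) φ y v))
    {f : X → ℂ} (hf : MDifferentiableAt 𝓘(ℝ, Fin n → ℂ) 𝓘(ℝ, ℂ) f y) {F : (Fin n → ℂ) → ℂ}
    (hF : F =ᶠ[𝓝 (φ y)] f ∘ φ.symm) (j : Fin n) (hj : φ y j ≠ 0) :
    ‖partialFDeriv F j (φ y)‖ ≤ √(A * modelCoeff b κ ε (φ y) j) * gradNorm g f y := by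
  have hc : 0 ≤ modelCoeff b κ ε (φ y) j := by
    rw [modelCoeff_eq b κ ε hj]
    positivity
  refine ContinuousLinearMap.opNorm_le_bound _
    (mul_nonneg (Real.sqrt_nonneg _) (Real.sqrt_nonneg _)) fun ζ => ?_
  have hz := φ.map_source hy
  have hmd := mdifferentiable_of_mem_maximalAtlas hφ
  set w : RealTangent n (φ.symm (φ y)) :=
    mfderiv 𝓘(ℝ, Fin n → ℂ) 𝓘(ℝ, Fin n → ℂ) φ.symm (φ y) (Pi.single j ζ : Fin n → ℂ) with hw
  have hleft := φ.left_inv hy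
  have hf' : MDifferentiableAt 𝓘(ℝ, Fin n → ℂ) 𝓘(ℝ, ℂ) f (φ.symm (φ y)) := by rwa [hleft]
  have h1 : partialFDeriv F j (φ y) ζ =
      realDiff f (φ.symm (φ y)) w := by
    have h2 : mfderiv 𝓘(ℝ, Fin n → ℂ) 𝓘(ℝ, ℂ) (f ∘ φ.symm) (φ y) =
        (mfderiv 𝓘(ℝ, Fin n → ℂ) 𝓘(ℝ, ℂ) f (φ.symm (φ y))).comp
          (mfderiv 𝓘(ℝ, Fin n → ℂ) 𝓘(ℝ, Fin n → ℂ) φ.symm (φ y)) :=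
      mfderiv_comp _ hf' (hmd.mdifferentiableAt_symm hz)
    rw [mfderiv_eq_fderiv] at h2
    rw [partialFDeriv, hF.fderiv_eq, h2]
    rfl
  have h3 : ‖realDiff f (φ.symm (φ y)) w‖ ^ 2 ≤
      gradNorm g f y ^ 2 * (A * (modelCoeff b κ ε (φ y) j * ‖ζ‖ ^ 2)) := by
    have hmw := mfderiv_mfderiv_symm hφ hz (Pi.single j ζ : Fin n → ℂ)
    rw [← hw] at hmw
    have hmod : modelMetric b κ ε (φ y) (Pi.single j ζ) = modelCoeff b κ ε (φ y) j * ‖ζ‖ ^ 2 := by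
      unfold modelMetric
      rw [Finset.sum_eq_single j]
      · simp
      · intro k _ hk
        simp [Pi.single_eq_of_ne hk]
      · simp
    -- `φ.symm (φ y)` and `y` are equal only propositionally, so the tangent spaces differ as types.
    clear_value w
    generalize φ.symm (φ y) = y' at *
    subst hleft
    refine (norm_sq_realDiff_le hsymm hpos hf w).trans ?_
    rw [← hmod, ← hmw]
    exact mul_le_mul_of_nonneg_left (hgA w) (sq_nonneg _)
  rw [h1]
  refine abs_le_of_sq_le_sq' ?_ (by unfold gradNorm; positivity) |>.2
  refine h3.trans (le_of_eq ?_)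
  rw [mul_pow, mul_pow, Real.sq_sqrt (by positivity)]
  ring

end Gradient

/-! ### From local to global oscillation estimates -/

section Chaining

variable {X T : Type*} [MeasurableSpace X]
  {μ : T → Measure X} {F : T → X → ℂ} {R : T → ℝ≥0∞} {p : ℝ}

/-- The oscillation integrals `∬_{S × S'} |F x - F y|^p dμ dμ` of a family of functions with respect
to a family of measures are bounded by a constant multiple of a family `R` of numbers. -/
def OscControlled (μ : T → Measure X) (F : T → X → ℂ) (R : T → ℝ≥0∞) (p : ℝ) (S S' : Set X) :
    Prop :=
  ∃ C : ℝ≥0∞, C ≠ ⊤ ∧ ∀ t, ∫⁻ x in S, (∫⁻ y in S', ‖F t x - F t y‖ₑ ^ p ∂μ t) ∂μ t ≤ C * R t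

theorem measurable_enorm_sub_rpow {f : X → ℂ} (hf : Measurable f) (p : ℝ) :
    Measurable fun z : X × X => ‖f z.1 - f z.2‖ₑ ^ p :=
  (((hf.comp measurable_fst).sub (hf.comp measurable_snd)).enorm).pow_const p

theorem lintegral_lintegral_enorm_sub_swap {f : X → ℂ} (hf : Measurable f) (ν ν' : Measure X)
    [SFinite ν] [SFinite ν'] (p : ℝ) :
    ∫⁻ x, (∫⁻ y, ‖f x - f y‖ₑ ^ p ∂ν') ∂ν = ∫⁻ y, (∫⁻ x, ‖f y - f x‖ₑ ^ p ∂ν) ∂ν' := by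
  rw [lintegral_lintegral_swap (measurable_enorm_sub_rpow hf p).aemeasurable]
  simp_rw [enorm_sub_rev]

theorem OscControlled.symm [∀ t, IsFiniteMeasure (μ t)] (hF : ∀ t, Measurable (F t))
    {S S' : Set X} (h : OscControlled μ F R p S S') : OscControlled μ F R p S' S := by
  obtain ⟨C, hC, h⟩ := h
  refine ⟨C, hC, fun t => ?_⟩
  rw [lintegral_lintegral_enorm_sub_swap (hF t)]
  exact h t

theorem OscControlled.mono {S S' A A' : Set X} (h : OscControlled μ F R p S S') (hA : A ⊆ S)
    (hA' : A' ⊆ S') : OscControlled μ F R p A A' := by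
  obtain ⟨C, hC, h⟩ := h
  refine ⟨C, hC, fun t => le_trans ?_ (h t)⟩
  exact (lintegral_mono fun x => lintegral_mono_set hA').trans (lintegral_mono_set hA)

/-- The oscillation between `U` and `W` is controlled by comparing with an intermediate set whose
measure is bounded from below. -/
theorem OscControlled.trans (hp : 1 ≤ p) {M : ℝ≥0∞} (hM : M ≠ ⊤) (hμM : ∀ t, μ t univ ≤ M)
    (hF : ∀ t, Measurable (F t)) {U O W : Set X} {m : ℝ≥0∞} (hm : m ≠ 0)
    (hmO : ∀ t, m ≤ μ t O) (h : OscControlled μ F R p U O) (h' : OscControlled μ F R p O W) :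
    OscControlled μ F R p U W := by
  obtain ⟨C, hC, h⟩ := h
  obtain ⟨C', hC', h'⟩ := h'
  have h2 : (2 : ℝ≥0∞) ^ (p - 1) ≠ ⊤ := ENNReal.rpow_ne_top_of_nonneg (by linarith) (by simp)
  refine ⟨m⁻¹ * (2 ^ (p - 1) * (M * (C + C'))), ENNReal.mul_ne_top (ENNReal.inv_ne_top.2 hm)
    (ENNReal.mul_ne_top h2 (ENNReal.mul_ne_top hM (ENNReal.add_ne_top.2 ⟨hC, hC'⟩))), fun t => ?_⟩
  have hfin : IsFiniteMeasure (μ t) := ⟨(hμM t).trans_lt hM.lt_top⟩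
  have hmtop : m ≠ ⊤ := ((hmO t).trans (measure_mono (subset_univ _))).trans_lt
    ((hμM t).trans_lt hM.lt_top) |>.ne
  have hg := measurable_enorm_sub_rpow (hF t) p
  obtain ⟨g, hgdef⟩ : ∃ g : X → X → ℝ≥0∞, ∀ x y, ‖F t x - F t y‖ₑ ^ p = g x y := ⟨_, fun _ _ => rfl⟩
  have key : ∀ x y z, g x z ≤ 2 ^ (p - 1) * (g x y + g y z) := by
    intro x y z
    rw [← hgdef, ← hgdef, ← hgdef]
    exact enorm_sub_rpow_le hp _ _ _
  have h := h t
  have h' := h' t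
  simp only [hgdef] at h h' hg ⊢
  have hg1 : ∀ x, Measurable (g x) := fun x => hg.comp (measurable_const.prodMk measurable_id)
  have hg2 : ∀ z, Measurable fun y => g y z := fun z =>
    hg.comp (measurable_id.prodMk measurable_const)
  have hstep : ∀ x z, m * g x z ≤
      2 ^ (p - 1) * (∫⁻ y in O, g x y ∂μ t) + 2 ^ (p - 1) * ∫⁻ y in O, g y z ∂μ t := by
    intro x z
    calc m * g x z ≤ μ t O * g x z := mul_le_mul_left (hmO t) _
      _ = ∫⁻ _ in O, g x z ∂μ t := by rw [setLIntegral_const, mul_comm]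
      _ ≤ ∫⁻ y in O, 2 ^ (p - 1) * (g x y + g y z) ∂μ t := lintegral_mono fun y => key x y z
      _ = _ := by
        rw [lintegral_const_mul' _ _ h2, lintegral_add_left (hg1 x), mul_add]
  have hI1 : Measurable fun x => ∫⁻ y in O, g x y ∂μ t := hg.lintegral_prod_right'
  have hI2 : Measurable fun z => ∫⁻ y in O, g y z ∂μ t := hg.lintegral_prod_left'
  have hI3 : Measurable fun x => ∫⁻ y in W, g x y ∂μ t := hg.lintegral_prod_right'
  have hswap : ∫⁻ z in W, (∫⁻ y in O, g y z ∂μ t) ∂μ t =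
      ∫⁻ y in O, (∫⁻ z in W, g y z ∂μ t) ∂μ t :=
    lintegral_lintegral_swap (hg.comp measurable_swap).aemeasurable
  have hmain : m * ∫⁻ x in U, (∫⁻ z in W, g x z ∂μ t) ∂μ t ≤
      2 ^ (p - 1) * (M * (C + C')) * R t := by
    calc m * ∫⁻ x in U, (∫⁻ z in W, g x z ∂μ t) ∂μ t
        = ∫⁻ x in U, (∫⁻ z in W, m * g x z ∂μ t) ∂μ t := by
          rw [← lintegral_const_mul _ hI3]
          simp_rw [lintegral_const_mul _ (hg1 _)]
      _ ≤ ∫⁻ x in U, (∫⁻ z in W, (2 ^ (p - 1) * (∫⁻ y in O, g x y ∂μ t) +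
            2 ^ (p - 1) * ∫⁻ y in O, g y z ∂μ t) ∂μ t) ∂μ t :=
          lintegral_mono fun x => lintegral_mono fun z => hstep x z
      _ = ∫⁻ x in U, (2 ^ (p - 1) * (∫⁻ y in O, g x y ∂μ t) * μ t W +
            2 ^ (p - 1) * ∫⁻ y in O, (∫⁻ z in W, g y z ∂μ t) ∂μ t) ∂μ t := by
          refine lintegral_congr fun x => ?_
          rw [lintegral_add_left measurable_const, setLIntegral_const,
            lintegral_const_mul _ hI2, hswap]
      _ = 2 ^ (p - 1) * (∫⁻ x in U, (∫⁻ y in O, g x y ∂μ t) ∂μ t) * μ t W +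
            2 ^ (p - 1) * (∫⁻ y in O, (∫⁻ z in W, g y z ∂μ t) ∂μ t) * μ t U := by
          rw [lintegral_add_right _ measurable_const, setLIntegral_const,
            lintegral_mul_const _ (hI1.const_mul _), lintegral_const_mul _ hI1]
      _ ≤ 2 ^ (p - 1) * (C * R t) * M + 2 ^ (p - 1) * (C' * R t) * M := by
          have hW : μ t W ≤ M := (measure_mono (subset_univ _)).trans (hμM t)
          have hU : μ t U ≤ M := (measure_mono (subset_univ _)).trans (hμM t)
          exact add_le_add (mul_le_mul' (mul_le_mul_right h _) hW)
            (mul_le_mul' (mul_le_mul_right h' _) hU)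
      _ = _ := by ring
  rw [mul_assoc]
  calc _ = m⁻¹ * (m * ∫⁻ x in U, (∫⁻ z in W, g x z ∂μ t) ∂μ t) := by
        rw [← mul_assoc, ENNReal.inv_mul_cancel hm hmtop, one_mul]
    _ ≤ _ := mul_le_mul_right hmain _

/-- On a compact connected space, local control of the oscillation implies global control, provided
that the measures are bounded, and bounded from below on open sets. -/
theorem oscControlled_univ [TopologicalSpace X] [CompactSpace X] [ConnectedSpace X] (hp : 1 ≤ p)
    {M : ℝ≥0∞} (hM : M ≠ ⊤) (hμM : ∀ t, μ t univ ≤ M) (hF : ∀ t, Measurable (F t))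
    (hlow : ∀ O : Set X, IsOpen O → O.Nonempty → ∃ m : ℝ≥0∞, m ≠ 0 ∧ ∀ t, m ≤ μ t O)
    (hloc : ∀ x : X, ∃ U ∈ 𝓝 x, OscControlled μ F R p U U) :
    OscControlled μ F R p univ univ := by
  have hfin : ∀ t, IsFiniteMeasure (μ t) := fun t => ⟨(hμM t).trans_lt hM.lt_top⟩
  let P : X → X → Prop := fun x y => ∃ U ∈ 𝓝 x, ∃ V ∈ 𝓝 y, OscControlled μ F R p U V
  have hPsymm : Std.Symm P := ⟨by
    rintro x y ⟨U, hU, V, hV, h⟩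
    exact ⟨V, hV, U, hU, h.symm hF⟩⟩
  have hPtrans : IsTrans X P := ⟨by
    rintro x y z ⟨U, hU, V, hV, h⟩ ⟨V', hV', W, hW, h'⟩
    obtain ⟨O, hO, hOo, hyO⟩ := mem_nhds_iff.1 (inter_mem hV hV')
    obtain ⟨m, hm, hmO⟩ := hlow O hOo ⟨y, hyO⟩
    exact ⟨U, hU, W, hW, (h.mono subset_rfl (hO.trans inter_subset_left)).trans hp hM hμM hF hm hmO
      (h'.mono (hO.trans inter_subset_right) subset_rfl)⟩⟩
  have hPall : ∀ x y, P x y := by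
    intro x y
    refine PreconnectedSpace.induction₂ P (fun x => ?_) hPtrans x y
    obtain ⟨U, hU, h⟩ := hloc x
    filter_upwards [eventually_mem_nhds_iff.2 hU] with y hy
    exact ⟨U, hU, U, hy, h⟩
  have hunion : ∀ A A' S : Set X, OscControlled μ F R p A S → OscControlled μ F R p A' S →
      OscControlled μ F R p (A ∪ A') S := by
    rintro A A' S ⟨C, hC, h⟩ ⟨C', hC', h'⟩
    refine ⟨C + C', ENNReal.add_ne_top.2 ⟨hC, hC'⟩, fun t => ?_⟩
    refine (lintegral_union_le _ _ _).trans ?_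
    rw [add_mul]
    exact add_le_add (h t) (h' t)
  have hright : ∀ x, ∃ U ∈ 𝓝 x, OscControlled μ F R p U univ := by
    intro x
    refine isCompact_univ.induction_on (p := fun S => ∃ U ∈ 𝓝 x, OscControlled μ F R p U S)
      ⟨univ, univ_mem, 0, by simp⟩ (fun S S' hS ⟨U, hU, h⟩ => ⟨U, hU, h.mono subset_rfl hS⟩) ?_ ?_
    · rintro S S' ⟨U, hU, h⟩ ⟨U', hU', h'⟩
      exact ⟨U ∩ U', inter_mem hU hU', (hunion _ _ _ ((h.mono inter_subset_left subset_rfl).symm hF)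
        ((h'.mono inter_subset_right subset_rfl).symm hF)).symm hF⟩
    · intro y _
      obtain ⟨U, hU, V, hV, h⟩ := hPall x y
      exact ⟨V, mem_nhdsWithin_of_mem_nhds hV, U, hU, h⟩
  refine isCompact_univ.induction_on (p := fun S => OscControlled μ F R p S univ) ⟨0, by simp⟩
    (fun S S' hS h => h.mono hS subset_rfl) (fun S S' h h' => hunion _ _ _ h h') fun y _ => ?_
  obtain ⟨U, hU, h⟩ := hright y
  exact ⟨U, mem_nhdsWithin_of_mem_nhds hU, h⟩

/-- By Jensen's inequality the oscillation integral bounds the deviation from the average. -/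
theorem average_le_of_oscControlled (hp : 1 ≤ p) {m : ℝ≥0∞} (hm : m ≠ 0) (hmμ : ∀ t, m ≤ μ t univ)
    [∀ t, IsFiniteMeasure (μ t)]
    (hF : ∀ t, Measurable (F t)) (hFi : ∀ t, Integrable (F t) (μ t))
    (h : OscControlled μ F R p univ univ) :
    ∃ C : ℝ≥0∞, C ≠ ⊤ ∧ ∀ t, ∫⁻ x, ‖F t x - ⨍ y, F t y ∂μ t‖ₑ ^ p ∂μ t ≤ C * R t := by
  obtain ⟨C, hC, h⟩ := h
  refine ⟨m⁻¹ * C, ENNReal.mul_ne_top (ENNReal.inv_ne_top.2 hm) hC, fun t => ?_⟩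
  have hne : NeZero (μ t) := ⟨fun h0 => hm (by simpa [h0] using hmμ t)⟩
  have hν : IsProbabilityMeasure ((μ t univ)⁻¹ • μ t) := inferInstance
  have h1 : ∀ x, ‖F t x - ⨍ y, F t y ∂μ t‖ₑ ^ p ≤
      (μ t univ)⁻¹ * ∫⁻ y, ‖F t x - F t y‖ₑ ^ p ∂μ t := by
    intro x
    have h2 : F t x - ⨍ y, F t y ∂μ t = ∫ y, (F t x - F t y) ∂((μ t univ)⁻¹ • μ t) := by
      rw [integral_sub (integrable_const _) ((hFi t).smul_measure
        (ENNReal.inv_ne_top.2 (NeZero.ne _))), integral_const]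
      simp [average]
    rw [h2]
    calc _ ≤ (∫⁻ y, ‖F t x - F t y‖ₑ ∂((μ t univ)⁻¹ • μ t)) ^ p :=
          ENNReal.rpow_le_rpow (enorm_integral_le_lintegral_enorm _) (by linarith)
      _ ≤ _ := rpow_lintegral_le _ ((measurable_const.sub (hF t)).enorm.aemeasurable) hp
      _ = _ := by rw [measure_univ, ENNReal.one_rpow, one_mul, lintegral_smul_measure]; rfl
  calc _ ≤ ∫⁻ x, (μ t univ)⁻¹ * (∫⁻ y, ‖F t x - F t y‖ₑ ^ p ∂μ t) ∂μ t := lintegral_mono h1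
    _ = (μ t univ)⁻¹ * ∫⁻ x, (∫⁻ y, ‖F t x - F t y‖ₑ ^ p ∂μ t) ∂μ t :=
      lintegral_const_mul _ (measurable_enorm_sub_rpow (hF t) p).lintegral_prod_right'
    _ ≤ m⁻¹ * (C * R t) := by
      refine mul_le_mul' (ENNReal.inv_le_inv.2 (hmμ t)) ?_
      simpa using h t
    _ = _ := by rw [mul_assoc]

end Chaining

/-! ### The weighted volume in an adapted chart -/

section LocalVolume

variable {n : ℕ} {X : Type*} [TopologicalSpace X]
  {φ : OpenPartialHomeomorph X (Fin n → ℂ)}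

/-- The inverse image of the ball of radius `R` around the origin in a chart. -/
def chartBall (φ : OpenPartialHomeomorph X (Fin n → ℂ)) (R : ℝ) : Set X :=
  φ.source ∩ φ ⁻¹' Metric.ball 0 R

theorem isOpen_chartBall (φ : OpenPartialHomeomorph X (Fin n → ℂ)) (R : ℝ) :
    IsOpen (chartBall φ R) :=
  φ.isOpen_inter_preimage Metric.isOpen_ball

theorem aemeasurable_chart [MeasurableSpace X] [BorelSpace X] (μ : Measure X) (R : ℝ) :
    AEMeasurable φ (μ.restrict (chartBall φ R)) :=
  (φ.continuousOn.mono inter_subset_left).aemeasurable (isOpen_chartBall φ R).measurableSet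

theorem chartBall_mem_nhds {x : X} (hx : x ∈ φ.source) (h0 : φ x = 0) {R : ℝ} (hR : 0 < R) :
    chartBall φ R ∈ 𝓝 x :=
  (isOpen_chartBall φ R).mem_nhds ⟨hx, by simpa [h0] using hR⟩

theorem eventually_chartBall_subset {x : X} (hx : x ∈ φ.source) (h0 : φ x = 0) {O : Set X}
    (hO : O ∈ 𝓝 x) : ∀ᶠ R in 𝓝[>] (0 : ℝ), chartBall φ R ⊆ O := by
  have h0t : (0 : Fin n → ℂ) ∈ φ.target := h0 ▸ φ.map_source hx
  have h1 : φ.symm ⁻¹' O ∈ 𝓝 (0 : Fin n → ℂ) :=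
    φ.continuousAt_symm h0t (by rwa [← h0, φ.left_inv hx])
  obtain ⟨δ, hδ, hball⟩ := Metric.mem_nhds_iff.1 h1
  filter_upwards [Ioo_mem_nhdsGT hδ] with R hR y hy
  have h2 : φ.symm (φ y) ∈ O := hball (Metric.ball_subset_ball hR.2.le hy.2)
  rwa [φ.left_inv hy.1] at h2

variable [ChartedSpace (Fin n → ℂ) X]

theorem HermitianMetric.continuous_normSq {D : Set X} (h : HermitianMetric n D)
    (hD : ∀ x, ∃ e : LocalEquation n D, x ∈ e.U) : Continuous h.normSq := by
  refine continuous_iff_continuousAt.2 fun x => ?_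
  obtain ⟨e, hx⟩ := hD x
  have hU := e.isOpen.mem_nhds hx
  have h1 : ContinuousAt (h.weight e) x := (h.smooth e).continuousOn.continuousAt hU
  have h2 : ContinuousAt e.s x := e.holomorphic.continuousOn.continuousAt hU
  refine (h1.mul (h2.norm.pow 2)).congr ?_
  filter_upwards [hU] with y hy
  exact (h.normSq_eq e hy).symm

theorem IsAdaptedChart.exists_localEquation {ι : Type*} {D : ι → Set X} {x : X}
    {κ : ι → Option (Fin n)} (h : IsAdaptedChart D x φ κ) (i : ι) :
    ∃ e : LocalEquation n (D i), x ∈ e.U := by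
  rcases hi : κ i with _ | j
  · exact ⟨unitEquation φ (h.absent i hi), h.mem_source⟩
  · exact ⟨coordEquation h.mem_maximalAtlas j (h.hyperplane i j hi), h.mem_source⟩

theorem IsSNC.exists_localEquation {ι : Type*} {D : ι → Set X} (h : IsSNC n D) (i : ι) (x : X) :
    ∃ e : LocalEquation n (D i), x ∈ e.U := by
  obtain ⟨φ, κ, hφ⟩ := h.exists_chart x
  exact hφ.exists_localEquation i

/-- The density of `weightedVolume`. -/
def divisorWeight {I J : Type*} [Fintype I] [Fintype J] {E : I → Set X} {B : J → Set X}
    (hE : ∀ α, HermitianMetric n (E α)) (hB : ∀ β, HermitianMetric n (B β))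
    (b : J → ℝ) (e : I → ℝ) (ε : ℝ) (x : X) : ℝ :=
  (∏ α, (ε ^ 2 + (hE α).normSq x) ^ e α) / ∏ β, (ε ^ 2 + (hB β).normSq x) ^ b β

theorem measurable_divisorWeight [MeasurableSpace X] [BorelSpace X] {I J : Type*} [Fintype I]
    [Fintype J] {E : I → Set X} {B : J → Set X} (hEB : IsSNC n (Sum.elim E B))
    (hE : ∀ α, HermitianMetric n (E α)) (hB : ∀ β, HermitianMetric n (B β))
    (b : J → ℝ) (e : I → ℝ) (ε : ℝ) : Measurable (divisorWeight hE hB b e ε) := by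
  have h1 : ∀ α, Measurable (hE α).normSq := fun α =>
    ((hE α).continuous_normSq (hEB.exists_localEquation (Sum.inl α))).measurable
  have h2 : ∀ β, Measurable (hB β).normSq := fun β =>
    ((hB β).continuous_normSq (hEB.exists_localEquation (Sum.inr β))).measurable
  unfold divisorWeight
  exact (Finset.measurable_fun_prod _ fun α _ => (measurable_const.add (h1 α)).pow_const _).div
    (Finset.measurable_fun_prod _ fun β _ => (measurable_const.add (h2 β)).pow_const _)

variable [IsManifold 𝓘(ℂ, Fin n → ℂ) ω X] [MeasurableSpace X] [BorelSpace X] [CompactSpace X]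

/-- Integration over the inverse image of a ball in a chart, as an integral over the ball. -/
theorem setLIntegral_chartBall (G : SmoothMetric n X)
    (hφ : φ ∈ IsManifold.maximalAtlas 𝓘(ℂ, Fin n → ℂ) ω X) {R : ℝ}
    (hR : Metric.ball 0 R ⊆ φ.target) {H : (Fin n → ℂ) → ℝ≥0∞} (hH : Measurable H) :
    ∫⁻ y in chartBall φ R, H (φ y) ∂riemannianVolume G.inner =
      ∫⁻ z in Metric.ball 0 R, ENNReal.ofReal (chartDensity G.inner φ z) * H z := by
  have hU := (isOpen_chartBall φ R).measurableSet
  have hdens : AEMeasurable (fun z => ENNReal.ofReal (chartDensity G.inner φ z))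
      (volume.restrict (Metric.ball 0 R)) :=
    (((continuousOn_chartDensity G hφ).mono hR).aemeasurable
      Metric.isOpen_ball.measurableSet).ennreal_ofReal
  have hcomp : AEMeasurable (fun y => H (φ y)) ((chartVolume G.inner φ).restrict (chartBall φ R)) :=
    hH.comp_aemeasurable (aemeasurable_chart _ R)
  have h1 : (riemannianVolume G.inner).restrict (chartBall φ R) =
      (chartVolume G.inner φ).restrict (chartBall φ R) := by
    rw [← riemannianVolume_restrict_source G.inner hφ, Measure.restrict_restrict hU,
      inter_eq_self_of_subset_left (show chartBall φ R ⊆ φ.source from inter_subset_left)]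
  rw [h1, ← lintegral_indicator hU]
  unfold chartVolume
  rw [lintegral_map' ((aemeasurable_indicator_iff hU).2 hcomp) (aemeasurable_chart_symm φ _)]
  have h2 : ∀ z ∈ φ.target, (chartBall φ R).indicator (fun y => H (φ y)) (φ.symm z) =
      (Metric.ball 0 R).indicator H z := by
    intro z hz
    have h3 : φ.symm z ∈ chartBall φ R ↔ z ∈ Metric.ball 0 R := by
      rw [chartBall, mem_inter_iff, mem_preimage, φ.right_inv hz]
      exact and_iff_right (φ.map_target hz)
    by_cases hb : z ∈ Metric.ball 0 R
    · rw [indicator_of_mem (h3.2 hb), indicator_of_mem hb, φ.right_inv hz]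
    · rw [indicator_of_notMem (mt h3.1 hb), indicator_of_notMem hb]
  rw [setLIntegral_congr_fun φ.open_target.measurableSet h2,
    lintegral_indicator Metric.isOpen_ball.measurableSet,
    Measure.restrict_restrict Metric.isOpen_ball.measurableSet,
    inter_eq_self_of_subset_left hR, restrict_withDensity Metric.isOpen_ball.measurableSet,
    lintegral_withDensity_eq_lintegral_mul₀ hdens hH.aemeasurable]
  rfl

theorem ae_chart_ne_zero (G : SmoothMetric n X)
    (hφ : φ ∈ IsManifold.maximalAtlas 𝓘(ℂ, Fin n → ℂ) ω X) {R : ℝ}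
    (hR : Metric.ball 0 R ⊆ φ.target) :
    ∀ᵐ y ∂(riemannianVolume G.inner).restrict (chartBall φ R), ∀ k, φ y k ≠ 0 := by
  refine ae_all_iff.2 fun k => ?_
  have hZ : MeasurableSet {z : Fin n → ℂ | z k = 0} :=
    measurableSet_eq_fun (measurable_pi_apply k) measurable_const
  have hH : Measurable ({z : Fin n → ℂ | z k = 0}.indicator (1 : (Fin n → ℂ) → ℝ≥0∞)) :=
    measurable_one.indicator hZ
  have h1 := setLIntegral_chartBall G hφ hR hH
  have h2 : ∀ᵐ z : Fin n → ℂ, z k ≠ 0 := by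
    rw [volume_pi]
    exact Measure.ae_eval_ne (fun _ : Fin n => (volume : Measure ℂ)) k 0
  have h3 : ∫⁻ z in Metric.ball 0 R, ENNReal.ofReal (chartDensity G.inner φ z) *
      {z : Fin n → ℂ | z k = 0}.indicator 1 z = 0 := by
    rw [← lintegral_zero (μ := volume.restrict (Metric.ball (0 : Fin n → ℂ) R))]
    refine lintegral_congr_ae ?_
    filter_upwards [ae_restrict_of_ae h2] with z hz
    simp [indicator, hz]
  rw [h3] at h1
  have h4 := (lintegral_eq_zero_iff' (hH.comp_aemeasurable (aemeasurable_chart _ R))).1 h1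
  filter_upwards [h4] with y hy h0
  simp [indicator, h0] at hy

/-- The exponent of `ε² + |z_k|²` in the weight of `weightedVolume` in an adapted chart. -/
def chartExponent {I J : Type*} [Fintype I] [Fintype J] (κ : I ⊕ J → Option (Fin n)) (e : I → ℝ)
    (b : J → ℝ) (k : Fin n) : ℝ :=
  coordExponent (fun α => κ (Sum.inl α)) e k +
    coordExponent (fun β => κ (Sum.inr β)) (fun β => -b β) k

/-- On small balls in an adapted chart the weighted volume is comparable, uniformly in `ε`, to the
measure `polydiscMeasure` whose exponents are read off from the chart. -/
theorem exists_weightedVolume_comparable (G : SmoothMetric n X) {I J : Type*} [Fintype I]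
    [Fintype J] {E : I → Set X} {B : J → Set X} (hEB : IsSNC n (Sum.elim E B))
    (hE : ∀ α, HermitianMetric n (E α)) (hB : ∀ β, HermitianMetric n (B β)) {x : X}
    {κ : I ⊕ J → Option (Fin n)} (h : IsAdaptedChart (Sum.elim E B) x φ κ)
    (b : J → ℝ) (e : I → ℝ) (ε₀ : ℝ) :
    ∃ K : ℝ≥0∞, K ≠ ⊤ ∧ ∀ᶠ R in 𝓝[>] (0 : ℝ), ∀ ε ∈ Icc 0 ε₀, ∀ H : (Fin n → ℂ) → ℝ≥0∞,
      Measurable H →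
      (∫⁻ y in chartBall φ R, H (φ y) ∂weightedVolume G.inner hE hB b e ε ≤
        K * ∫⁻ z, H z ∂polydiscMeasure ε (chartExponent κ e b) R) ∧
      ∫⁻ z, H z ∂polydiscMeasure ε (chartExponent κ e b) R ≤
        K * ∫⁻ y in chartBall φ R, H (φ y) ∂weightedVolume G.inner hE hB b e ε := by
  obtain ⟨K, hK, hcomp⟩ := exists_comparable_density hE hB h e b ε₀
  obtain ⟨a, ha⟩ : ∃ a : Fin n → ℝ, a = chartExponent κ e b := ⟨_, rfl⟩
  have hφ := h.mem_maximalAtlas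
  have h0t : (0 : Fin n → ℂ) ∈ φ.target := h.centred ▸ φ.map_source h.mem_source
  have hsymm0 : φ.symm 0 = x := by rw [← h.centred, φ.left_inv h.mem_source]
  obtain ⟨d, hd⟩ : ∃ d, d = chartDensity G.inner φ 0 := ⟨_, rfl⟩
  have hd0 : 0 < d := hd ▸ chartDensity_pos G hφ h0t
  have hdc : ContinuousAt (chartDensity G.inner φ) 0 :=
    (continuousOn_chartDensity G hφ).continuousAt (φ.open_target.mem_nhds h0t)
  have hsc : Tendsto φ.symm (𝓝 0) (𝓝 x) := by
    have := φ.continuousAt_symm h0t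
    rwa [ContinuousAt, hsymm0] at this
  have hev : ∀ᶠ z in 𝓝 (0 : Fin n → ℂ), z ∈ φ.target ∧ d / 2 < chartDensity G.inner φ z ∧
      chartDensity G.inner φ z < 2 * d ∧ ∀ ε ∈ Icc 0 ε₀, (∀ k, φ (φ.symm z) k ≠ 0) →
        Comparable K (divisorWeight hE hB b e ε (φ.symm z))
          (∏ k, (ε ^ 2 + ‖φ (φ.symm z) k‖ ^ 2) ^ a k) := by
    rw [ha]
    filter_upwards [φ.open_target.mem_nhds h0t,
      hdc.eventually (lt_mem_nhds (show d / 2 < chartDensity G.inner φ 0 by linarith)),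
      hdc.eventually (gt_mem_nhds (show chartDensity G.inner φ 0 < 2 * d by linarith)),
      hsc.eventually hcomp] with z h1 h2 h3 h4
    exact ⟨h1, h2, h3, h4⟩
  obtain ⟨δ, hδ, hball⟩ := Metric.eventually_nhds_iff_ball.1 hev
  refine ⟨ENNReal.ofReal (2 * d * K) + ENNReal.ofReal (K * (d / 2)⁻¹), by simp, ?_⟩
  filter_upwards [Ioo_mem_nhdsGT hδ] with R hR ε hε H hH
  rw [← ha]
  have hsub : Metric.ball (0 : Fin n → ℂ) R ⊆ φ.target := fun z hz =>
    (hball z (Metric.ball_subset_ball hR.2.le hz)).1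
  have hU := (isOpen_chartBall φ R).measurableSet
  have hw : Measurable fun y => ENNReal.ofReal (divisorWeight hE hB b e ε y) :=
    (measurable_divisorWeight hEB hE hB b e ε).ennreal_ofReal
  have hWm : Measurable fun z : Fin n → ℂ =>
      ENNReal.ofReal (∏ k, (ε ^ 2 + ‖z k‖ ^ 2) ^ a k) := by fun_prop
  have hwv : ∫⁻ y in chartBall φ R, H (φ y) ∂weightedVolume G.inner hE hB b e ε =
      ∫⁻ y in chartBall φ R, ENNReal.ofReal (divisorWeight hE hB b e ε y) * H (φ y)
        ∂riemannianVolume G.inner :=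
    setLIntegral_withDensity_eq_setLIntegral_mul_non_measurable _ hw _ hU (by simp)
  have hpd : ∫⁻ z, H z ∂polydiscMeasure ε a R =
      ∫⁻ z in Metric.ball 0 R, ENNReal.ofReal (∏ k, (ε ^ 2 + ‖z k‖ ^ 2) ^ a k) * H z :=
    lintegral_withDensity_eq_lintegral_mul _ hWm hH
  have hcmp : ∀ y ∈ chartBall φ R, (∀ k, φ y k ≠ 0) →
      Comparable K (divisorWeight hE hB b e ε y) (∏ k, (ε ^ 2 + ‖φ y k‖ ^ 2) ^ a k) := by
    intro y hy hne
    have h1 := (hball (φ y) (Metric.ball_subset_ball hR.2.le hy.2)).2.2.2 ε hε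
    rw [φ.left_inv hy.1] at h1
    exact h1 hne
  have hae := ae_chart_ne_zero G hφ hsub
  rw [hwv, hpd]
  constructor
  · calc ∫⁻ y in chartBall φ R, ENNReal.ofReal (divisorWeight hE hB b e ε y) * H (φ y)
          ∂riemannianVolume G.inner
        ≤ ∫⁻ y in chartBall φ R, ENNReal.ofReal K *
            (ENNReal.ofReal (∏ k, (ε ^ 2 + ‖φ y k‖ ^ 2) ^ a k) * H (φ y))
            ∂riemannianVolume G.inner := by
          refine lintegral_mono_ae ?_
          filter_upwards [hae, ae_restrict_mem hU] with y hne hy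
          rw [← mul_assoc, ← ENNReal.ofReal_mul hK.le]
          exact mul_le_mul_left (ENNReal.ofReal_le_ofReal (hcmp y hy hne).1) _
      _ = ∫⁻ z in Metric.ball 0 R, ENNReal.ofReal (chartDensity G.inner φ z) *
            (ENNReal.ofReal K * (ENNReal.ofReal (∏ k, (ε ^ 2 + ‖z k‖ ^ 2) ^ a k) * H z)) :=
          setLIntegral_chartBall G hφ hsub ((hWm.mul hH).const_mul _)
      _ ≤ ∫⁻ z in Metric.ball 0 R, ENNReal.ofReal (2 * d * K) *
            (ENNReal.ofReal (∏ k, (ε ^ 2 + ‖z k‖ ^ 2) ^ a k) * H z) := by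
          refine setLIntegral_mono' Metric.isOpen_ball.measurableSet fun z hz => ?_
          rw [← mul_assoc, ENNReal.ofReal_mul (by positivity)]
          refine mul_le_mul_left (mul_le_mul_left (ENNReal.ofReal_le_ofReal ?_) _) _
          exact (hball z (Metric.ball_subset_ball hR.2.le hz)).2.2.1.le
      _ ≤ _ := by
          rw [lintegral_const_mul' _ _ (by simp)]
          exact mul_le_mul_left le_self_add _
  · have hd2 : 0 < d / 2 := by positivity
    calc ∫⁻ z in Metric.ball 0 R, ENNReal.ofReal (∏ k, (ε ^ 2 + ‖z k‖ ^ 2) ^ a k) * H z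
        ≤ ∫⁻ z in Metric.ball 0 R, ENNReal.ofReal (chartDensity G.inner φ z) *
            (ENNReal.ofReal (d / 2)⁻¹ *
              (ENNReal.ofReal (∏ k, (ε ^ 2 + ‖z k‖ ^ 2) ^ a k) * H z)) := by
          refine setLIntegral_mono' Metric.isOpen_ball.measurableSet fun z hz => ?_
          rw [← mul_assoc, ← ENNReal.ofReal_mul' (by positivity)]
          refine le_mul_of_one_le_left zero_le ?_
          rw [ENNReal.one_le_ofReal, ← div_eq_mul_inv, one_le_div hd2]
          exact (hball z (Metric.ball_subset_ball hR.2.le hz)).2.1.le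
      _ = ∫⁻ y in chartBall φ R, ENNReal.ofReal (d / 2)⁻¹ *
            (ENNReal.ofReal (∏ k, (ε ^ 2 + ‖φ y k‖ ^ 2) ^ a k) * H (φ y))
            ∂riemannianVolume G.inner :=
          (setLIntegral_chartBall G hφ hsub ((hWm.mul hH).const_mul _)).symm
      _ ≤ ∫⁻ y in chartBall φ R, ENNReal.ofReal (K * (d / 2)⁻¹) *
            (ENNReal.ofReal (divisorWeight hE hB b e ε y) * H (φ y))
            ∂riemannianVolume G.inner := by
          refine lintegral_mono_ae ?_
          filter_upwards [hae, ae_restrict_mem hU] with y hne hy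
          rw [← mul_assoc, ← mul_assoc, ← ENNReal.ofReal_mul (by positivity),
            ← ENNReal.ofReal_mul (by positivity)]
          refine mul_le_mul_left (ENNReal.ofReal_le_ofReal ?_) _
          calc (d / 2)⁻¹ * ∏ k, (ε ^ 2 + ‖φ y k‖ ^ 2) ^ a k
              ≤ (d / 2)⁻¹ * (K * divisorWeight hE hB b e ε y) :=
                mul_le_mul_of_nonneg_left (hcmp y hy hne).2 (by positivity)
            _ = _ := by ring
      _ ≤ _ := by
          rw [lintegral_const_mul' _ _ (by simp)]
          exact mul_le_mul_left le_add_self _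

end LocalVolume

/-! ### Bounds for the masses -/

section Mass

variable {n : ℕ}

theorem lintegral_polydiscMeasure (ε : ℝ) (a : Fin n → ℝ) (R : ℝ) {H : (Fin n → ℂ) → ℝ≥0∞}
    (hH : Measurable H) : ∫⁻ z, H z ∂polydiscMeasure ε a R =
      ∫⁻ z in Metric.ball 0 R, ENNReal.ofReal (∏ k, (ε ^ 2 + ‖z k‖ ^ 2) ^ a k) * H z :=
  lintegral_withDensity_eq_lintegral_mul _ (by fun_prop) hH

theorem exists_le_polydiscMeasure_univ (ε₀ : ℝ) (a : Fin n → ℝ) {R : ℝ} (hR : 0 < R) :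
    ∃ m : ℝ≥0∞, m ≠ 0 ∧ ∀ ε ∈ Icc 0 ε₀, m ≤ polydiscMeasure ε a R univ := by
  -- The weight is bounded from below on the product of the annuli `R / 2 < |z_k| < R`.
  obtain ⟨Q, hQ⟩ : ∃ Q : Set (Fin n → ℂ), Q = {z | ∀ k, R / 2 < ‖z k‖ ∧ ‖z k‖ < R} := ⟨_, rfl⟩
  have hQo : IsOpen Q := by
    have hQ' : Q = ⋂ k, {z | R / 2 < ‖z k‖} ∩ {z | ‖z k‖ < R} := by
      ext z
      simp [hQ]
    have hc : ∀ k, Continuous fun z : Fin n → ℂ => ‖z k‖ := fun k => (continuous_apply k).norm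
    rw [hQ']
    exact isOpen_iInter_of_finite fun k =>
      (isOpen_lt continuous_const (hc k)).inter (isOpen_lt (hc k) continuous_const)
  have hQne : Q.Nonempty := by
    refine ⟨fun _ => ((3 * R / 4 : ℝ) : ℂ), ?_⟩
    rw [hQ]
    intro k
    simp only [Complex.norm_real, Real.norm_eq_abs]
    rw [abs_of_pos (by positivity)]
    constructor <;> linarith
  have hQb : Q ⊆ Metric.ball 0 R := by
    intro z hz
    rw [hQ] at hz
    rw [mem_ball_zero_iff, pi_norm_lt_iff hR]
    exact fun k => (hz k).2
  obtain ⟨c, hc⟩ : ∃ c : Fin n → ℝ, ∀ k, c k =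
      ((R ^ 2 / 4) ^ (-a k) + (ε₀ ^ 2 + R ^ 2) ^ (-a k))⁻¹ := ⟨_, fun _ => rfl⟩
  have hc0 : ∀ k, 0 < c k := fun k => by
    rw [hc]
    positivity
  refine ⟨ENNReal.ofReal (∏ k, c k) * volume Q, mul_ne_zero ?_ (hQo.measure_pos _ hQne).ne', ?_⟩
  · rw [Ne, ENNReal.ofReal_eq_zero, not_le]
    exact Finset.prod_pos fun k _ => hc0 k
  intro ε hε
  have h1 : polydiscMeasure ε a R univ =
      ∫⁻ z in Metric.ball (0 : Fin n → ℂ) R, ENNReal.ofReal (∏ k, (ε ^ 2 + ‖z k‖ ^ 2) ^ a k) := by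
    rw [← lintegral_one, lintegral_polydiscMeasure _ _ _ measurable_const]
    simp
  rw [h1, ← setLIntegral_const]
  refine (setLIntegral_mono' hQo.measurableSet fun z hz => ?_).trans (lintegral_mono_set hQb)
  refine ENNReal.ofReal_le_ofReal (Finset.prod_le_prod (fun k _ => (hc0 k).le) fun k _ => ?_)
  rw [hQ] at hz
  have hz := hz k
  have h0 := hε.1
  have h2 : R ^ 2 / 4 ≤ ε ^ 2 + ‖z k‖ ^ 2 := by
    have : (R / 2) ^ 2 ≤ ‖z k‖ ^ 2 := by gcongr; exact hz.1.le
    nlinarith [sq_nonneg ε]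
  have h3 : ε ^ 2 + ‖z k‖ ^ 2 ≤ ε₀ ^ 2 + R ^ 2 := by
    have e1 : ε ^ 2 ≤ ε₀ ^ 2 := by have := hε.2; gcongr
    have e2 : ‖z k‖ ^ 2 ≤ R ^ 2 := by have := hz.2.le; gcongr
    linarith
  have h4 : 0 < ε ^ 2 + ‖z k‖ ^ 2 := lt_of_lt_of_le (by positivity) h2
  have h5 := rpow_le_add_rpow (by positivity) h2 h3 (-a k)
  rw [Real.rpow_neg h4.le, inv_le_comm₀ (by positivity) (by positivity)] at h5
  rwa [hc]

variable {X : Type*} [TopologicalSpace X] [ChartedSpace (Fin n → ℂ) X] {I J : Type*} [Fintype J]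
  {E : I → Set X} {B : J → Set X}

theorem IsAdaptedChart.neg_one_lt_coordExponent {x : X} {φ : OpenPartialHomeomorph X (Fin n → ℂ)}
    {κ : I ⊕ J → Option (Fin n)} (h : IsAdaptedChart (Sum.elim E B) x φ κ) {b : J → ℝ}
    (hb : ∀ β, b β < 1) (k : Fin n) :
    -1 < coordExponent (fun β => κ (Sum.inr β)) (fun β => -b β) k :=
  WeakPoincare.neg_one_lt_coordExponent
    (fun β β' j h1 h2 => Sum.inr_injective (h.injective _ _ j h1 h2))
    (fun β => by linarith [hb β]) k

variable [Fintype I]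

theorem IsAdaptedChart.neg_one_lt_chartExponent {x : X} {φ : OpenPartialHomeomorph X (Fin n → ℂ)}
    {κ : I ⊕ J → Option (Fin n)} (h : IsAdaptedChart (Sum.elim E B) x φ κ) {b : J → ℝ}
    (hb : ∀ β, b β < 1) {e : I → ℝ} (he : ∀ α, 0 ≤ e α) (k : Fin n) :
    -1 < chartExponent κ e b k :=
  lt_add_of_nonneg_of_lt (coordExponent_nonneg he k) (h.neg_one_lt_coordExponent hb k)

variable [IsManifold 𝓘(ℂ, Fin n → ℂ) ω X] [MeasurableSpace X] [BorelSpace X] [CompactSpace X]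

/-- The total masses are bounded uniformly in `ε`, as all exponents in a chart exceed `-1`. -/
theorem exists_weightedVolume_univ_le (G : SmoothMetric n X) (hEB : IsSNC n (Sum.elim E B))
    (hE : ∀ α, HermitianMetric n (E α)) (hB : ∀ β, HermitianMetric n (B β)) {b : J → ℝ}
    (hb : ∀ β, b β < 1) {e : I → ℝ} (he : ∀ α, 0 ≤ e α) (ε₀ : ℝ) :
    ∃ M : ℝ≥0∞, M ≠ ⊤ ∧ ∀ ε ∈ Icc 0 ε₀, weightedVolume G.inner hE hB b e ε univ ≤ M := by
  refine isCompact_univ.induction_on (p := fun S => ∃ M : ℝ≥0∞, M ≠ ⊤ ∧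
    ∀ ε ∈ Icc 0 ε₀, weightedVolume G.inner hE hB b e ε S ≤ M) ⟨0, by simp⟩ ?_ ?_ ?_
  · rintro S S' hS ⟨M, hM, h⟩
    exact ⟨M, hM, fun ε hε => (measure_mono hS).trans (h ε hε)⟩
  · rintro S S' ⟨M, hM, h⟩ ⟨M', hM', h'⟩
    exact ⟨M + M', ENNReal.add_ne_top.2 ⟨hM, hM'⟩, fun ε hε =>
      (measure_union_le _ _).trans (add_le_add (h ε hε) (h' ε hε))⟩
  · intro x _
    obtain ⟨φ, κ, hφ⟩ := hEB.exists_chart x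
    obtain ⟨K, hK, hev⟩ := exists_weightedVolume_comparable G hEB hE hB hφ b e ε₀
    obtain ⟨R, hR, hR0⟩ := (hev.and self_mem_nhdsWithin).exists
    replace hR0 : 0 < R := hR0
    obtain ⟨M, hM, hMε⟩ := exists_polydiscMeasure_univ_le (ε₀ := ε₀)
      (hφ.neg_one_lt_chartExponent hb he) hR0
    refine ⟨chartBall φ R, mem_nhdsWithin_of_mem_nhds
      (chartBall_mem_nhds hφ.mem_source hφ.centred hR0), K * M, ENNReal.mul_ne_top hK hM,
      fun ε hε => ?_⟩
    have h1 := (hR ε hε 1 measurable_one).1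
    simp only [Pi.one_apply, lintegral_one, Measure.restrict_apply_univ] at h1
    exact h1.trans (mul_le_mul_right (hMε ε hε) _)

theorem exists_le_weightedVolume (G : SmoothMetric n X) (hEB : IsSNC n (Sum.elim E B))
    (hE : ∀ α, HermitianMetric n (E α)) (hB : ∀ β, HermitianMetric n (B β)) (b : J → ℝ)
    (e : I → ℝ) (ε₀ : ℝ) {O : Set X} (hO : IsOpen O) (hne : O.Nonempty) :
    ∃ m : ℝ≥0∞, m ≠ 0 ∧ ∀ ε ∈ Icc 0 ε₀, m ≤ weightedVolume G.inner hE hB b e ε O := by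
  obtain ⟨x, hx⟩ := hne
  obtain ⟨φ, κ, hφ⟩ := hEB.exists_chart x
  obtain ⟨K, hK, hev⟩ := exists_weightedVolume_comparable G hEB hE hB hφ b e ε₀
  obtain ⟨R, ⟨hR, hRO⟩, hR0⟩ := ((hev.and (eventually_chartBall_subset hφ.mem_source hφ.centred
    (hO.mem_nhds hx))).and self_mem_nhdsWithin).exists
  replace hR0 : 0 < R := hR0
  obtain ⟨m, hm, hmε⟩ := exists_le_polydiscMeasure_univ ε₀ (chartExponent κ e b) hR0
  refine ⟨m / K, (ENNReal.div_pos hm hK).ne', fun ε hε => ?_⟩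
  have h1 := (hR ε hε 1 measurable_one).2
  simp only [Pi.one_apply, lintegral_one, Measure.restrict_apply_univ] at h1
  exact (ENNReal.div_le_of_le_mul' ((hmε ε hε).trans h1)).trans (measure_mono hRO)

end Mass

/-! ### The local estimate -/

section Local

variable {n : ℕ}

/-- In a product of nonnegative powers of bounded quantities one factor can be cancelled. -/
theorem rpow_neg_mul_prod_rpow_le {ι : Type*} [Fintype ι] [DecidableEq ι] {T c : ι → ℝ} {Λ : ℝ}
    (hT : ∀ k, 0 < T k) (hTΛ : ∀ k, T k ≤ Λ) (hΛ : 1 ≤ Λ) (hc : ∀ k, 0 ≤ c k) (j : ι) :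
    T j ^ (-c j) * ∏ k, T k ^ c k ≤ ∏ k, Λ ^ c k := by
  rw [← Finset.mul_prod_erase _ _ (Finset.mem_univ j),
    ← Finset.mul_prod_erase _ (fun k => Λ ^ c k) (Finset.mem_univ j), ← mul_assoc,
    ← Real.rpow_add (hT j), neg_add_cancel, Real.rpow_zero]
  refine mul_le_mul (Real.one_le_rpow hΛ (hc j)) ?_
    (Finset.prod_nonneg fun k _ => Real.rpow_nonneg (hT k).le _) (by positivity)
  exact Finset.prod_le_prod (fun k _ => Real.rpow_nonneg (hT k).le _) fun k _ =>
    Real.rpow_le_rpow (hT k).le (hTΛ k) (hc k)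

theorem coordExponent_scaledIndex {I : Type*} [Fintype I] (κ : I → Option (Fin n)) (q : I → ℝ)
    (p : ℝ) (k : Fin n) :
    coordExponent κ (scaledIndex q p) k = (1 - p / 2) * coordExponent κ q k := by
  unfold coordExponent scaledIndex
  rw [Finset.mul_sum]
  exact Finset.sum_congr rfl fun i _ => by split_ifs <;> simp

/-- The weight of the model inequality for the index `q` is bounded by the one that belongs to the
index `q_p`, with the remaining factor `(ε² + |z_j|²)^{-(p/2) d_j}` coming from the metric. -/
theorem rpow_mul_prod_chartExponent_le {I J : Type*} [Fintype I] [Fintype J]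
    (κ : I ⊕ J → Option (Fin n)) {q : I → ℝ} (hq : ∀ α, 0 ≤ q α) (b : J → ℝ) {p : ℝ} (hp : 0 ≤ p)
    {T : Fin n → ℝ} {Λ : ℝ} (hT : ∀ k, 0 < T k) (hTΛ : ∀ k, T k ≤ Λ) (hΛ : 1 ≤ Λ) (j : Fin n) :
    (∏ k, T k ^ chartExponent κ q b k) * T j ^ (-(p / 2) * chartExponent κ q b j) ≤
      (∏ k, Λ ^ (p / 2 * coordExponent (fun α => κ (Sum.inl α)) q k)) *
        ((∏ k, T k ^ chartExponent κ (scaledIndex q p) b k) *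
          T j ^ (-(p / 2) * coordExponent (fun β => κ (Sum.inr β)) (fun β => -b β) j)) := by
  obtain ⟨s, hs⟩ : ∃ s : Fin n → ℝ, s = coordExponent (fun α => κ (Sum.inl α)) q := ⟨_, rfl⟩
  obtain ⟨d, hd⟩ : ∃ d : Fin n → ℝ,
    d = coordExponent (fun β => κ (Sum.inr β)) (fun β => -b β) := ⟨_, rfl⟩
  have hs0 : ∀ k, 0 ≤ s k := fun k => hs ▸ coordExponent_nonneg hq k
  have h1 : ∀ k, chartExponent κ q b k = s k + d k := fun k => by rw [hs, hd]; rfl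
  have h2 : ∀ k, chartExponent κ (scaledIndex q p) b k = (1 - p / 2) * s k + d k := fun k => by
    rw [chartExponent, coordExponent_scaledIndex, hs, hd]
  have h3 : ∏ k, T k ^ chartExponent κ q b k =
      (∏ k, T k ^ (p / 2 * s k)) * ∏ k, T k ^ chartExponent κ (scaledIndex q p) b k := by
    rw [← Finset.prod_mul_distrib]
    refine Finset.prod_congr rfl fun k _ => ?_
    rw [← Real.rpow_add (hT k), h1, h2]
    congr 1
    ring
  have h4 : T j ^ (-(p / 2) * chartExponent κ q b j) =
      T j ^ (-(p / 2 * s j)) * T j ^ (-(p / 2) * d j) := by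
    rw [← Real.rpow_add (hT j), h1]
    congr 1
    ring
  have h5 := rpow_neg_mul_prod_rpow_le hT hTΛ hΛ (c := fun k => p / 2 * s k)
    (fun k => mul_nonneg (by positivity) (hs0 k)) j
  rw [h3, h4, ← hs, ← hd]
  have h6 : 0 ≤ (∏ k, T k ^ chartExponent κ (scaledIndex q p) b k) * T j ^ (-(p / 2) * d j) :=
    mul_nonneg (Finset.prod_nonneg fun k _ => Real.rpow_nonneg (hT k).le _)
      (Real.rpow_nonneg (hT j).le _)
  calc _ = (T j ^ (-(p / 2 * s j)) * ∏ k, T k ^ (p / 2 * s k)) *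
        ((∏ k, T k ^ chartExponent κ (scaledIndex q p) b k) * T j ^ (-(p / 2) * d j)) := by ring
    _ ≤ _ := mul_le_mul_of_nonneg_right h5 h6

variable {X : Type*} [TopologicalSpace X] [ChartedSpace (Fin n → ℂ) X]

theorem mem_regularSet_of_chart_ne_zero {I J : Type*} {E : I → Set X} {B : J → Set X} {x : X}
    {φ : OpenPartialHomeomorph X (Fin n → ℂ)} {κ : I ⊕ J → Option (Fin n)}
    (h : IsAdaptedChart (Sum.elim E B) x φ κ) {y : X} (hy : y ∈ φ.source) (hne : ∀ k, φ y k ≠ 0)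
    (ε : ℝ) : y ∈ regularSet B ε := by
  refine Or.inr fun β hβ => ?_
  rcases hκ : κ (Sum.inr β) with _ | j
  · exact h.absent _ hκ y hy hβ
  · exact hne j ((h.hyperplane _ j hκ y hy).1 hβ)

/-- In a chart a smooth function agrees on a small ball with a globally defined one. -/
theorem exists_contDiff_eqOn_ball {φ : OpenPartialHomeomorph X (Fin n → ℂ)}
    (hφ : φ ∈ IsManifold.maximalAtlas 𝓘(ℂ, Fin n → ℂ) ω X) {R : ℝ} (hR : 0 < R)
    (hsub : Metric.closedBall 0 (2 * R) ⊆ φ.target) {f : X → ℂ}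
    (hf : ContMDiff 𝓘(ℝ, Fin n → ℂ) 𝓘(ℝ, ℂ) ∞ f) :
    ∃ F : (Fin n → ℂ) → ℂ, ContDiff ℝ 1 F ∧ EqOn F (f ∘ φ.symm) (Metric.ball 0 R) := by
  have h1 : ContDiffOn ℝ ∞ (f ∘ φ.symm) φ.target :=
    contMDiffOn_iff_contDiffOn.1 (hf.comp_contMDiffOn
      (contMDiffOn_symm_of_mem_maximalAtlas (mem_maximalAtlas_real hφ)))
  let χ : ContDiffBump (0 : Fin n → ℂ) := ⟨R, 2 * R, hR, by linarith⟩
  refine ⟨fun z => χ z • (f ∘ φ.symm) z, contDiff_iff_contDiffAt.2 fun z => ?_, fun z hz => ?_⟩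
  · by_cases hz : z ∈ φ.target
    · exact χ.contDiffAt.smul ((h1.contDiffAt (φ.open_target.mem_nhds hz)).of_le (by simp))
    · have h2 : z ∈ (Metric.closedBall (0 : Fin n → ℂ) (2 * R))ᶜ := fun h => hz (hsub h)
      refine (contDiffAt_const (c := (0 : ℂ))).congr_of_eventuallyEq ?_
      filter_upwards [Metric.isClosed_closedBall.isOpen_compl.mem_nhds h2] with w hw
      have h3 : χ w = 0 := χ.zero_of_le_dist (by
        simpa [Metric.mem_closedBall] using (le_of_lt (by simpa using hw)))
      simp [h3]
  · have h3 : χ z = 1 := χ.one_of_mem_closedBall (Metric.ball_subset_closedBall hz)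
    simp [h3]

/-- The pointwise form of the bound for a partial derivative by the gradient, with the weight of
the model inequality. -/
theorem enorm_partialFDeriv_rpow_mul_le {I J : Type*} [Fintype J] {b : J → ℝ}
    {κ : I ⊕ J → Option (Fin n)} {ε A p : ℝ} (hA : 0 < A) (hp : 0 ≤ p) {g : BilinField n X}
    {φ : OpenPartialHomeomorph X (Fin n → ℂ)}
    (hφ : φ ∈ IsManifold.maximalAtlas 𝓘(ℂ, Fin n → ℂ) ω X) {y : X} (hy : y ∈ φ.source)
    (hsymm : ∀ v w : RealTangent n y, g y v w = g y w v)
    (hpos : ∀ v : RealTangent n y, v ≠ 0 → 0 < g y v v)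
    (hgA : ∀ v : RealTangent n y, g y v v ≤ A * modelMetric b κ ε (φ y)
      (mfderiv 𝓘(ℝ, Fin n → ℂ) 𝓘(ℝ, Fin n → ℂ) φ y v))
    {f : X → ℂ} (hf : MDifferentiableAt 𝓘(ℝ, Fin n → ℂ) 𝓘(ℝ, ℂ) f y) {F : (Fin n → ℂ) → ℂ}
    (hF : F =ᶠ[𝓝 (φ y)] f ∘ φ.symm) (j : Fin n) (hj : φ y j ≠ 0) :
    ‖partialFDeriv F j (φ y)‖ₑ ^ p * ENNReal.ofReal ((ε ^ 2 + ‖φ y j‖ ^ 2) ^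
        (-(p / 2) * coordExponent (fun β => κ (Sum.inr β)) (fun β => -b β) j)) ≤
      ENNReal.ofReal (A ^ (p / 2)) * ENNReal.ofReal (gradNorm g f y ^ p) := by
  have h1 := norm_partialFDeriv_le hA hφ hy hsymm hpos hgA hf hF j hj
  rw [modelCoeff_eq b κ ε hj] at h1
  obtain ⟨d, hd⟩ : ∃ d, d = coordExponent (fun β => κ (Sum.inr β)) (fun β => -b β) j := ⟨_, rfl⟩
  obtain ⟨T, hT⟩ : ∃ T, T = ε ^ 2 + ‖φ y j‖ ^ 2 := ⟨_, rfl⟩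
  rw [← hd, ← hT] at h1 ⊢
  have hT0 : 0 < T := by
    have := norm_pos_iff.2 hj
    rw [hT]
    positivity
  have hg0 : 0 ≤ gradNorm g f y := Real.sqrt_nonneg _
  have hTd := Real.rpow_pos_of_pos hT0 d
  have h2 : ‖partialFDeriv F j (φ y)‖ ^ p * T ^ (-(p / 2) * d) ≤
      A ^ (p / 2) * gradNorm g f y ^ p := by
    calc ‖partialFDeriv F j (φ y)‖ ^ p * T ^ (-(p / 2) * d)
        ≤ (√(A * T ^ d) * gradNorm g f y) ^ p * T ^ (-(p / 2) * d) :=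
          mul_le_mul_of_nonneg_right (Real.rpow_le_rpow (norm_nonneg _) h1 hp) (by positivity)
      _ = A ^ (p / 2) * gradNorm g f y ^ p * (T ^ (d * (p / 2)) * T ^ (-(p / 2) * d)) := by
          rw [Real.mul_rpow (Real.sqrt_nonneg _) hg0, Real.sqrt_eq_rpow,
            ← Real.rpow_mul (by positivity), show 1 / 2 * p = p / 2 by ring,
            Real.mul_rpow hA.le hTd.le, ← Real.rpow_mul hT0.le]
          ring
      _ = _ := by
          rw [← Real.rpow_add hT0, show d * (p / 2) + -(p / 2) * d = 0 by ring, Real.rpow_zero,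
            mul_one]
  rw [← ofReal_norm, ENNReal.ofReal_rpow_of_nonneg (norm_nonneg _) hp,
    ← ENNReal.ofReal_mul (by positivity), ← ENNReal.ofReal_mul (by positivity)]
  exact ENNReal.ofReal_le_ofReal h2

variable [IsManifold 𝓘(ℂ, Fin n → ℂ) ω X] [MeasurableSpace X] [BorelSpace X] [CompactSpace X]
  {I J : Type*} [Fintype I] [Fintype J] {E : I → Set X} {B : J → Set X}

/-- In an adapted chart the right hand side of the inequality on the polydisc is bounded by the
weighted integral of the gradient. -/
theorem exists_lintegral_partialFDeriv_le (G : SmoothMetric n X)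
    (hEB : IsSNC n (Sum.elim E B)) {b : J → ℝ}
    (hE : ∀ α, HermitianMetric n (E α)) (hB : ∀ β, HermitianMetric n (B β)) {ε₀ : ℝ}
    {g : ℝ → BilinField n X}
    (hsymm : ∀ ε ∈ Icc 0 ε₀, ∀ x ∈ regularSet B ε, ∀ v w : RealTangent n x, g ε x v w = g ε x w v)
    (hpos : ∀ ε ∈ Icc 0 ε₀, ∀ x ∈ regularSet B ε, ∀ v : RealTangent n x, v ≠ 0 → 0 < g ε x v v)
    {q : I → ℝ} (hq : ∀ α, 0 ≤ q α) {p : ℝ} (hp : 0 ≤ p) {x : X}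
    {φ : OpenPartialHomeomorph X (Fin n → ℂ)} {κ : I ⊕ J → Option (Fin n)}
    (h : IsAdaptedChart (Sum.elim E B) x φ κ) {V : Set X} (hV : V ∈ 𝓝 x) {A : ℝ} (hA : 0 < A)
    (hgA : ∀ ε ∈ Icc 0 ε₀, ∀ y ∈ V ∩ regularSet B ε, ∀ v : RealTangent n y,
      g ε y v v ≤ A * modelMetric b κ ε (φ y)
        (mfderiv 𝓘(ℝ, Fin n → ℂ) 𝓘(ℝ, Fin n → ℂ) φ y v)) :
    ∃ K : ℝ≥0∞, K ≠ ⊤ ∧ ∀ᶠ R in 𝓝[>] (0 : ℝ), ∀ ε ∈ Icc 0 ε₀, ∀ f : X → ℂ,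
      ContMDiff 𝓘(ℝ, Fin n → ℂ) 𝓘(ℝ, ℂ) ∞ f → ∀ F : (Fin n → ℂ) → ℂ, ContDiff ℝ 1 F →
      EqOn F (f ∘ φ.symm) (Metric.ball 0 R) → ∀ j,
      ∫⁻ z, ‖partialFDeriv F j z‖ₑ ^ p * ENNReal.ofReal ((ε ^ 2 + ‖z j‖ ^ 2) ^
          (-(p / 2) * chartExponent κ q b j)) ∂polydiscMeasure ε (chartExponent κ q b) R ≤
        K * ∫⁻ y, ENNReal.ofReal (gradNorm (g ε) f y ^ p)
          ∂weightedVolume G.inner hE hB b (scaledIndex q p) ε := by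
  obtain ⟨K, hK, hev⟩ := exists_weightedVolume_comparable G hEB hE hB h b (scaledIndex q p) ε₀
  have h0t : (0 : Fin n → ℂ) ∈ φ.target := h.centred ▸ φ.map_source h.mem_source
  obtain ⟨δ, hδ, hball⟩ := Metric.isOpen_iff.1 φ.open_target 0 h0t
  obtain ⟨Λ, hΛ⟩ : ∃ Λ : ℝ, Λ = 1 + ε₀ ^ 2 := ⟨_, rfl⟩
  obtain ⟨Q, hQ⟩ : ∃ Q : ℝ, Q =
    ∏ k : Fin n, Λ ^ (p / 2 * coordExponent (fun α => κ (Sum.inl α)) q k) := ⟨_, rfl⟩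
  have hΛ1 : 1 ≤ Λ := by rw [hΛ]; nlinarith [sq_nonneg ε₀]
  have hQ0 : 0 ≤ Q := hQ ▸ Finset.prod_nonneg fun k _ => by positivity
  refine ⟨ENNReal.ofReal Q * (K * ENNReal.ofReal (A ^ (p / 2))), by finiteness, ?_⟩
  filter_upwards [hev, eventually_chartBall_subset h.mem_source h.centred hV,
    Ioo_mem_nhdsGT (lt_min one_pos hδ)] with R hR hRV hRI ε hε f hf F hFc hF j
  have hsub : Metric.ball (0 : Fin n → ℂ) R ⊆ φ.target :=
    (Metric.ball_subset_ball (hRI.2.le.trans (min_le_right _ _))).trans hball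
  have hpc : Continuous (partialFDeriv F j) := by
    unfold partialFDeriv
    exact (hFc.continuous_fderiv (by simp)).clm_comp continuous_const
  have hpm : Measurable fun z => ‖partialFDeriv F j z‖ₑ ^ p := (hpc.enorm.measurable).pow_const p
  have hTm : ∀ e : ℝ, Measurable fun z : Fin n → ℂ =>
      ENNReal.ofReal ((ε ^ 2 + ‖z j‖ ^ 2) ^ e) := fun e => by fun_prop
  have hne : ∀ᵐ z : Fin n → ℂ, ∀ k, z k ≠ 0 := ae_all_iff.2 fun k => by
    rw [volume_pi]
    exact Measure.ae_eval_ne (fun _ : Fin n => (volume : Measure ℂ)) k 0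
  have hac : (weightedVolume G.inner hE hB b (scaledIndex q p) ε).restrict (chartBall φ R) ≪
      (riemannianVolume G.inner).restrict (chartBall φ R) :=
    (withDensity_absolutelyContinuous _ _).restrict _
  obtain ⟨H, hH⟩ : ∃ H : (Fin n → ℂ) → ℝ≥0∞, H = fun z => ‖partialFDeriv F j z‖ₑ ^ p *
      ENNReal.ofReal ((ε ^ 2 + ‖z j‖ ^ 2) ^
        (-(p / 2) * coordExponent (fun β => κ (Sum.inr β)) (fun β => -b β) j)) := ⟨_, rfl⟩
  have hHm : Measurable H := hH ▸ hpm.mul (hTm _)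
  calc _ = ∫⁻ z in Metric.ball 0 R, ENNReal.ofReal (∏ k, (ε ^ 2 + ‖z k‖ ^ 2) ^
          chartExponent κ q b k) * (‖partialFDeriv F j z‖ₑ ^ p *
            ENNReal.ofReal ((ε ^ 2 + ‖z j‖ ^ 2) ^ (-(p / 2) * chartExponent κ q b j))) :=
        lintegral_polydiscMeasure _ _ _ (hpm.mul (hTm _))
    _ ≤ ∫⁻ z in Metric.ball 0 R, ENNReal.ofReal Q * (ENNReal.ofReal (∏ k, (ε ^ 2 + ‖z k‖ ^ 2) ^
          chartExponent κ (scaledIndex q p) b k) * H z) := by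
        refine lintegral_mono_ae ?_
        filter_upwards [ae_restrict_of_ae hne, ae_restrict_mem Metric.isOpen_ball.measurableSet]
          with z hz hzR
        have hT : ∀ k, 0 < ε ^ 2 + ‖z k‖ ^ 2 := fun k => by
          have := norm_pos_iff.2 (hz k)
          positivity
        have hTΛ : ∀ k, ε ^ 2 + ‖z k‖ ^ 2 ≤ Λ := fun k => by
          have h0 := hε.1
          have e1 : ε ^ 2 ≤ ε₀ ^ 2 := by have := hε.2; gcongr
          have e2 : ‖z k‖ ≤ 1 := (norm_le_pi_norm z k).trans
            ((mem_ball_zero_iff.1 hzR).le.trans (hRI.2.le.trans (min_le_left _ _)))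
          have e3 : ‖z k‖ ^ 2 ≤ 1 := pow_le_one₀ (norm_nonneg _) e2
          rw [hΛ]
          linarith
        have h1 := rpow_mul_prod_chartExponent_le κ hq b hp hT hTΛ hΛ1 j
        rw [← hQ] at h1
        have h2 := mul_le_mul_right (ENNReal.ofReal_le_ofReal h1) (‖partialFDeriv F j z‖ₑ ^ p)
        have hP : ∀ e : Fin n → ℝ, 0 ≤ ∏ k, (ε ^ 2 + ‖z k‖ ^ 2) ^ e k := fun e =>
          Finset.prod_nonneg fun k _ => Real.rpow_nonneg (hT k).le _
        rw [ENNReal.ofReal_mul (hP _), ENNReal.ofReal_mul hQ0, ENNReal.ofReal_mul (hP _)] at h2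
        simp only [hH]
        convert h2 using 1 <;> ring
    _ = ENNReal.ofReal Q * ∫⁻ z, H z
          ∂polydiscMeasure ε (chartExponent κ (scaledIndex q p) b) R := by
        rw [lintegral_const_mul' _ _ (by simp), lintegral_polydiscMeasure _ _ _ hHm]
    _ ≤ ENNReal.ofReal Q * (K * ∫⁻ y in chartBall φ R, H (φ y)
          ∂weightedVolume G.inner hE hB b (scaledIndex q p) ε) :=
        mul_le_mul_right (hR ε hε H hHm).2 _
    _ ≤ ENNReal.ofReal Q * (K * ∫⁻ y in chartBall φ R, ENNReal.ofReal (A ^ (p / 2)) *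
          ENNReal.ofReal (gradNorm (g ε) f y ^ p)
          ∂weightedVolume G.inner hE hB b (scaledIndex q p) ε) := by
        refine mul_le_mul_right (mul_le_mul_right (lintegral_mono_ae ?_) _) _
        filter_upwards [hac (ae_chart_ne_zero G h.mem_maximalAtlas hsub),
          ae_restrict_mem (isOpen_chartBall φ R).measurableSet] with y hy hyR
        -- For `ε = 0` the metric is only defined off the `B β`, that is, almost everywhere.
        have hreg := mem_regularSet_of_chart_ne_zero h hyR.1 hy ε
        rw [hH]
        exact enorm_partialFDeriv_rpow_mul_le hA hp h.mem_maximalAtlas hyR.1 (hsymm ε hε y hreg)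
          (hpos ε hε y hreg) (hgA ε hε y ⟨hRV hyR, hreg⟩) (hf.mdifferentiableAt (by simp))
          (hF.eventuallyEq_of_mem (Metric.isOpen_ball.mem_nhds hyR.2)) j (hy j)
    _ ≤ ENNReal.ofReal Q * (K * (ENNReal.ofReal (A ^ (p / 2)) *
          ∫⁻ y, ENNReal.ofReal (gradNorm (g ε) f y ^ p)
          ∂weightedVolume G.inner hE hB b (scaledIndex q p) ε)) := by
        rw [lintegral_const_mul' _ _ (by simp)]
        exact mul_le_mul_right (mul_le_mul_right (mul_le_mul_right
          (setLIntegral_le_lintegral _ _) _) _) _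
    _ = _ := by ring

/-- The local form of the inequality, uniformly in `ε` and in the function. -/
theorem exists_oscControlled_nhds (G : SmoothMetric n X)
    (hEB : IsSNC n (Sum.elim E B)) {b : J → ℝ} (hb : ∀ β, b β < 1)
    (hE : ∀ α, HermitianMetric n (E α)) (hB : ∀ β, HermitianMetric n (B β)) {ε₀ : ℝ}
    {g : ℝ → BilinField n X} (hg : IsConicRegularization E B b ε₀ g)
    {q : I → ℝ} (hq : ∀ α, 0 ≤ q α) {p : ℝ} (hp : 1 ≤ p) (x : X) :
    ∃ U ∈ 𝓝 x, OscControlled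
      (T := {t : ℝ × (X → ℂ) // t.1 ∈ Icc 0 ε₀ ∧ ContMDiff 𝓘(ℝ, Fin n → ℂ) 𝓘(ℝ, ℂ) ∞ t.2})
      (fun t => weightedVolume G.inner hE hB b q t.1.1) (fun t => t.1.2)
      (fun t => ∫⁻ y, ENNReal.ofReal (gradNorm (g t.1.1) t.1.2 y ^ p)
        ∂weightedVolume G.inner hE hB b (scaledIndex q p) t.1.1) p U U := by
  obtain ⟨φ, κ, h, V, hV, -, A, hA, hgA⟩ := hg.quasiIsometric x
  obtain ⟨K, hK, hev⟩ := exists_weightedVolume_comparable G hEB hE hB h b q ε₀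
  obtain ⟨K', hK', hev'⟩ := exists_lintegral_partialFDeriv_le G hEB hE hB hg.symm hg.pos hq
    (by linarith : 0 ≤ p) h hV hA fun ε hε y hy v => (hgA ε hε y hy v).2
  have h0t : (0 : Fin n → ℂ) ∈ φ.target := h.centred ▸ φ.map_source h.mem_source
  obtain ⟨δ, hδ, hball⟩ := Metric.isOpen_iff.1 φ.open_target 0 h0t
  obtain ⟨R, ⟨hR, hR'⟩, hRI⟩ := ((hev.and hev').and
    (Ioo_mem_nhdsGT (show 0 < δ / 2 by positivity))).exists
  obtain ⟨C, hC, hpoinc⟩ := exists_polydisc_poincare (ε₀ := ε₀) hp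
    (h.neg_one_lt_chartExponent hb hq) hRI.1
  refine ⟨chartBall φ R, chartBall_mem_nhds h.mem_source h.centred hRI.1,
    K * K * (C * (n * K')), by finiteness, ?_⟩
  rintro ⟨⟨ε, f⟩, hε, hf⟩
  dsimp only at hε hf ⊢
  have hsub : Metric.closedBall (0 : Fin n → ℂ) (2 * R) ⊆ φ.target :=
    (Metric.closedBall_subset_ball (by linarith [hRI.2])).trans hball
  obtain ⟨F, hFc, hF⟩ := exists_contDiff_eqOn_ball h.mem_maximalAtlas hRI.1 hsub hf
  have hfF : ∀ y ∈ chartBall φ R, f y = F (φ y) := fun y hy => by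
    rw [hF hy.2, Function.comp_apply, φ.left_inv hy.1]
  have hU := (isOpen_chartBall φ R).measurableSet
  have hFm := hFc.continuous.measurable
  have hpair := measurable_enorm_sub_rpow hFm p
  obtain ⟨ρ, hρ⟩ : ∃ ρ, ρ = polydiscMeasure ε (chartExponent κ q b) R := ⟨_, rfl⟩
  have hρs : SFinite ρ := by
    rw [hρ, polydiscMeasure]
    infer_instance
  have hmain := hpoinc ε hε F hFc
  rw [← hρ] at hmain
  calc _ = ∫⁻ x in chartBall φ R, (∫⁻ y in chartBall φ R, ‖F (φ x) - F (φ y)‖ₑ ^ p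
          ∂weightedVolume G.inner hE hB b q ε) ∂weightedVolume G.inner hE hB b q ε := by
        refine setLIntegral_congr_fun hU fun x hx => setLIntegral_congr_fun hU fun y hy => ?_
        simp only [hfF x hx, hfF y hy]
    _ ≤ ∫⁻ x in chartBall φ R, K * (∫⁻ ζ, ‖F (φ x) - F ζ‖ₑ ^ p ∂ρ)
          ∂weightedVolume G.inner hE hB b q ε := lintegral_mono fun x => hρ ▸
        (hR ε hε (fun ζ => ‖F (φ x) - F ζ‖ₑ ^ p)
          (((measurable_const.sub hFm).enorm).pow_const p)).1
    _ ≤ K * ∫⁻ z, K * (∫⁻ ζ, ‖F z - F ζ‖ₑ ^ p ∂ρ) ∂ρ := hρ ▸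
        (hR ε hε (fun z => K * ∫⁻ ζ, ‖F z - F ζ‖ₑ ^ p ∂ρ)
          (hpair.lintegral_prod_right'.const_mul _)).1
    _ = K * K * ∫⁻ z, (∫⁻ ζ, ‖F z - F ζ‖ₑ ^ p ∂ρ) ∂ρ := by
        rw [lintegral_const_mul _ hpair.lintegral_prod_right', mul_assoc]
    _ ≤ K * K * (C * ∑ _j : Fin n, (K' * ∫⁻ y, ENNReal.ofReal (gradNorm (g ε) f y ^ p)
          ∂weightedVolume G.inner hE hB b (scaledIndex q p) ε)) := by
        refine mul_le_mul_right (hmain.trans (mul_le_mul_right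
          (Finset.sum_le_sum fun j _ => ?_) _)) _
        rw [hρ]
        exact hR' ε hε f hf F hFc hF j
    _ = _ := by
        rw [Finset.sum_const, Finset.card_univ, Fintype.card_fin, nsmul_eq_mul]
        ring

end Local

end WeakPoincare

end

open WeakPoincare in
theorem proposition2p2
    {n : ℕ} {X : Type*} [TopologicalSpace X] [T2Space X] [CompactSpace X] [ConnectedSpace X]
    [MeasurableSpace X] [BorelSpace X]
    [ChartedSpace (Fin n → ℂ) X] [IsManifold 𝓘(ℂ, Fin n → ℂ) ω X]
    (G : SmoothMetric n X) (hG : IsKahler G)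
    {I J : Type*} [Fintype I] [Fintype J] (E : I → Set X) (B : J → Set X)
    (hEB : IsSNC n (Sum.elim E B))
    (b : J → ℝ) (hb : ∀ β, b β ∈ Ico (0 : ℝ) 1)
    (hE : ∀ α, HermitianMetric n (E α)) (hB : ∀ β, HermitianMetric n (B β))
    (ε₀ : ℝ) (hε₀ : 0 < ε₀)
    (g : ℝ → BilinField n X) (hg : IsConicRegularization E B b ε₀ g)
    (q : I → ℝ) (hq : ∀ α, 0 ≤ q α) (p : ℝ) (hp : 1 ≤ p) :
    ∃ C : ℝ, 0 < C ∧ ∀ ε ∈ Icc 0 ε₀, ∀ f : X → ℂ,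
      ContMDiff 𝓘(ℝ, Fin n → ℂ) 𝓘(ℝ, ℂ) ∞ f →
        ∫⁻ x, ENNReal.ofReal
            (‖f x - ⨍ y, f y ∂(weightedVolume G.inner hE hB b q ε)‖ ^ p)
            ∂(weightedVolume G.inner hE hB b q ε)
          ≤ ENNReal.ofReal C *
            ∫⁻ x, ENNReal.ofReal (gradNorm (g ε) f x ^ p)
              ∂(weightedVolume G.inner hE hB b (scaledIndex q p) ε) := by
  have hb' : ∀ β, b β < 1 := fun β => (hb β).2
  obtain ⟨M, hM, hMε⟩ := exists_weightedVolume_univ_le G hEB hE hB hb' hq ε₀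
  have hlow := fun (O : Set X) => exists_le_weightedVolume G hEB hE hB b q ε₀ (O := O)
  obtain ⟨m, hm, hmε⟩ := hlow univ isOpen_univ univ_nonempty
  have hfin : ∀ t : {t : ℝ × (X → ℂ) // t.1 ∈ Icc 0 ε₀ ∧
      ContMDiff 𝓘(ℝ, Fin n → ℂ) 𝓘(ℝ, ℂ) ∞ t.2},
      IsFiniteMeasure (weightedVolume G.inner hE hB b q t.1.1) :=
    fun t => ⟨(hMε _ t.2.1).trans_lt hM.lt_top⟩
  have hosc := oscControlled_univ hp hM (fun t => hMε _ t.2.1)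
    (fun t => t.2.2.continuous.measurable)
    (fun O hO hne => (hlow O hO hne).imp fun m h => ⟨h.1, fun t => h.2 _ t.2.1⟩)
    (exists_oscControlled_nhds G hEB hb' hE hB hg hq hp)
  obtain ⟨C, hC, h⟩ := average_le_of_oscControlled hp hm (fun t => hmε _ t.2.1)
    (fun t => t.2.2.continuous.measurable)
    (fun t => t.2.2.continuous.integrable_of_hasCompactSupport
      (HasCompactSupport.of_compactSpace _)) hosc
  refine ⟨C.toReal + 1, by positivity, fun ε hε f hf => ?_⟩
  have hfp : ∀ w : ℂ, ENNReal.ofReal (‖w‖ ^ p) = ‖w‖ₑ ^ p := fun w => by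
    rw [← ofReal_norm, ENNReal.ofReal_rpow_of_nonneg (norm_nonneg _) (by linarith)]
  simp only [hfp]
  refine (h ⟨(ε, f), hε, hf⟩).trans (mul_le_mul_left ?_ _)
  rw [← ENNReal.ofReal_toReal hC]
  exact ENNReal.ofReal_le_ofReal (by rw [ENNReal.ofReal_toReal hC]; linarith)
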